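/- Let $d\ge 1$ and $0<s<\min\{1,\tfrac d2\}$. \textbf{Kernels.} A function $g:\mathbf R^d\to\mathbf R$ is a \emph{Riesz-type kernel of order $s$} if there are an integer $m\ge 0$, a function $G:\mathbf R^{d+m}\to\mathbf R$ and constants $C_1,C_2>0$, $C\ge 0$ such that (1) $G(x,0)=g(x)$ for all $x$; (2) $G(X)=G(-X)$ for $X\ne0$; (3) $\lim_{X\to0}G(X)=\infty$; (4) $\Delta G\le 0$ in some ball $B(0,r_0)\subset\mathbf R^{d+m}$, in the sense of distributions; (5) $|G(X)|\le C|X|^{-(d-2s)}$ for $X\neq 0$; (6) $G$ is differentiable away from $0$ and $|\nabla G(X)|\le C|X|^{-(d-2s+1)}$ for $X\neq 0$; (7) $C_1|\Xi|^{-(m+2s)}\le\widehat G(\Xi)\le C_2|\Xi|^{-(m+2s)}$; (8) $C_1|\xi|^{-2s}\le\widehat g(\xi)\le C_2|\xi|^{-2s}$; (9) there are $c_s<1$ and $r_0>0$ such that $G(Y)<c_sG(X)$ for all $X,Y\in B(0,r_0)\setminus\{0\}$ with $|Y|\ge2|X|$; (10) away from $0$ the tempered distribution $\mathfrak F(1/\widehat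 g)$ is a function $h$ with $C_1|x|^{-(d+2s)}\le|h(x)|\le C_2|x|^{-(d+2s)}$. (Fourier transforms are those of tempered distributions.) \textbf{Energies.} With the convention $g(0)=+\infty$ put $$\mathcal E(\kappa)=\iint g(x-y)\,d(\kappa\otimes\kappa)(x,y)$$ for a finite signed measure $\kappa$ (an extended integral; $\mathcal E(\kappa)=+\infty$ if it has the form $\infty-\infty$), and $\mathcal E_V(\mu)=\mathcal E(\mu)+\int V\,d\mu$ for a probability measure $\mu$. Let $\mu_\infty$ denote the minimizer of $\mathcal E_V$ among all probability measures on $\mathbf R^d$. \textbf{Potentials.} $V:\mathbf R^d\to\mathbf R$ is \emph{admissible} if $V\in C^2$, $V(x)\to\infty$ as $|x|\to\infty$, $\int e^{-\beta V}dx<\infty$ for every $\beta>0$, and $\mu_\infty$ has a bounded density. (If $d=2$ and $g=-\frac1{2\pi}\log|x|$ one also asks that $V(x)-\log|x|\to\infty$.) \textbf{Norms.} For a metric space $\Omega$, $f\in C(\Omega)$ and a finite signed measure $\kappa$ on $\Omega$, $$|f|_{\dot C^{0,\alpha}}=\sup_{x\ne y}\frac{|f(x)-f(y)|}{|x-y|^\alpha},\qquad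 \|f\|_{C^{0,\alpha}}=|f|_{\dot C^{0,\alpha}}+\sup|f|,$$ $$\|\kappa\|_{\dot C^{0,\alpha}_*}=\sup_{|f|_{\dot C^{0,\alpha}}<\infty}\frac{\int f\,d\kappa}{|f|_{\dot C^{0,\alpha}}},\qquad \|\kappa\|_{C^{0,\alpha}_*}=\sup_{\|f\|_{C^{0,\alpha}}<\infty}\frac{\int f\,d\kappa}{\|f\|_{C^{0,\alpha}}},$$ with $0/0=0$ and $c/0=\infty$ for $c>0$. \textbf{Theorem.} Let $g$ be a Riesz-type kernel of order $s$ and let $\alpha>s$. 1. For every compact $\Omega\subset\mathbf R^d$ there is a constant $C_{\alpha,\Omega}$, depending only on $g,\alpha,\Omega$, such that for all probability measures $\mu,\nu$ on $\Omega$ $$\|\mu-\nu\|_{\dot C^{0,\alpha}_*}^2\le C_{\alpha,\Omega}\,\mathcal E(\mu-\nu),$$ where the norm is taken on $\Omega$. Let moreover $V$ be admissible. 2. There is a constant $C_\alpha$, depending only on $V,g,\alpha$, such that for all probability measures $\mu$ on $\mathbf R^d$ $$\|\mu-\mu_\infty\|_{C^{0,\alpha}_*}^2\le C_\alpha\big(\mathcal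 E_V(\mu)-\mathcal E_V(\mu_\infty)\big).$$ 3. If $\liminf_{|x|\to\infty}V(x)/|x|^{2\alpha}>0$, there is a constant $C_\alpha$, depending only on $V,g,\alpha$, such that for all probability measures $\mu$ on $\mathbf R^d$ $$\|\mu-\mu_\infty\|_{\dot C^{0,\alpha}_*}^2\le C_\alpha\big(\mathcal E_V(\mu)-\mathcal E_V(\mu_\infty)\big).$$ -/

import Mathlib

open MeasureTheory Filter Topology
open scoped ENNReal NNReal ContDiff FourierTransform SchwartzMap Laplacian

noncomputable section

namespace RieszGas

/-! ### Extended integrals against differences of measures -/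

/-- The extended integral of `f` against `p - n`, where `p` and `n` are the positive and the
negative part of a signed measure. It is the usual extended Lebesgue integral whenever that is
defined; the undefined case `∞ - ∞` is given the value `+∞`. -/
def extIntegral {X : Type*} [MeasurableSpace X] (f : X → EReal) (p n : Measure X) : EReal :=
  let a : ℝ≥0∞ := ∫⁻ x, (f x).toENNReal ∂p + ∫⁻ x, (-f x).toENNReal ∂n
  let b : ℝ≥0∞ := ∫⁻ x, (-f x).toENNReal ∂p + ∫⁻ x, (f x).toENNReal ∂n
  if a = ⊤ then ⊤ else (a : EReal) - (b : EReal)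

/-- The positive part of the Jordan decomposition. -/
def posPart {X : Type*} [MeasurableSpace X] (κ : SignedMeasure X) : Measure X :=
  κ.toJordanDecomposition.posPart

/-- The negative part of the Jordan decomposition. -/
def negPart {X : Type*} [MeasurableSpace X] (κ : SignedMeasure X) : Measure X :=
  κ.toJordanDecomposition.negPart

/-- The extended integral `∫ f dκ` of a real function against a signed measure. -/
def sintegral {X : Type*} [MeasurableSpace X] (f : X → ℝ) (κ : SignedMeasure X) : EReal :=
  extIntegral (fun x => (f x : EReal)) (posPart κ) (negPart κ)

/-- A probability measure seen as a signed measure. -/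
def toSigned {X : Type*} [MeasurableSpace X] (μ : ProbabilityMeasure X) : SignedMeasure X :=
  (μ : Measure X).toSignedMeasure

/-! ### Hölder norms and their duals -/

/-- The full Hölder norm `|f|_{Ċ^{0,α}} + ‖f‖_∞`; the seminorm is Mathlib's `eHolderNorm`. -/
def fullHolderNorm {X : Type*} [MetricSpace X] (α : ℝ≥0) (f : X → ℝ) : ℝ≥0∞ :=
  eHolderNorm α f + ⨆ x, ‖f x‖ₑ

/-- The homogeneous dual Hölder norm: the supremum of `∫ f dκ / |f|_{Ċ^{0,α}}` over continuous `f`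
with finite Hölder seminorm. In `ℝ≥0∞` one has `0 / 0 = 0` and `c / 0 = ∞` for `c > 0`, and the
supremum is not changed by truncating negative values of the integral at `0`. -/
def dualHolderSeminorm {X : Type*} [MetricSpace X] [MeasurableSpace X]
    (α : ℝ≥0) (κ : SignedMeasure X) : ℝ≥0∞ :=
  ⨆ (f : C(X, ℝ)) (_ : eHolderNorm α f < ⊤), (sintegral f κ).toENNReal / eHolderNorm α f

/-- The dual of the full Hölder norm: the supremum of `∫ f dκ / ‖f‖_{C^{0,α}}` over continuous `f`
with finite full Hölder norm. -/
def dualHolderNorm {X : Type*} [MetricSpace X] [MeasurableSpace X]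
    (α : ℝ≥0) (κ : SignedMeasure X) : ℝ≥0∞ :=
  ⨆ (f : C(X, ℝ)) (_ : fullHolderNorm α f < ⊤), (sintegral f κ).toENNReal / fullHolderNorm α f

/-! ### Riesz-type kernels -/

/-- `ℝ^d` with the Euclidean norm. -/
abbrev Space (d : ℕ) : Type := EuclideanSpace ℝ (Fin d)

/-- `ℝ^{d+m}`, with the first `d` and the last `m` coordinates kept apart. -/
abbrev ExtSpace (d m : ℕ) : Type := EuclideanSpace ℝ (Fin d ⊕ Fin m)

/-- The inclusion `x ↦ (x, 0)` of `ℝ^d` into `ℝ^{d+m}`. -/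
def incl (d m : ℕ) (x : Space d) : ExtSpace d m :=
  WithLp.toLp 2 (Sum.elim (fun i => x i) (fun _ => 0))

/-- The locally integrable function `w` is the Fourier transform of the locally integrable function
`u`, in the sense of tempered distributions. -/
def IsFourierTransform {ι : Type*} [Fintype ι] (u w : EuclideanSpace ℝ ι → ℝ) : Prop :=
  ∀ φ : 𝓢(EuclideanSpace ℝ ι, ℂ), ∫ x, (u x : ℂ) * (𝓕 φ) x = ∫ ξ, (w ξ : ℂ) * φ ξ

/-- Away from the origin, the tempered distribution which is the Fourier transform of `u` is the
function `h`. -/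
def IsFourierTransformAwayFromZero {ι : Type*} [Fintype ι] (u h : EuclideanSpace ℝ ι → ℝ) : Prop :=
  ∀ φ : 𝓢(EuclideanSpace ℝ ι, ℂ), (0 : EuclideanSpace ℝ ι) ∉ tsupport φ →
    ∫ ξ, (u ξ : ℂ) * (𝓕 φ) ξ = ∫ x, (h x : ℂ) * φ x

/-- `ΔG ≤ 0` in the open set `U`, in the sense of distributions. -/
def LaplacianNonposOn {ι : Type*} [Fintype ι] (G : EuclideanSpace ℝ ι → ℝ)
    (U : Set (EuclideanSpace ℝ ι)) : Prop :=
  ∀ φ : EuclideanSpace ℝ ι → ℝ, ContDiff ℝ ∞ φ → HasCompactSupport φ → tsupport φ ⊆ U →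
    (∀ X, 0 ≤ φ X) → ∫ X, G X * (Δ φ) X ≤ 0

/-- `g` is a Riesz-type kernel of order `s` on `ℝ^d`. The value `g 0` is irrelevant
(see `kernel`). -/
def IsRieszType (d : ℕ) (s : ℝ) (g : Space d → ℝ) : Prop :=
  ∃ (m : ℕ) (G : ExtSpace d m → ℝ) (C₁ C₂ C : ℝ), 0 < C₁ ∧ 0 < C₂ ∧ 0 ≤ C ∧
    (∀ x, G (incl d m x) = g x) ∧
    (∀ X, X ≠ 0 → G X = G (-X)) ∧
    Tendsto G (𝓝[≠] 0) atTop ∧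
    (∃ r₀ > 0, LaplacianNonposOn G (Metric.ball 0 r₀)) ∧
    (∀ X, X ≠ 0 → |G X| ≤ C / ‖X‖ ^ ((d : ℝ) - 2 * s)) ∧
    (∀ X, X ≠ 0 → DifferentiableAt ℝ G X ∧ ‖fderiv ℝ G X‖ ≤ C / ‖X‖ ^ ((d : ℝ) - 2 * s + 1)) ∧
    (∃ Ghat : ExtSpace d m → ℝ, Measurable Ghat ∧ IsFourierTransform G Ghat ∧
      ∀ Ξ, Ξ ≠ 0 → C₁ / ‖Ξ‖ ^ ((m : ℝ) + 2 * s) ≤ Ghat Ξ ∧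
        Ghat Ξ ≤ C₂ / ‖Ξ‖ ^ ((m : ℝ) + 2 * s)) ∧
    (∃ c < (1 : ℝ), ∃ r₀ > 0, ∀ X ∈ Metric.ball (0 : ExtSpace d m) r₀,
      ∀ Y ∈ Metric.ball (0 : ExtSpace d m) r₀, X ≠ 0 → Y ≠ 0 → 2 * ‖X‖ ≤ ‖Y‖ → G Y < c * G X) ∧
    (∃ ghat : Space d → ℝ, Measurable ghat ∧ IsFourierTransform g ghat ∧
      (∀ ξ, ξ ≠ 0 → C₁ / ‖ξ‖ ^ (2 * s) ≤ ghat ξ ∧ ghat ξ ≤ C₂ / ‖ξ‖ ^ (2 * s)) ∧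
      ∃ h : Space d → ℝ, Measurable h ∧
        IsFourierTransformAwayFromZero (fun ξ => 1 / ghat ξ) h ∧
        ∀ x, x ≠ 0 → C₁ / ‖x‖ ^ ((d : ℝ) + 2 * s) ≤ |h x| ∧
          |h x| ≤ C₂ / ‖x‖ ^ ((d : ℝ) + 2 * s))

/-! ### Energies and the equilibrium measure -/

/-- The interaction kernel with its singular value `g(0) = +∞`. -/
def kernel {d : ℕ} (g : Space d → ℝ) (x : Space d) : EReal :=
  open Classical in if x = 0 then ⊤ else (g x : EReal)

/-- The self-interaction energy `∬ g(x - y) d(κ ⊗ κ)(x, y)` of a signed measure. -/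
def energy {d : ℕ} (g : Space d → ℝ) (κ : SignedMeasure (Space d)) : EReal :=
  extIntegral (fun z : Space d × Space d => kernel g (z.1 - z.2))
    ((posPart κ).prod (posPart κ) + (negPart κ).prod (negPart κ))
    ((posPart κ).prod (negPart κ) + (negPart κ).prod (posPart κ))

/-- The mean field energy `𝓔_V(μ) = 𝓔(μ) + ∫ V dμ` of a probability measure. -/
def energyV {d : ℕ} (g V : Space d → ℝ) (μ : ProbabilityMeasure (Space d)) : EReal :=
  energy g (toSigned μ) + sintegral V (toSigned μ)

/-- `μ` is an equilibrium measure: it minimizes `𝓔_V` among all probability measures. -/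
def IsEquilibriumMeasure {d : ℕ} (g V : Space d → ℝ) (μ : ProbabilityMeasure (Space d)) : Prop :=
  ∀ ν : ProbabilityMeasure (Space d), energyV g V μ ≤ energyV g V ν

/-- Admissible potentials. -/
structure Admissible {d : ℕ} (g V : Space d → ℝ) : Prop where
  contDiff : ContDiff ℝ 2 V
  tendsto : Tendsto V (cocompact (Space d)) atTop
  integrable_exp : ∀ β : ℝ, 0 < β → Integrable (fun x => Real.exp (-β * V x)) volume
  /-- The equilibrium measure has a bounded density. -/
  bounded_density : ∀ μ : ProbabilityMeasure (Space d), IsEquilibriumMeasure g V μ →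
    ∃ ρ : Space d → ℝ, MemLp ρ ∞ volume ∧
      (μ : Measure (Space d)) = volume.withDensity (fun x => ENNReal.ofReal (ρ x))
  /-- An additional growth condition for the two-dimensional Coulomb kernel. -/
  coulomb_two : d = 2 → (∀ x, x ≠ 0 → g x = -(1 / (2 * Real.pi)) * Real.log ‖x‖) →
    Tendsto (fun x => V x - Real.log ‖x‖) (cocompact (Space d)) atTop

end RieszGas

end

noncomputable section

namespace RieszGas

/-! Write `a = d - 2s`. For a difference `κ = p - q` of finite measures the energy is formally `∫ ĝ
|κ̂|²`, which is at least `C₁ ∫ ‖ξ‖^(-2s) |κ̂|²`, a squared Sobolev norm of order `-s`. A compactly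
supported Hölder function `F` of exponent `β > s` has finite Sobolev norm of order `s` (Gagliardo's
double integral and Plancherel), and Cauchy–Schwarz in `ξ` bounds `(∫ F dκ)²` by a constant times
the energy: `exists_sq_integral_sub_le`. The exponent used is `β = min α 1`, which exceeds `s`
because `s < 1`.

The work lies in justifying the Fourier formula for measures that merely have finite energy. The
kernel is averaged at scale `ε` against a probability density `ψ ≥ 0` whose transform `φ` satisfies
`0 ≤ φ ≤ 1`; the averaged kernel is bounded and Fubini applies. Letting `ε → 0` requires a majorant
`B (|g| + 1)` uniform in `ε`. The upper bound on `g` gives a majorant `B ‖z‖^(-a)`, so a matching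
lower bound on `g` near the origin is needed, and it has to be extracted from the axioms. Since `ĝ ≥
C₁ ‖ξ‖^(-2s)`, the average of `g` around `0` at scale `ε` is at least `c ε^(-a)`; hence `g` is that
large at some point of an annulus of size `ε`, and the decay condition (9) transfers this to points
nearer the origin (`exists_lower_bound`). Positivity on the Fourier side together with Fatou makes
cross interactions finite (`integrable_cross`) and gives the Sobolev bound (`negSobolevSq_le`).

On a compact set a test function is shifted by a constant, which integrates to zero against a
difference of probability measures, extended by McShane's formula and cut off.

On the whole space, the first variation at the equilibrium measure, tested on the part of `μ` inside
a ball, shows that the energy excess dominates `𝓔(μ - μ_∞)` plus the integral of `V - B` outside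
that ball (`energy_sub_add_setIntegral_le`). The first term controls the truncated test function.
The second controls the remainder, because outside the ball `(f(x) - f(0))²` is at most a multiple
of `V(x) - B`: for bounded `f` since `V → ∞`, for `f` of growth `‖x‖^α` since `V` grows at least
like `‖x‖^(2α)`. -/

/-- The character `e^{2πi x·ξ}`. -/
def expInner {d : ℕ} (x ξ : Space d) : ℂ := (𝐞 (inner ℝ x ξ) : ℂ)

@[simp]
lemma norm_expInner {d : ℕ} (x ξ : Space d) : ‖expInner x ξ‖ = 1 := Circle.norm_coe _

lemma expInner_add {d : ℕ} (x y ξ : Space d) :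
    expInner (x + y) ξ = expInner x ξ * expInner y ξ := by
  simp [expInner, inner_add_left, AddChar.map_add_eq_mul]

lemma expInner_neg {d : ℕ} (x ξ : Space d) :
    expInner (-x) ξ = starRingEnd ℂ (expInner x ξ) := by
  simp [expInner, inner_neg_left, AddChar.map_neg_eq_inv]

lemma expInner_smul_comm {d : ℕ} (r : ℝ) (x ξ : Space d) :
    expInner (r • x) ξ = expInner x (r • ξ) := by
  simp [expInner, inner_smul_left, inner_smul_right]

lemma continuous_expInner {d : ℕ} : Continuous fun z : Space d × Space d => expInner z.1 z.2 := by
  unfold expInner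
  have : Continuous fun z : Space d × Space d => (inner ℝ z.1 z.2 : ℝ) := by fun_prop
  exact continuous_subtype_val.comp (Real.continuous_fourierChar.comp this)

@[fun_prop]
lemma continuous_expInner_comp {X : Type*} [TopologicalSpace X] {d : ℕ} {f h : X → Space d}
    (hf : Continuous f) (hh : Continuous h) : Continuous fun x => expInner (f x) (h x) :=
  continuous_expInner.comp (hf.prodMk hh)

lemma fourier_eq_integral_expInner {d : ℕ} (f : Space d → ℂ) (ξ : Space d) :
    𝓕 f ξ = ∫ x, expInner (-x) ξ * f x := by
  rw [Real.fourier_eq]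
  simp [expInner, Circle.smul_def]

lemma fourierInv_eq_integral_expInner {d : ℕ} (f : Space d → ℂ) (ξ : Space d) :
    𝓕⁻ f ξ = ∫ x, expInner x ξ * f x := by
  rw [Real.fourierInv_eq]
  simp [expInner, Circle.smul_def]

/-! ### Mollifiers that are nonnegative on both sides of the Fourier transform -/

/-- A Schwartz function `φ ≥ 0` with `φ 0 = 1`, whose Fourier transform `ψ` is nonnegative. -/
structure Mollifier (d : ℕ) where
  toSchwartz : 𝓢(Space d, ℂ)
  φ : Space d → ℝ
  ψ : Space d → ℝ
  coe_eq : ∀ ξ, toSchwartz ξ = (φ ξ : ℂ)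
  fourier_eq : ∀ x, (𝓕 toSchwartz) x = (ψ x : ℂ)
  φ_nonneg : ∀ ξ, 0 ≤ φ ξ
  ψ_nonneg : ∀ x, 0 ≤ ψ x
  φ_zero : φ 0 = 1

/-- Conjugating the transform amounts to the substitution `x ↦ -x`, which leaves `b` unchanged. -/
lemma fourier_real_of_even {d : ℕ} {b : Space d → ℝ} (hb : ∀ x, b (-x) = b x) (ξ : Space d) :
    ((𝓕 (fun x => (b x : ℂ)) ξ).re : ℂ) = 𝓕 (fun x => (b x : ℂ)) ξ := by
  rw [← Complex.conj_eq_iff_re, fourier_eq_integral_expInner, ← integral_conj,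
    ← integral_neg_eq_self]
  congr 1 with x
  simp [hb, expInner_neg]

/-- The autocorrelation `χ * χ` of an even bump `χ ≥ 0` is nonnegative, and its transform is the
square of the real function `𝓕 χ`, hence nonnegative too. Dividing by its value `∫ χ²` at the origin
normalizes it. -/
lemma nonempty_mollifier (d : ℕ) : Nonempty (Mollifier d) := by
  let χ : ContDiffBump (0 : Space d) := ⟨1, 2, by norm_num, by norm_num⟩
  have hcd : ContDiff ℝ ∞ fun x => (χ x : ℂ) := Complex.ofRealCLM.contDiff.comp χ.contDiff
  have hcs : HasCompactSupport fun x => (χ x : ℂ) :=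
    χ.hasCompactSupport.comp_left (g := fun r : ℝ => (r : ℂ)) (by simp)
  let X : 𝓢(Space d, ℂ) := hcs.toSchwartzMap hcd
  have hX : ∀ x, X x = (χ x : ℂ) := fun x => rfl
  let c : 𝓢(Space d, ℂ) := SchwartzMap.convolution (ContinuousLinearMap.mul ℂ ℂ) X X
  let cr : Space d → ℝ := fun x => ∫ t, χ t * χ (x - t)
  have hc : ∀ x, c x = (cr x : ℂ) := by
    intro x
    simp only [c, cr]
    rw [SchwartzMap.convolution_apply, MeasureTheory.convolution, ← integral_complex_ofReal]
    simp [hX]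
  have heven : ∀ x, χ (-x) = χ x := fun x => χ.neg x
  have hc0 : 0 < cr 0 := by
    have h1 : cr 0 = ∫ t, χ t * χ t := by simp [cr, heven]
    rw [h1]
    have hcont : Continuous fun t => χ t * χ t := χ.continuous.mul χ.continuous
    have hsupp : HasCompactSupport fun t => χ t * χ t := χ.hasCompactSupport.mul_right
    refine hcont.integral_pos_of_hasCompactSupport_nonneg_nonzero hsupp
      (fun t => mul_self_nonneg _) (x := 0) ?_
    have : χ 0 = 1 := χ.one_of_mem_closedBall (by simp [χ.rIn_pos.le])
    simp [this]
  have hf : ∀ x, (𝓕 c) x = ((((𝓕 (X : Space d → ℂ) x).re) ^ 2 : ℝ) : ℂ) := by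
    intro x
    have h1 := fourier_real_of_even heven x
    have h2 : 𝓕 c = SchwartzMap.pairing (ContinuousLinearMap.mul ℂ ℂ) (𝓕 X) (𝓕 X) :=
      SchwartzMap.fourier_convolution _ _ _
    rw [h2]
    simp only [SchwartzMap.pairing_apply_apply, ContinuousLinearMap.mul_apply', SchwartzMap.fourier_coe]
    have h3 : (X : Space d → ℂ) = fun x => (χ x : ℂ) := rfl
    rw [h3]
    conv_lhs => rw [← h1]
    push_cast
    ring
  refine ⟨⟨((cr 0 : ℂ))⁻¹ • c, fun x => (cr 0)⁻¹ * cr x,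
    fun x => (cr 0)⁻¹ * (𝓕 (X : Space d → ℂ) x).re ^ 2, ?_, ?_, ?_, ?_, ?_⟩⟩
  · intro x; simp [hc]
  · intro x
    have : 𝓕 (((cr 0 : ℂ))⁻¹ • c) = ((cr 0 : ℂ))⁻¹ • 𝓕 c := FourierTransform.fourier_smul _ _
    rw [this]
    simp [hf]
  · intro x
    exact mul_nonneg (inv_nonneg.2 hc0.le) (integral_nonneg fun t => mul_nonneg χ.nonneg χ.nonneg)
  · intro x; positivity
  · exact inv_mul_cancel₀ hc0.ne'

namespace Mollifier

variable {d : ℕ} (η : Mollifier d)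

lemma ψ_eq_re : η.ψ = fun x => ((𝓕 η.toSchwartz) x).re := by
  ext x; simp [η.fourier_eq]

lemma φ_eq_re : η.φ = fun x => (η.toSchwartz x).re := by
  ext x; simp [η.coe_eq]

lemma abs_ψ (x : Space d) : η.ψ x = ‖(𝓕 η.toSchwartz) x‖ := by
  rw [η.fourier_eq, Complex.norm_real, Real.norm_of_nonneg (η.ψ_nonneg x)]

lemma continuous_ψ : Continuous η.ψ := by
  rw [ψ_eq_re]; exact Complex.continuous_re.comp (SchwartzMap.continuous _)

lemma continuous_φ : Continuous η.φ := by
  rw [φ_eq_re]; exact Complex.continuous_re.comp (SchwartzMap.continuous _)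

lemma integrable_ψ : Integrable η.ψ := by
  rw [ψ_eq_re]; exact Integrable.re (𝕜 := ℂ) (SchwartzMap.integrable _)

lemma integrable_φ : Integrable η.φ := by
  rw [φ_eq_re]; exact Integrable.re (𝕜 := ℂ) (SchwartzMap.integrable _)

lemma integrable_pow_mul_ψ (k : ℕ) : Integrable fun x => ‖x‖ ^ k * η.ψ x := by
  simp_rw [abs_ψ]; exact SchwartzMap.integrable_pow_mul volume _ k

lemma exists_pow_mul_ψ_le (k : ℕ) : ∃ A, ∀ x, ‖x‖ ^ k * η.ψ x ≤ A :=
  ⟨_, fun x => by rw [abs_ψ]; exact SchwartzMap.norm_pow_mul_le_seminorm ℝ _ k x⟩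

lemma integral_expInner_mul_ψ (ξ : Space d) : ∫ x, expInner x ξ * η.ψ x = η.φ ξ := by
  rw [← η.coe_eq]
  have h : 𝓕⁻ (𝓕 η.toSchwartz) = η.toSchwartz := FourierTransform.fourierInv_fourier_eq _
  conv_rhs => rw [← h]
  rw [SchwartzMap.fourierInv_coe, fourierInv_eq_integral_expInner]
  simp_rw [η.fourier_eq]

lemma integral_ψ : ∫ x, η.ψ x = 1 := by
  have h := η.integral_expInner_mul_ψ 0
  have h0 : ∀ x : Space d, expInner x 0 = 1 := by simp [expInner]
  simp_rw [h0, one_mul, η.φ_zero] at h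
  rw [integral_complex_ofReal] at h
  exact_mod_cast h

/-- Positivity of `ψ` enters: `|φ ξ| ≤ ∫ ψ = φ 0 = 1`. -/
lemma φ_le_one (ξ : Space d) : η.φ ξ ≤ 1 := by
  have h := η.integral_expInner_mul_ψ ξ
  have h2 : ‖(η.φ ξ : ℂ)‖ ≤ ∫ x, ‖expInner x ξ * η.ψ x‖ := by
    rw [← h]; exact norm_integral_le_integral_norm _
  simp only [norm_mul, norm_expInner, one_mul, Complex.norm_real,
    Real.norm_of_nonneg (η.φ_nonneg ξ), Real.norm_of_nonneg (η.ψ_nonneg _), η.integral_ψ] at h2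
  exact h2

lemma tendsto_φ (ξ : Space d) {ε : ℕ → ℝ} (hε : Tendsto ε atTop (𝓝 0)) :
    Tendsto (fun k => η.φ (ε k • ξ)) atTop (𝓝 1) := by
  have : Tendsto (fun k => ε k • ξ) atTop (𝓝 0) := by simpa using hε.smul_const ξ
  rw [← η.φ_zero]
  exact (η.continuous_φ.tendsto 0).comp this

lemma exists_half_le_φ : ∃ δ > 0, ∀ ξ : Space d, ‖ξ‖ < δ → 1 / 2 ≤ η.φ ξ := by
  have h := (η.continuous_φ.tendsto 0).eventually (lt_mem_nhds (show (1 : ℝ) / 2 < η.φ 0 by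
    rw [η.φ_zero]; norm_num))
  obtain ⟨δ, hδ, h⟩ := Metric.eventually_nhds_iff.1 h
  exact ⟨δ, hδ, fun ξ hξ => (h (by simpa using hξ)).le⟩

/-- The scaled and modulated test function `ξ ↦ e^{2πi z·ξ} φ(εξ)`, as a Schwartz function. -/
lemma exists_schwartz {ε : ℝ} (hε : 0 < ε) (z : Space d) :
    ∃ Φ : 𝓢(Space d, ℂ), (∀ ξ, Φ ξ = expInner z ξ * η.φ (ε • ξ)) ∧
      ∀ x, (𝓕 Φ) x = (((ε ^ d)⁻¹ * η.ψ (ε⁻¹ • (x - z)) : ℝ) : ℂ) := by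
  let L : Space d ≃L[ℝ] Space d := ContinuousLinearEquiv.smulLeft (Units.mk0 ε⁻¹ (inv_ne_zero hε.ne'))
  -- The test function is built on the real side, as the copy of `ψ` at scale `ε` centred at `z`
  -- with the same integral; `Φ` is its inverse transform.
  let Θ : 𝓢(Space d, ℂ) := ((ε ^ d : ℝ) : ℂ)⁻¹ • SchwartzMap.compSubConstCLM ℝ z
    (SchwartzMap.compCLMOfContinuousLinearEquiv ℝ L (𝓕 η.toSchwartz))
  have hΘ : ∀ x, Θ x = (((ε ^ d)⁻¹ * η.ψ (ε⁻¹ • (x - z)) : ℝ) : ℂ) := by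
    intro x
    simp only [Θ, smul_apply, SchwartzMap.compSubConstCLM_apply,
      SchwartzMap.compCLMOfContinuousLinearEquiv_apply, Function.comp_apply]
    have : L (x - z) = ε⁻¹ • (x - z) := rfl
    rw [this, η.fourier_eq]
    push_cast
    rfl
  refine ⟨𝓕⁻ Θ, fun ξ => ?_, fun x => ?_⟩
  · rw [SchwartzMap.fourierInv_coe, fourierInv_eq_integral_expInner]
    simp_rw [hΘ]
    rw [← integral_add_right_eq_self _ z]
    simp only [add_sub_cancel_right]
    have h := Measure.integral_comp_inv_smul (volume : Measure (Space d))
      (fun u => expInner (ε • u + z) ξ * (((ε ^ d)⁻¹ * η.ψ u : ℝ) : ℂ)) ε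
    have e1 : ∀ x : Space d, ε • ε⁻¹ • x = x := fun x => by
      rw [smul_smul, mul_inv_cancel₀ hε.ne', one_smul]
    simp only [e1] at h
    rw [h, ← η.integral_expInner_mul_ψ, ← integral_const_mul]
    simp only [finrank_euclideanSpace, Fintype.card_fin]
    rw [← integral_smul]
    congr 1 with u
    rw [expInner_add, expInner_smul_comm, abs_of_pos (by positivity)]
    have : (ε : ℂ) ≠ 0 := by exact_mod_cast hε.ne'
    simp only [Complex.real_smul]
    push_cast
    field_simp
  · have h : 𝓕 (𝓕⁻ Θ) = Θ := FourierTransform.fourier_fourierInv_eq _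
    rw [h, hΘ]

/-- Mollification in Fourier and in real variables. -/
lemma integral_mollify {u w : Space d → ℂ}
    (huw : ∀ φ : 𝓢(Space d, ℂ), ∫ x, u x * (𝓕 φ) x = ∫ ξ, w ξ * φ ξ)
    {ε : ℝ} (hε : 0 < ε) (z : Space d) :
    ∫ ξ, w ξ * (expInner z ξ * η.φ (ε • ξ)) = ∫ v, u (z + ε • v) * η.ψ v := by
  obtain ⟨Φ, h1, h2⟩ := η.exists_schwartz hε z
  have h := huw Φ
  simp_rw [h1, h2] at h
  rw [← h, ← integral_add_left_eq_self _ z]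
  simp only [add_sub_cancel_left]
  have h := Measure.integral_comp_inv_smul (volume : Measure (Space d))
      (fun v => u (z + ε • v) * (((ε ^ d)⁻¹ * η.ψ v : ℝ) : ℂ)) ε
  have e1 : ∀ x : Space d, ε • ε⁻¹ • x = x := fun x => by
      rw [smul_smul, mul_inv_cancel₀ hε.ne', one_smul]
  simp only [e1] at h
  rw [h, ← integral_smul]
  simp only [finrank_euclideanSpace, Fintype.card_fin]
  congr 1 with v
  rw [abs_of_pos (by positivity)]
  have : (ε : ℂ) ≠ 0 := by exact_mod_cast hε.ne'
  simp only [Complex.real_smul]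
  push_cast
  field_simp

end Mollifier

/-! ### Powers of the norm -/

lemma nontrivial_space {d : ℕ} (hd : 0 < d) : Nontrivial (Space d) := by
  have : Nonempty (Fin d) := ⟨⟨0, hd⟩⟩
  infer_instance

/-- In polar coordinates the integrand becomes `r^(d-1-a)`, whose exponent exceeds `-1`. -/
lemma integrableOn_norm_rpow_ball {d : ℕ} (hd : 0 < d) {a : ℝ} (ha : a < d) (r : ℝ) :
    IntegrableOn (fun x : Space d => ‖x‖ ^ (-a)) (Metric.ball 0 r) := by
  have := nontrivial_space hd
  rcases le_or_gt r 0 with hr | hr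
  · simp [Metric.ball_eq_empty.2 hr]
  rw [integrableOn_fun_norm_addHaar volume (f := fun t : ℝ => t ^ (-a))]
  have h := (intervalIntegral.integrableOn_Ioo_rpow_iff (s := (d : ℝ) - 1 - a) hr).2 (by linarith)
  refine h.congr_fun (fun y hy => ?_) measurableSet_Ioo
  have hy0 : 0 < y := hy.1
  simp only [finrank_euclideanSpace, Fintype.card_fin, smul_eq_mul]
  rw [← Real.rpow_natCast, ← Real.rpow_add hy0]
  congr 1
  rw [Nat.cast_sub hd]
  push_cast
  ring

lemma integrable_norm_rpow_tail {d : ℕ} {a : ℝ} (ha : (d : ℝ) < a) :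
    IntegrableOn (fun x : Space d => ‖x‖ ^ (-a)) {x | 1 ≤ ‖x‖} := by
  have h := integrable_one_add_norm (E := Space d) (μ := volume) (r := a) (by simpa using ha)
  refine (h.const_mul (2 ^ a)).integrableOn.mono' (by
    exact (measurable_norm.pow_const _).aestronglyMeasurable) ?_
  refine ae_restrict_of_forall_mem (measurableSet_le measurable_const measurable_norm) fun x hx => ?_
  have hx : 1 ≤ ‖x‖ := hx
  have ha0 : 0 ≤ a := (Nat.cast_nonneg d).trans ha.le
  rw [Real.norm_of_nonneg (by positivity), Real.rpow_neg (by positivity),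
    Real.rpow_neg (by positivity), ← div_eq_mul_inv, ← one_div]
  rw [div_le_div_iff₀ (by positivity) (by positivity), one_mul,
    ← Real.mul_rpow (by norm_num) (by positivity)]
  exact Real.rpow_le_rpow (by positivity) (by linarith) ha0

/-- The integral of `‖x‖^{-a}` over the unit ball. -/
def unitBallIntegral (d : ℕ) (a : ℝ) : ℝ := ∫ x in Metric.ball (0 : Space d) 1, ‖x‖ ^ (-a)

lemma unitBallIntegral_nonneg (d : ℕ) (a : ℝ) : 0 ≤ unitBallIntegral d a :=
  integral_nonneg fun _ => by positivity

/-- The singular weight is split at radius `1`: inside, `t` is replaced by its bound `Θ`; outside,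
the weight is at most `1`. -/
lemma norm_rpow_neg_mul_le {d : ℕ} {a Θ t : ℝ} (ha : 0 ≤ a) (x : Space d) (h0 : 0 ≤ t)
    (ht : t ≤ Θ) :
    ‖x‖ ^ (-a) * t ≤
      Θ * (Metric.ball (0 : Space d) 1).indicator (fun x => ‖x‖ ^ (-a)) x + t := by
  by_cases hx : ‖x‖ < 1
  · rw [Set.indicator_of_mem (by simpa using hx)]
    have : ‖x‖ ^ (-a) * t ≤ Θ * ‖x‖ ^ (-a) := by
      rw [mul_comm]; gcongr
    linarith
  · rw [Set.indicator_of_notMem (by simpa using hx)]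
    have : ‖x‖ ^ (-a) ≤ 1 := Real.rpow_le_one_of_one_le_of_nonpos (not_lt.1 hx) (by linarith)
    nlinarith

/-- The bound does not depend on `w`, since the singular part is integrated with a
translation-invariant measure. -/
lemma integrable_norm_rpow_mul {d : ℕ} (hd : 0 < d) {a Θ : ℝ} (ha : 0 ≤ a) (had : a < d)
    {θ : Space d → ℝ} (hθ : Continuous θ) (hi : Integrable θ) (h0 : ∀ x, 0 ≤ θ x)
    (hΘ : ∀ x, θ x ≤ Θ) (w : Space d) :
    Integrable (fun v => ‖w + v‖ ^ (-a) * θ v) ∧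
      ∫ v, ‖w + v‖ ^ (-a) * θ v ≤ Θ * unitBallIntegral d a + ∫ v, θ v := by
  have h1 : Integrable ((Metric.ball (0 : Space d) 1).indicator (fun x => ‖x‖ ^ (-a))) :=
    (integrable_indicator_iff measurableSet_ball).2 (integrableOn_norm_rpow_ball hd had 1)
  have h2 : Integrable (fun v => Θ * (Metric.ball (0 : Space d) 1).indicator
      (fun x => ‖x‖ ^ (-a)) (w + v) + θ v) := ((h1.comp_add_left w).const_mul Θ).add hi
  have h3 : ∀ v, ‖w + v‖ ^ (-a) * θ v ≤ Θ * (Metric.ball (0 : Space d) 1).indicator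
      (fun x => ‖x‖ ^ (-a)) (w + v) + θ v := fun v => norm_rpow_neg_mul_le ha _ (h0 v) (hΘ v)
  have h4 : Integrable (fun v => ‖w + v‖ ^ (-a) * θ v) := by
    refine h2.mono' ?_ (ae_of_all _ fun v => ?_)
    · exact (((measurable_const.add measurable_id).norm.pow_const _).mul
        hθ.measurable).aestronglyMeasurable
    · rw [Real.norm_of_nonneg (mul_nonneg (by positivity) (h0 v))]; exact h3 v
  refine ⟨h4, (integral_mono h4 h2 h3).trans_eq ?_⟩
  rw [integral_add ((h1.comp_add_left w).const_mul Θ) hi, integral_const_mul,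
    integral_add_left_eq_self (f := (Metric.ball (0 : Space d) 1).indicator
      (fun x => ‖x‖ ^ (-a))), integral_indicator measurableSet_ball]
  rfl

/-- From `‖w‖^a ≤ 2^a (‖w + v‖^a + ‖v‖^a)`: the first term cancels the singularity, the second is
absorbed by the weight `1 + ‖v‖^d` because `a ≤ d`. -/
lemma norm_rpow_mul_le {d : ℕ} {a : ℝ} (ha : 0 < a) (had : a ≤ d) (w v : Space d) {t : ℝ}
    (ht : 0 ≤ t) :
    ‖w‖ ^ a * (‖w + v‖ ^ (-a) * t) ≤
      2 ^ a * (t + ‖w + v‖ ^ (-a) * ((1 + ‖v‖ ^ d) * t)) := by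
  have hva : ‖v‖ ^ a ≤ 1 + ‖v‖ ^ d := by
    rcases le_total ‖v‖ 1 with h | h
    · have : ‖v‖ ^ a ≤ 1 := Real.rpow_le_one (norm_nonneg _) h ha.le
      have : 0 ≤ ‖v‖ ^ d := by positivity
      linarith
    · have : ‖v‖ ^ a ≤ ‖v‖ ^ (d : ℝ) := Real.rpow_le_rpow_of_exponent_le h had
      rw [Real.rpow_natCast] at this
      linarith
  -- At the singular point `0 ^ (-a) = 0` by convention, so the left side vanishes.
  rcases eq_or_ne (w + v) 0 with h | h
  · rw [h, norm_zero, Real.zero_rpow (by linarith)]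
    simp only [zero_mul, mul_zero, add_zero]
    positivity
  have hp : 0 < ‖w + v‖ := norm_pos_iff.2 h
  have hw : ‖w‖ ^ a ≤ 2 ^ a * (‖w + v‖ ^ a + ‖v‖ ^ a) := by
    have h1 : ‖w‖ ≤ ‖w + v‖ + ‖v‖ := by simpa using norm_sub_le (w + v) v
    have h2 : ‖w‖ ≤ 2 * max ‖w + v‖ ‖v‖ := by
      have := le_max_left ‖w + v‖ ‖v‖
      have := le_max_right ‖w + v‖ ‖v‖
      linarith
    refine (Real.rpow_le_rpow (norm_nonneg _) h2 ha.le).trans ?_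
    rw [Real.mul_rpow (by norm_num) (by positivity)]
    gcongr
    rcases max_choice ‖w + v‖ ‖v‖ with h | h <;> rw [h]
    · linarith [Real.rpow_nonneg (norm_nonneg v) a]
    · linarith [Real.rpow_nonneg (norm_nonneg (w + v)) a]
  have hc : ‖w + v‖ ^ a * ‖w + v‖ ^ (-a) = 1 := by
    rw [← Real.rpow_add hp]; simp
  calc ‖w‖ ^ a * (‖w + v‖ ^ (-a) * t)
      ≤ (2 ^ a * (‖w + v‖ ^ a + (1 + ‖v‖ ^ d))) * (‖w + v‖ ^ (-a) * t) := by
        gcongr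
        exact hw.trans (by gcongr)
    _ = 2 ^ a * ((‖w + v‖ ^ a * ‖w + v‖ ^ (-a)) * t +
          ‖w + v‖ ^ (-a) * ((1 + ‖v‖ ^ d) * t)) := by ring
    _ = _ := by rw [hc, one_mul]

/-- Averages of `‖z‖^{-a}` at scale `ε` are controlled by `‖z‖^{-a}`, uniformly in `ε`. -/
lemma exists_average_norm_rpow_le {d : ℕ} (hd : 0 < d) {a : ℝ} (ha : 0 < a) (had : a < d)
    {θ : Space d → ℝ} (hθ : Continuous θ) (h0 : ∀ x, 0 ≤ θ x) (hi : Integrable θ)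
    (hi' : Integrable fun v => (1 + ‖v‖ ^ d) * θ v) {Θ : ℝ}
    (hΘ : ∀ v, (1 + ‖v‖ ^ d) * θ v ≤ Θ) :
    ∃ B, 0 ≤ B ∧ ∀ ε : ℝ, 0 < ε → ∀ z : Space d,
      Integrable (fun v => ‖z + ε • v‖ ^ (-a) * θ v) ∧
      (z ≠ 0 → ∫ v, ‖z + ε • v‖ ^ (-a) * θ v ≤ B * ‖z‖ ^ (-a)) := by
  have hΘ' : ∀ v, θ v ≤ Θ := fun v => by
    refine le_trans ?_ (hΘ v)
    have : 0 ≤ ‖v‖ ^ d * θ v := mul_nonneg (by positivity) (h0 v)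
    linarith
  have hc' : Continuous fun v : Space d => (1 + ‖v‖ ^ d) * θ v := by fun_prop
  have h0' : ∀ v : Space d, 0 ≤ (1 + ‖v‖ ^ d) * θ v := fun v => mul_nonneg (by positivity) (h0 v)
  have hΘ0 : 0 ≤ Θ := (h0 0).trans (hΘ' 0)
  set B : ℝ := 2 ^ a * ((∫ v, θ v) + (Θ * unitBallIntegral d a + ∫ v, (1 + ‖v‖ ^ d) * θ v))
  -- By homogeneity everything reduces to scale `1` with `w = ε⁻¹ • z`; a bound on `‖w‖^a` times the
  -- average that is uniform in `w` is then uniform in `ε` and `z`.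
  have key : ∀ ε : ℝ, 0 < ε → ∀ z v : Space d,
      ‖z + ε • v‖ ^ (-a) = ε ^ (-a) * ‖ε⁻¹ • z + v‖ ^ (-a) := by
    intro ε hε z v
    rw [← Real.mul_rpow hε.le (norm_nonneg _)]
    congr 1
    rw [← Real.norm_of_nonneg hε.le, ← norm_smul, Real.norm_of_nonneg hε.le, smul_add, smul_smul,
      mul_inv_cancel₀ hε.ne', one_smul]
  refine ⟨B, ?_, fun ε hε z => ⟨?_, fun hz => ?_⟩⟩
  · have := unitBallIntegral_nonneg d a
    have h1 : 0 ≤ ∫ v, θ v := integral_nonneg h0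
    have h2 : 0 ≤ ∫ v, (1 + ‖v‖ ^ d) * θ v := integral_nonneg h0'
    positivity
  · simp_rw [key ε hε z, mul_assoc]
    exact (integrable_norm_rpow_mul hd ha.le had hθ hi h0 hΘ' _).1.const_mul _
  · simp_rw [key ε hε z, mul_assoc]
    rw [integral_const_mul]
    set w := ε⁻¹ • z
    have hw : 0 < ‖w‖ := norm_pos_iff.2 (smul_ne_zero (inv_ne_zero hε.ne') hz)
    have hzw : ‖z‖ ^ (-a) = ε ^ (-a) * ‖w‖ ^ (-a) := by
      have := key ε hε z 0
      simpa using this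
    rw [hzw, ← mul_assoc, mul_comm B, mul_assoc]
    refine mul_le_mul_of_nonneg_left ?_ (by positivity)
    have i1 := integrable_norm_rpow_mul hd ha.le had hθ hi h0 hΘ' w
    have i2 := integrable_norm_rpow_mul hd ha.le had hc' hi' h0' hΘ w
    have h1 : ‖w‖ ^ a * ∫ v, ‖w + v‖ ^ (-a) * θ v ≤ B := by
      rw [← integral_const_mul]
      refine (integral_mono (i1.1.const_mul _) ((hi.add i2.1).const_mul (2 ^ a))
        fun v => norm_rpow_mul_le ha had.le w v (h0 v)).trans ?_
      simp only [Pi.add_apply]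
      rw [integral_const_mul, integral_add hi i2.1]
      exact mul_le_mul_of_nonneg_left (add_le_add le_rfl i2.2) (by positivity)
    rw [Real.rpow_neg hw.le, ← div_eq_mul_inv, le_div_iff₀ (by positivity), mul_comm]
    exact h1

namespace Mollifier

variable {d : ℕ} (η : Mollifier d)

lemma integrable_one_add_pow_mul (k : ℕ) : Integrable fun v => (1 + ‖v‖ ^ d) * (‖v‖ ^ k * η.ψ v) := by
  have h := (η.integrable_pow_mul_ψ k).add (η.integrable_pow_mul_ψ (d + k))
  refine h.congr (ae_of_all _ fun v => ?_)
  simp only [Pi.add_apply]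
  ring

lemma exists_one_add_pow_mul_le (k : ℕ) :
    ∃ A, ∀ v, (1 + ‖v‖ ^ d) * (‖v‖ ^ k * η.ψ v) ≤ A := by
  obtain ⟨A, hA⟩ := η.exists_pow_mul_ψ_le k
  obtain ⟨A', hA'⟩ := η.exists_pow_mul_ψ_le (d + k)
  refine ⟨A + A', fun v => ?_⟩
  have := hA v
  have := hA' v
  rw [pow_add] at this
  nlinarith

/-- The case `k = 0` dominates the mollified kernel. The case `k = 1` serves in the convergence
proof, where the far part of the average is paid for by a factor `‖v‖`. -/
lemma exists_average_le (hd : 0 < d) {a : ℝ} (ha : 0 < a) (had : a < d) (k : ℕ) :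
    ∃ B, 0 ≤ B ∧ ∀ ε : ℝ, 0 < ε → ∀ z : Space d,
      Integrable (fun v => ‖z + ε • v‖ ^ (-a) * (‖v‖ ^ k * η.ψ v)) ∧
      (z ≠ 0 → ∫ v, ‖z + ε • v‖ ^ (-a) * (‖v‖ ^ k * η.ψ v) ≤ B * ‖z‖ ^ (-a)) := by
  obtain ⟨A, hA⟩ := η.exists_one_add_pow_mul_le k
  have := η.continuous_ψ
  exact exists_average_norm_rpow_le hd ha had (by fun_prop)
    (fun v => mul_nonneg (by positivity) (η.ψ_nonneg v)) (η.integrable_pow_mul_ψ k)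
    (η.integrable_one_add_pow_mul k) hA

end Mollifier

/-! ### Bounds on a Riesz-type kernel and its Fourier transform -/

/-- The quantitative content of a Riesz-type kernel on `ℝ^d` and of its Fourier transform, both
normalized to vanish at the origin. -/
structure KernelBounds {d : ℕ} (s : ℝ) (g ghat : Space d → ℝ) (C₁ C₂ C : ℝ) : Prop where
  s_pos : 0 < s
  two_s_lt : 2 * s < d
  C₁_pos : 0 < C₁
  C_nonneg : 0 ≤ C
  continuousAt : ∀ x, x ≠ 0 → ContinuousAt g x
  abs_le : ∀ x, |g x| ≤ C * ‖x‖ ^ (-((d : ℝ) - 2 * s))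
  measurable_hat : Measurable ghat
  fourier : IsFourierTransform g ghat
  le_hat : ∀ ξ, C₁ * ‖ξ‖ ^ (-(2 * s)) ≤ ghat ξ
  hat_le : ∀ ξ, ghat ξ ≤ C₂ * ‖ξ‖ ^ (-(2 * s))

/-- The mollification of `g` at scale `ε`. -/
def mollify {d : ℕ} (η : Mollifier d) (g : Space d → ℝ) (ε : ℝ) (z : Space d) : ℝ :=
  ∫ v, g (z + ε • v) * η.ψ v

namespace KernelBounds

variable {d : ℕ} {s : ℝ} {g ghat : Space d → ℝ} {C₁ C₂ C : ℝ} (η : Mollifier d)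

lemma dim_pos (hg : KernelBounds s g ghat C₁ C₂ C) : 0 < d := by
  have h1 := hg.s_pos
  have h2 := hg.two_s_lt
  have : (0 : ℝ) < d := by linarith
  exact_mod_cast this

lemma exponent_pos (hg : KernelBounds s g ghat C₁ C₂ C) : 0 < (d : ℝ) - 2 * s := by
  linarith [hg.two_s_lt]

lemma exponent_lt (hg : KernelBounds s g ghat C₁ C₂ C) : (d : ℝ) - 2 * s < d := by
  linarith [hg.s_pos]

lemma measurable (hg : KernelBounds s g ghat C₁ C₂ C) : Measurable g :=
  measurable_of_continuousOn_compl_singleton 0 fun x hx => (hg.continuousAt x hx).continuousWithinAt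

lemma hat_nonneg (hg : KernelBounds s g ghat C₁ C₂ C) (ξ : Space d) : 0 ≤ ghat ξ :=
  (mul_nonneg hg.C₁_pos.le (by positivity)).trans (hg.le_hat ξ)

lemma integrable_norm_rpow_mul_φ (hg : KernelBounds s g ghat C₁ C₂ C) {ε : ℝ} (hε : 0 < ε) :
    Integrable fun ξ => ‖ξ‖ ^ (-(2 * s)) * η.φ (ε • ξ) := by
  have hc := η.continuous_φ
  have h := (integrable_norm_rpow_mul (θ := fun ξ => η.φ (ε • ξ)) (Θ := 1) hg.dim_pos
    (by linarith [hg.s_pos]) hg.two_s_lt (by fun_prop)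
    (η.integrable_φ.comp_smul hε.ne') (fun _ => η.φ_nonneg _) (fun _ => η.φ_le_one _) 0).1
  simpa using h

lemma integrable_hat_mul_φ (hg : KernelBounds s g ghat C₁ C₂ C) {ε : ℝ} (hε : 0 < ε) :
    Integrable fun ξ => ghat ξ * η.φ (ε • ξ) := by
  have hc := η.continuous_φ
  refine ((hg.integrable_norm_rpow_mul_φ η hε).const_mul C₂).mono'
    (hg.measurable_hat.mul (by fun_prop)).aestronglyMeasurable (ae_of_all _ fun ξ => ?_)
  rw [Real.norm_of_nonneg (mul_nonneg (hg.hat_nonneg ξ) (η.φ_nonneg _)), ← mul_assoc]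
  exact mul_le_mul_of_nonneg_right (hg.hat_le ξ) (η.φ_nonneg _)

lemma integral_hat_eq_mollify (hg : KernelBounds s g ghat C₁ C₂ C) {ε : ℝ} (hε : 0 < ε)
    (z : Space d) :
    ∫ ξ, (ghat ξ : ℂ) * (expInner z ξ * η.φ (ε • ξ)) = (mollify η g ε z : ℂ) := by
  rw [η.integral_mollify hg.fourier hε z, mollify, ← integral_complex_ofReal]
  simp

lemma integrable_mollify (hg : KernelBounds s g ghat C₁ C₂ C) {ε : ℝ} (hε : 0 < ε) (z : Space d) :
    Integrable fun v => g (z + ε • v) * η.ψ v := by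
  obtain ⟨B, -, h⟩ := η.exists_average_le hg.dim_pos hg.exponent_pos hg.exponent_lt 0
  refine ((h ε hε z).1.const_mul C).mono' ?_ (ae_of_all _ fun v => ?_)
  · exact ((hg.measurable.comp (by fun_prop)).mul η.continuous_ψ.measurable).aestronglyMeasurable
  · rw [norm_mul, Real.norm_of_nonneg (η.ψ_nonneg v), Real.norm_eq_abs, ← mul_assoc, pow_zero,
      one_mul]
    exact mul_le_mul_of_nonneg_right (hg.abs_le _) (η.ψ_nonneg _)

lemma exists_abs_mollify_le (hg : KernelBounds s g ghat C₁ C₂ C) :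
    ∃ B, 0 ≤ B ∧ ∀ ε : ℝ, 0 < ε → ∀ z, z ≠ 0 →
      |mollify η g ε z| ≤ B * ‖z‖ ^ (-((d : ℝ) - 2 * s)) := by
  obtain ⟨B, hB, h⟩ := η.exists_average_le hg.dim_pos hg.exponent_pos hg.exponent_lt 0
  refine ⟨C * B, mul_nonneg hg.C_nonneg hB, fun ε hε z hz => ?_⟩
  have h1 : |mollify η g ε z| ≤ ∫ v, C * (‖z + ε • v‖ ^ (-((d : ℝ) - 2 * s)) * (‖v‖ ^ 0 * η.ψ v)) := by
    rw [← Real.norm_eq_abs]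
    refine norm_integral_le_of_norm_le ((h ε hε z).1.const_mul C) (ae_of_all _ fun v => ?_)
    rw [norm_mul, Real.norm_of_nonneg (η.ψ_nonneg v), Real.norm_eq_abs, ← mul_assoc, pow_zero,
      one_mul]
    exact mul_le_mul_of_nonneg_right (hg.abs_le _) (η.ψ_nonneg _)
  rw [integral_const_mul] at h1
  refine h1.trans ?_
  rw [mul_assoc]
  exact mul_le_mul_of_nonneg_left ((h ε hε z).2 hz) hg.C_nonneg

/-- Continuity at `z` handles the `v` with `ε ‖v‖ < ρ`. For the others `1 ≤ ε ρ⁻¹ ‖v‖`, as in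
Chebyshev's inequality, and the weighted averages of the singular bound on `g` are finite uniformly
in `ε`, so their contribution is `O(ε)` although `g` is unbounded. -/
lemma tendsto_mollify (hg : KernelBounds s g ghat C₁ C₂ C) {z : Space d} (hz : z ≠ 0) {ε : ℕ → ℝ}
    (hε0 : ∀ k, 0 < ε k)
    (hε : Tendsto ε atTop (𝓝 0)) :
    Tendsto (fun k => mollify η g (ε k) z) atTop (𝓝 (g z)) := by
  obtain ⟨B, hB, hav⟩ := η.exists_average_le hg.dim_pos hg.exponent_pos hg.exponent_lt 1
  set M : ℝ := ∫ v, ‖v‖ ^ 1 * η.ψ v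
  set D : ℝ := C * (B * ‖z‖ ^ (-((d : ℝ) - 2 * s))) + |g z| * M
  rw [Metric.tendsto_atTop']
  intro t ht
  obtain ⟨ρ, hρ, hcont⟩ := Metric.continuousAt_iff.1 (hg.continuousAt z hz) (t / 2) (by linarith)
  have hlim : Tendsto (fun k => ε k * (ρ⁻¹ * D)) atTop (𝓝 0) := by
    simpa using hε.mul_const (ρ⁻¹ * D)
  obtain ⟨N, hN⟩ := (hlim.eventually (gt_mem_nhds (show 0 < t / 2 by linarith))).exists_forall_of_atTop
  refine ⟨N, fun k hk => ?_⟩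
  have he := hε0 k
  have hsub : mollify η g (ε k) z - g z = ∫ v, (g (z + ε k • v) - g z) * η.ψ v := by
    simp_rw [sub_mul]
    rw [integral_sub (hg.integrable_mollify η he z) (η.integrable_ψ.const_mul _),
      integral_const_mul, η.integral_ψ, mul_one]
    rfl
  have hi1 := (hav (ε k) he z).1
  have hi2 := η.integrable_pow_mul_ψ 1
  have hsum : Integrable fun v =>
      C * (‖z + ε k • v‖ ^ (-((d : ℝ) - 2 * s)) * (‖v‖ ^ 1 * η.ψ v)) + |g z| * (‖v‖ ^ 1 * η.ψ v) :=
    (hi1.const_mul C).add (hi2.const_mul _)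
  have hInt : Integrable fun v => t / 2 * η.ψ v + ε k * ρ⁻¹ *
      (C * (‖z + ε k • v‖ ^ (-((d : ℝ) - 2 * s)) * (‖v‖ ^ 1 * η.ψ v)) +
        |g z| * (‖v‖ ^ 1 * η.ψ v)) :=
    (η.integrable_ψ.const_mul _).add (hsum.const_mul _)
  rw [Real.dist_eq, hsub, ← Real.norm_eq_abs]
  refine (norm_integral_le_of_norm_le hInt (ae_of_all _ fun v => ?_)).trans_lt ?_
  · rw [norm_mul, Real.norm_of_nonneg (η.ψ_nonneg v), Real.norm_eq_abs]
    have hψ := η.ψ_nonneg v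
    by_cases hv : ε k * ‖v‖ < ρ
    · have h1 : |g (z + ε k • v) - g z| < t / 2 := by
        rw [← Real.dist_eq]
        refine hcont ?_
        simpa [dist_eq_norm, norm_smul, abs_of_pos he] using hv
      have h2 : 0 ≤ ε k * ρ⁻¹ * (C * (‖z + ε k • v‖ ^ (-((d : ℝ) - 2 * s)) * (‖v‖ ^ 1 * η.ψ v)) +
        |g z| * (‖v‖ ^ 1 * η.ψ v)) := by
        have := hg.C_nonneg
        positivity
      nlinarith [mul_le_mul_of_nonneg_right h1.le hψ]
    · have h1 : 1 ≤ ε k * ρ⁻¹ * ‖v‖ := by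
        rw [mul_right_comm, ← div_eq_mul_inv, le_div_iff₀ hρ]; linarith
      have h2 : |g (z + ε k • v) - g z| ≤ C * ‖z + ε k • v‖ ^ (-((d : ℝ) - 2 * s)) + |g z| :=
        (abs_sub _ _).trans (add_le_add (hg.abs_le _) le_rfl)
      have h3 : 0 ≤ C * ‖z + ε k • v‖ ^ (-((d : ℝ) - 2 * s)) + |g z| := (abs_nonneg _).trans h2
      calc |g (z + ε k • v) - g z| * η.ψ v
          ≤ (C * ‖z + ε k • v‖ ^ (-((d : ℝ) - 2 * s)) + |g z|) * η.ψ v := by gcongr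
        _ ≤ (ε k * ρ⁻¹ * ‖v‖) *
            ((C * ‖z + ε k • v‖ ^ (-((d : ℝ) - 2 * s)) + |g z|) * η.ψ v) :=
          le_mul_of_one_le_left (mul_nonneg h3 hψ) h1
        _ = ε k * ρ⁻¹ * (C * (‖z + ε k • v‖ ^ (-((d : ℝ) - 2 * s)) * (‖v‖ ^ 1 * η.ψ v)) +
              |g z| * (‖v‖ ^ 1 * η.ψ v)) := by ring
        _ ≤ _ := le_add_of_nonneg_left (by positivity)
  · rw [integral_add (η.integrable_ψ.const_mul _) (hsum.const_mul _), integral_const_mul,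
      integral_const_mul, integral_add (hi1.const_mul C) (hi2.const_mul _), integral_const_mul,
      integral_const_mul, η.integral_ψ, mul_one]
    have h1 := (hav (ε k) he z).2 hz
    have h2 : C * ∫ v, ‖z + ε k • v‖ ^ (-((d : ℝ) - 2 * s)) * (‖v‖ ^ 1 * η.ψ v) ≤
        C * (B * ‖z‖ ^ (-((d : ℝ) - 2 * s))) := mul_le_mul_of_nonneg_left h1 hg.C_nonneg
    have h3 : ε k * ρ⁻¹ * (C * (∫ v, ‖z + ε k • v‖ ^ (-((d : ℝ) - 2 * s)) * (‖v‖ ^ 1 * η.ψ v)) +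
        |g z| * M) ≤ ε k * (ρ⁻¹ * D) := by
      rw [mul_assoc]
      gcongr
      exact add_le_add h2 le_rfl
    have := hN k hk.le
    linarith

lemma neg_le_mollify (hg : KernelBounds s g ghat C₁ C₂ C) {K : ℝ} (hK : ∀ x, -K ≤ g x) {ε : ℝ}
    (hε : 0 < ε) (z : Space d) :
    -K ≤ mollify η g ε z := by
  have h : ∫ v, -K * η.ψ v ≤ mollify η g ε z :=
    integral_mono (η.integrable_ψ.const_mul _) (hg.integrable_mollify η hε z)
      fun v => mul_le_mul_of_nonneg_right (hK _) (η.ψ_nonneg v)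
  rwa [integral_const_mul, η.integral_ψ, mul_one] at h

/-- At every scale `ε` the mollified kernel at `0` is at least of order `ε^{-(d-2s)}`. -/
lemma exists_le_mollify_zero (hg : KernelBounds s g ghat C₁ C₂ C) : ∃ c > 0, ∀ ε : ℝ, 0 < ε →
    c * ε ^ (-((d : ℝ) - 2 * s)) ≤ mollify η g ε 0 := by
  obtain ⟨δ, hδ, hφ⟩ := η.exists_half_le_φ
  have hpos : 0 < (volume (Metric.ball (0 : Space d) 1)).toReal :=
    ENNReal.toReal_pos (Metric.measure_ball_pos _ _ one_pos).ne' measure_ball_lt_top.ne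
  set vol := (volume (Metric.ball (0 : Space d) 1)).toReal
  have hC := hg.C₁_pos
  refine ⟨C₁ / 2 * δ ^ (-(2 * s)) * (δ ^ d * vol), by positivity, fun ε hε => ?_⟩
  have heq : mollify η g ε 0 = ∫ ξ, ghat ξ * η.φ (ε • ξ) := by
    have h := hg.integral_hat_eq_mollify η hε 0
    have h0 : ∀ ξ : Space d, expInner 0 ξ = 1 := by simp [expInner]
    simp_rw [h0, one_mul] at h
    have h2 : ((∫ ξ, ghat ξ * η.φ (ε • ξ) : ℝ) : ℂ) = mollify η g ε 0 := by
      rw [← h, ← integral_complex_ofReal]; simp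
    exact_mod_cast h2.symm
  -- The integrand `ĝ φ(ε·)` is nonnegative, so the integral may be restricted to the ball of radius
  -- `δ / ε`. There `φ(εξ) ≥ 1/2` and `‖ξ‖^(-2s) ≥ (δ/ε)^(-2s)`; multiplying by the volume yields
  -- the power `ε^(-(d-2s))`.
  have hr : 0 < δ / ε := by positivity
  have h1 : ∫ ξ in Metric.ball (0 : Space d) (δ / ε), C₁ / 2 * (δ / ε) ^ (-(2 * s)) ≤
      ∫ ξ, ghat ξ * η.φ (ε • ξ) := by
    refine le_trans ?_ (setIntegral_le_integral (s := Metric.ball (0 : Space d) (δ / ε))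
      (hg.integrable_hat_mul_φ η hε)
      (ae_of_all _ fun ξ => mul_nonneg (hg.hat_nonneg ξ) (η.φ_nonneg _)))
    have hnull : ∀ᵐ ξ ∂(volume : Measure (Space d)), ξ ≠ 0 := by
      have := nontrivial_space hg.dim_pos
      simp [ae_iff]
    refine setIntegral_mono_on_ae (integrableOn_const measure_ball_lt_top.ne)
      (hg.integrable_hat_mul_φ η hε).integrableOn measurableSet_ball ?_
    filter_upwards [hnull] with ξ hξ0 hξ
    have hξ' : ‖ξ‖ < δ / ε := by simpa using hξ
    have h2 : 1 / 2 ≤ η.φ (ε • ξ) := hφ _ (by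
      rw [norm_smul, Real.norm_of_nonneg hε.le, mul_comm]; exact (lt_div_iff₀ hε).1 hξ')
    have h3 : (δ / ε) ^ (-(2 * s)) ≤ ‖ξ‖ ^ (-(2 * s)) :=
      Real.rpow_le_rpow_of_nonpos (norm_pos_iff.2 hξ0) hξ'.le (by linarith [hg.s_pos])
    calc C₁ / 2 * (δ / ε) ^ (-(2 * s)) = C₁ * (δ / ε) ^ (-(2 * s)) * (1 / 2) := by ring
      _ ≤ C₁ * ‖ξ‖ ^ (-(2 * s)) * η.φ (ε • ξ) := by gcongr
      _ ≤ _ := mul_le_mul_of_nonneg_right (hg.le_hat ξ) (η.φ_nonneg _)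
  rw [heq]
  refine le_trans (le_of_eq ?_) h1
  rw [setIntegral_const, measureReal_def, Measure.addHaar_ball_of_pos _ _ hr, ENNReal.toReal_mul,
    ENNReal.toReal_ofReal (by positivity), smul_eq_mul]
  simp only [finrank_euclideanSpace, Fintype.card_fin]
  change _ = (δ / ε) ^ d * vol * _
  rw [div_pow, Real.div_rpow hδ.le hε.le, neg_sub, Real.rpow_sub hε, Real.rpow_neg hε.le (2 * s),
    Real.rpow_natCast]
  field_simp

/-- At every scale the kernel is large at some point of an annulus. -/
lemma exists_annulus_point (hg : KernelBounds s g ghat C₁ C₂ C) :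
    ∃ δ > 0, ∃ L > 0, ∃ c > 0, ∀ ε : ℝ, 0 < ε →
    ∃ y : Space d, δ * ε ≤ ‖y‖ ∧ ‖y‖ ≤ L * ε ∧ c * ε ^ (-((d : ℝ) - 2 * s)) ≤ g y := by
  obtain ⟨η⟩ := nonempty_mollifier d
  obtain ⟨c₀, hc₀, hmol⟩ := hg.exists_le_mollify_zero η
  obtain ⟨A, hA⟩ := η.exists_pow_mul_ψ_le 0
  simp only [pow_zero, one_mul] at hA
  have hA0 : 0 ≤ A := (η.ψ_nonneg 0).trans (hA 0)
  have hs := hg.s_pos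
  have ha := hg.exponent_pos
  set a : ℝ := (d : ℝ) - 2 * s with ha_def
  set J := unitBallIntegral d ((d : ℝ) - s)
  have hJ : 0 ≤ J := unitBallIntegral_nonneg _ _
  have hCn := hg.C_nonneg
  -- The part `‖v‖ < δ` of the average is made smaller than a quarter of the lower bound `c₀`, by
  -- trading `‖v‖^(-a) ≤ δ^s ‖v‖^(-(d-s))`; the exponent `d - s` is still integrable.
  obtain ⟨δ, hδ, hδ1, hδ2⟩ : ∃ δ : ℝ, 0 < δ ∧ δ < 1 ∧ C * A * J * δ ^ s < c₀ / 4 := by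
    have h1 : Tendsto (fun δ : ℝ => C * A * J * δ ^ s) (𝓝[>] 0) (𝓝 0) := by
      have : Tendsto (fun δ : ℝ => δ ^ s) (𝓝[>] 0) (𝓝 ((0 : ℝ) ^ s)) :=
        ((Real.continuousAt_rpow_const 0 s (Or.inr hs.le)).tendsto).mono_left nhdsWithin_le_nhds
      rw [Real.zero_rpow hs.ne'] at this
      simpa using this.const_mul (C * A * J)
    have h2 := h1.eventually (gt_mem_nhds (show (0 : ℝ) < c₀ / 4 by linarith))
    have h3 : ∀ᶠ δ : ℝ in 𝓝[>] 0, δ ∈ Set.Ioo (0 : ℝ) 1 := Ioo_mem_nhdsGT one_pos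
    obtain ⟨δ, hδ⟩ := (h2.and h3).exists
    exact ⟨δ, hδ.2.1, hδ.2.2, hδ.1⟩
  -- The part `‖v‖ > L` is likewise kept below a quarter of `c₀`, by decay of the kernel.
  obtain ⟨L, hL, hL2⟩ : ∃ L : ℝ, 0 < L ∧ C * L ^ (-a) < c₀ / 4 := by
    have h1 : Tendsto (fun L : ℝ => C * L ^ (-a)) atTop (𝓝 0) := by
      simpa using (tendsto_rpow_neg_atTop ha).const_mul C
    obtain ⟨L, h⟩ := ((h1.eventually (gt_mem_nhds (show (0 : ℝ) < c₀ / 4 by linarith))).and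
      (eventually_gt_atTop 0)).exists
    exact ⟨L, h.2, h.1⟩
  refine ⟨δ, hδ, L, hL, c₀ / 4, by positivity, fun ε hε => ?_⟩
  -- If `g` were below `(c₀/4) ε^(-a)` throughout the annulus, the three parts would add up to less
  -- than `(3c₀/4) ε^(-a)`, against the lower bound on the average at `0`.
  by_contra! hcon
  have hscale : ∀ v : Space d, ‖ε • v‖ = ε * ‖v‖ := fun v => by
    rw [norm_smul, Real.norm_of_nonneg hε.le]
  have hεa : 0 < ε ^ (-a) := by positivity
  have hpt : ∀ v : Space d, g (0 + ε • v) * η.ψ v ≤ ε ^ (-a) * (C * A * δ ^ s *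
      (Metric.ball (0 : Space d) 1).indicator (fun x => ‖x‖ ^ (-((d : ℝ) - s))) v +
      (c₀ / 4 + C * L ^ (-a)) * η.ψ v) := by
    intro v
    have hψ := η.ψ_nonneg v
    have hind : 0 ≤ (Metric.ball (0 : Space d) 1).indicator (fun x => ‖x‖ ^ (-((d : ℝ) - s))) v :=
      Set.indicator_nonneg (fun x _ => by positivity) v
    have hgle : g (ε • v) ≤ C * (ε ^ (-a) * ‖v‖ ^ (-a)) := by
      refine (le_abs_self _).trans ((hg.abs_le _).trans_eq ?_)
      rw [hscale, Real.mul_rpow hε.le (norm_nonneg _)]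
    rw [zero_add]
    by_cases h1 : ‖v‖ < δ
    · rw [Set.indicator_of_mem (by simpa using h1.trans hδ1)]
      have h2 : ‖v‖ ^ (-a) ≤ δ ^ s * ‖v‖ ^ (-((d : ℝ) - s)) := by
        rcases eq_or_ne v 0 with rfl | hv
        · rw [norm_zero, Real.zero_rpow (by linarith)]; positivity
        have hv := norm_pos_iff.2 hv
        have : -a = s + -((d : ℝ) - s) := by rw [ha_def]; ring
        rw [this, Real.rpow_add hv]
        gcongr
      calc g (ε • v) * η.ψ v ≤ C * (ε ^ (-a) * (δ ^ s * ‖v‖ ^ (-((d : ℝ) - s)))) * A := by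
            refine mul_le_mul (hgle.trans ?_) (hA v) hψ (by positivity)
            gcongr
        _ = ε ^ (-a) * (C * A * δ ^ s * ‖v‖ ^ (-((d : ℝ) - s))) := by ring
        _ ≤ _ := by
            gcongr
            exact le_add_of_nonneg_right (by positivity)
    · have h3 : g (ε • v) ≤ ε ^ (-a) * (c₀ / 4 + C * L ^ (-a)) := by
        by_cases h2 : ‖v‖ ≤ L
        · have := hcon (ε • v) (by rw [hscale, mul_comm]; gcongr; linarith)
            (by rw [hscale, mul_comm]; gcongr)
          have h4 : 0 ≤ ε ^ (-a) * (C * L ^ (-a)) := by positivity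
          linarith
        · have h4 : ‖v‖ ^ (-a) ≤ L ^ (-a) :=
            Real.rpow_le_rpow_of_nonpos hL (by linarith) (by linarith)
          have h5 : C * (ε ^ (-a) * ‖v‖ ^ (-a)) ≤ ε ^ (-a) * (C * L ^ (-a)) := by
            rw [mul_left_comm]; gcongr
          have h6 : 0 ≤ ε ^ (-a) * (c₀ / 4) := by positivity
          linarith
      calc g (ε • v) * η.ψ v ≤ ε ^ (-a) * (c₀ / 4 + C * L ^ (-a)) * η.ψ v := by gcongr
        _ = ε ^ (-a) * ((c₀ / 4 + C * L ^ (-a)) * η.ψ v) := by ring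
        _ ≤ _ := by
            gcongr
            exact le_add_of_nonneg_left (by positivity)
  have hi1 : Integrable ((Metric.ball (0 : Space d) 1).indicator
      (fun x => ‖x‖ ^ (-((d : ℝ) - s)))) :=
    (integrable_indicator_iff measurableSet_ball).2
      (integrableOn_norm_rpow_ball hg.dim_pos (by linarith) 1)
  have h1 : mollify η g ε 0 ≤ _ := integral_mono (hg.integrable_mollify η hε 0)
    (((hi1.const_mul _).add (η.integrable_ψ.const_mul _)).const_mul _) hpt
  rw [integral_const_mul] at h1
  simp only [Pi.add_apply] at h1
  rw [integral_add (hi1.const_mul _) (η.integrable_ψ.const_mul _), integral_const_mul,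
    integral_const_mul, η.integral_ψ, mul_one, integral_indicator measurableSet_ball] at h1
  have h2 := (hmol ε hε).trans h1
  change c₀ * ε ^ (-a) ≤ ε ^ (-a) * (C * A * δ ^ s * J + _) at h2
  rw [mul_comm, mul_le_mul_iff_right₀ hεa] at h2
  nlinarith

/-- The lower bound on the kernel near the origin. -/
lemma exists_lower_bound (hg : KernelBounds s g ghat C₁ C₂ C) (htop : Tendsto g (𝓝[≠] 0) atTop)
    (hdec : ∃ c < (1 : ℝ), ∃ r₀ > 0, ∀ x ∈ Metric.ball (0 : Space d) r₀,
      ∀ y ∈ Metric.ball (0 : Space d) r₀, x ≠ 0 → y ≠ 0 → 2 * ‖x‖ ≤ ‖y‖ → g y < c * g x) :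
    ∃ c > 0, ∃ r > 0, ∀ x : Space d, x ≠ 0 → ‖x‖ < r →
      c * ‖x‖ ^ (-((d : ℝ) - 2 * s)) ≤ g x := by
  obtain ⟨δ, hδ, L, hL, c, hc, hann⟩ := hg.exists_annulus_point
  obtain ⟨q, hq, r₀, hr₀, hdec⟩ := hdec
  have hpos := htop.eventually (eventually_gt_atTop 0)
  rw [eventually_nhdsWithin_iff, Metric.eventually_nhds_iff] at hpos
  obtain ⟨r₁, hr₁, hpos⟩ := hpos
  set a : ℝ := (d : ℝ) - 2 * s
  refine ⟨c * (2 / δ) ^ (-a), by positivity,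
    min (min r₀ r₁) (r₀ / (L * (2 / δ))), by positivity, fun x hx hxr => ?_⟩
  have hx0 : 0 < ‖x‖ := norm_pos_iff.2 hx
  have hx1 : ‖x‖ < r₀ := hxr.trans_le ((min_le_left _ _).trans (min_le_left _ _))
  have hx2 : ‖x‖ < r₁ := hxr.trans_le ((min_le_left _ _).trans (min_le_right _ _))
  have hx3 : ‖x‖ < r₀ / (L * (2 / δ)) := hxr.trans_le (min_le_right _ _)
  -- The scale `2‖x‖/δ` puts the annulus point `y` at distance at least `2‖x‖`, so that the decay
  -- condition compares `g y` with `g x`. Since `q < 1` and `g x > 0`, it follows that `g y < g x`.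
  -- The last term in the radius above ensures `‖y‖ < r₀`.
  obtain ⟨y, hy1, hy2, hy3⟩ := hann (2 / δ * ‖x‖) (by positivity)
  have e1 : δ * (2 / δ * ‖x‖) = 2 * ‖x‖ := by field_simp
  rw [e1] at hy1
  have hy0 : y ≠ 0 := norm_pos_iff.1 (by linarith)
  have hyr : ‖y‖ < r₀ := by
    refine hy2.trans_lt ?_
    rw [lt_div_iff₀ (by positivity)] at hx3
    linarith
  have h1 := hdec x (by simpa using hx1) y (by simpa using hyr) hx hy0 hy1
  have h2 : 0 < g x := hpos (by simpa using hx2) hx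
  rw [Real.mul_rpow (by positivity) hx0.le] at hy3
  nlinarith

end KernelBounds

/-! ### From the axioms to two-sided bounds on the kernel -/

/-- Kernel bounds complemented by the lower bounds on the kernel. -/
structure SharpKernelBounds {d : ℕ} (s : ℝ) (g ghat : Space d → ℝ) (C₁ C₂ C A K : ℝ) : Prop
    extends KernelBounds s g ghat C₁ C₂ C where
  even : ∀ x, g (-x) = g x
  A_nonneg : 0 ≤ A
  rpow_le : ∀ x, x ≠ 0 → ‖x‖ ^ (-((d : ℝ) - 2 * s)) ≤ A * (|g x| + 1)
  neg_le : ∀ x, -K ≤ g x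

lemma norm_incl (d m : ℕ) (x : Space d) : ‖incl d m x‖ = ‖x‖ := by
  simp [incl, EuclideanSpace.norm_eq]

lemma incl_ne_zero {d m : ℕ} {x : Space d} (hx : x ≠ 0) : incl d m x ≠ 0 := by
  rwa [← norm_ne_zero_iff, norm_incl, norm_ne_zero_iff]

lemma incl_zero (d m : ℕ) : incl d m 0 = 0 := by
  rw [← norm_eq_zero, norm_incl, norm_zero]

lemma incl_neg (d m : ℕ) (x : Space d) : incl d m (-x) = -incl d m x := by
  ext i
  rcases i with i | i <;> simp [incl]

lemma continuous_incl (d m : ℕ) : Continuous (incl d m) := by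
  unfold incl
  refine (PiLp.continuous_toLp 2 _).comp (continuous_pi fun i => ?_)
  rcases i with i | i
  · simp only [Sum.elim_inl]; fun_prop
  · simp only [Sum.elim_inr]; fun_prop

lemma update_ae_eq {d : ℕ} (hd : 0 < d) (f : Space d → ℝ) (c : ℝ) :
    Function.update f 0 c =ᵐ[volume] f := by
  have := nontrivial_space hd
  have : ∀ᵐ x ∂(volume : Measure (Space d)), x ≠ 0 := by simp [ae_iff]
  filter_upwards [this] with x hx
  simp [hx]

lemma IsFourierTransform.congr {d : ℕ} {u u' w w' : Space d → ℝ} (h : IsFourierTransform u w)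
    (hu : u' =ᵐ[volume] u) (hw : w' =ᵐ[volume] w) : IsFourierTransform u' w' := by
  intro φ
  have h1 : ∫ x, (u' x : ℂ) * (𝓕 φ) x = ∫ x, (u x : ℂ) * (𝓕 φ) x :=
    integral_congr_ae (by filter_upwards [hu] with x hx; rw [hx])
  have h2 : ∫ x, (w' x : ℂ) * φ x = ∫ x, (w x : ℂ) * φ x :=
    integral_congr_ae (by filter_upwards [hw] with x hx; rw [hx])
  rw [h1, h2]
  exact h φ

/-- The data of the extended kernel are restricted along `incl`, and the values of `g` and `ĝ` at
the origin are reset to `0`. With `0 ^ (-b) = 0` for `b ≠ 0` the power bounds then hold everywhere;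
the Fourier pairing does not see a single point, and the energies use the value `⊤` there anyway. -/
lemma IsRieszType.exists_bounds {d : ℕ} {s : ℝ} (hs : s ∈ Set.Ioo (0 : ℝ) (min 1 ((d : ℝ) / 2)))
    {g : Space d → ℝ} (hg : IsRieszType d s g) :
    ∃ (g₀ ghat : Space d → ℝ) (C₁ C₂ C A K : ℝ),
      SharpKernelBounds s g₀ ghat C₁ C₂ C A K ∧ ∀ x, x ≠ 0 → g₀ x = g x := by
  obtain ⟨m, G, C₁, C₂, C, hC₁, hC₂, hC, hGg, heven, htop, -, habs, hdiff, -, hdec, hhat⟩ := hg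
  obtain ⟨ghat, hmeas, hF, hbd, -⟩ := hhat
  have hs0 : 0 < s := hs.1
  have hs2 : 2 * s < d := by linarith [hs.2.trans_le (min_le_right _ _)]
  have hd : 0 < d := by
    have : (0 : ℝ) < d := by linarith
    exact_mod_cast this
  have ha : 0 < (d : ℝ) - 2 * s := by linarith
  set g₀ := Function.update g 0 0
  set h₀ := Function.update ghat 0 0
  have hg₀ : ∀ x, x ≠ 0 → g₀ x = g x := fun x hx => by simp [g₀, hx]
  have hg₀0 : g₀ 0 = 0 := by simp [g₀]
  have hh₀ : ∀ x, x ≠ 0 → h₀ x = ghat x := fun x hx => by simp [h₀, hx]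
  have hh₀0 : h₀ 0 = 0 := by simp [h₀]
  have hev : ∀ᶠ x in 𝓝[≠] (0 : Space d), g₀ x = g x :=
    eventually_nhdsWithin_of_forall fun x hx => hg₀ x hx
  have hincl : Tendsto (incl d m) (𝓝[≠] 0) (𝓝[≠] 0) := by
    refine tendsto_nhdsWithin_iff.2 ⟨?_, eventually_nhdsWithin_of_forall fun x hx => incl_ne_zero hx⟩
    have := ((continuous_incl d m).tendsto 0).mono_left (nhdsWithin_le_nhds (s := {0}ᶜ))
    rwa [incl_zero] at this
  have htop₀ : Tendsto g₀ (𝓝[≠] 0) atTop := by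
    have h1 : Tendsto g (𝓝[≠] 0) atTop := by
      refine (htop.comp hincl).congr fun x => hGg x
    exact h1.congr' (hev.mono fun x hx => hx.symm)
  have hKB : KernelBounds s g₀ h₀ C₁ C₂ C :=
    { s_pos := hs0
      two_s_lt := hs2
      C₁_pos := hC₁
      C_nonneg := hC
      continuousAt := by
        intro x hx
        have h1 : ContinuousAt g x := by
          have : g = G ∘ incl d m := funext fun x => (hGg x).symm
          rw [this]
          exact (hdiff _ (incl_ne_zero hx)).1.continuousAt.comp (continuous_incl d m).continuousAt
        refine h1.congr ?_
        filter_upwards [isOpen_ne.mem_nhds hx] with y hy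
        exact (hg₀ y hy).symm
      abs_le := by
        intro x
        rcases eq_or_ne x 0 with rfl | hx
        · rw [hg₀0, abs_zero]; positivity
        · have := habs _ (incl_ne_zero hx)
          rwa [hGg, norm_incl, div_eq_mul_inv, ← Real.rpow_neg (norm_nonneg _), ← hg₀ x hx] at this
      measurable_hat := by
        have h : h₀ = fun x => if x = 0 then 0 else ghat x := by
          ext x; simp [h₀, Function.update_apply]
        rw [h]
        exact Measurable.ite (measurableSet_singleton 0) measurable_const hmeas
      fourier := hF.congr (update_ae_eq hd _ _) (update_ae_eq hd _ _)
      le_hat := by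
        intro ξ
        rcases eq_or_ne ξ 0 with rfl | hx
        · rw [hh₀0, norm_zero, Real.zero_rpow (by linarith), mul_zero]
        · have := (hbd ξ hx).1
          rwa [div_eq_mul_inv, ← Real.rpow_neg (norm_nonneg _), ← hh₀ ξ hx] at this
      hat_le := by
        intro ξ
        rcases eq_or_ne ξ 0 with rfl | hx
        · rw [hh₀0, norm_zero, Real.zero_rpow (by linarith), mul_zero]
        · have := (hbd ξ hx).2
          rwa [div_eq_mul_inv, ← Real.rpow_neg (norm_nonneg _), ← hh₀ ξ hx] at this }
  obtain ⟨c, hc, r, hr, hlow⟩ := hKB.exists_lower_bound htop₀ (by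
    obtain ⟨q, hq, r₀, hr₀, h⟩ := hdec
    refine ⟨q, hq, r₀, hr₀, fun x hx y hy hx0 hy0 hxy => ?_⟩
    have := h (incl d m x) (by simpa [norm_incl] using hx) (incl d m y)
      (by simpa [norm_incl] using hy) (incl_ne_zero hx0) (incl_ne_zero hy0)
      (by simpa [norm_incl] using hxy)
    rwa [hGg, hGg, ← hg₀ x hx0, ← hg₀ y hy0] at this)
  -- Inside radius `r` the lower bound on `g₀` gives the constant `c⁻¹` and positivity; outside,
  -- `‖x‖^(-a) ≤ r^(-a)` gives the other summand of `A`, and `|g₀| ≤ C r^(-a)` gives `K`.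
  refine ⟨g₀, h₀, C₁, C₂, C, c⁻¹ + r ^ (-((d : ℝ) - 2 * s)), C * r ^ (-((d : ℝ) - 2 * s)),
    { toKernelBounds := hKB
      even := ?_
      A_nonneg := by positivity
      rpow_le := ?_
      neg_le := ?_ }, hg₀⟩
  · intro x
    rcases eq_or_ne x 0 with rfl | hx
    · simp
    · rw [hg₀ x hx, hg₀ (-x) (neg_ne_zero.2 hx), ← hGg, ← hGg, incl_neg,
        heven _ (incl_ne_zero hx)]
  · intro x hx
    rcases lt_or_ge ‖x‖ r with h | h
    · have h1 := hlow x hx h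
      have h2 : ‖x‖ ^ (-((d : ℝ) - 2 * s)) ≤ c⁻¹ * g₀ x := by
        rw [inv_mul_eq_div, le_div_iff₀ hc, mul_comm]; exact h1
      refine h2.trans (mul_le_mul (le_add_of_nonneg_right (by positivity)) ?_ ?_ (by positivity))
      · linarith [le_abs_self (g₀ x)]
      · exact (mul_nonneg hc.le (by positivity)).trans h1
    · have h1 : ‖x‖ ^ (-((d : ℝ) - 2 * s)) ≤ r ^ (-((d : ℝ) - 2 * s)) :=
        Real.rpow_le_rpow_of_nonpos hr h (by linarith)
      calc ‖x‖ ^ (-((d : ℝ) - 2 * s)) ≤ (c⁻¹ + r ^ (-((d : ℝ) - 2 * s))) * 1 := by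
            rw [mul_one]; exact h1.trans (le_add_of_nonneg_left (by positivity))
        _ ≤ _ := by gcongr; linarith [abs_nonneg (g₀ x)]
  · intro x
    rcases eq_or_ne x 0 with rfl | hx
    · rw [hg₀0, neg_nonpos]; positivity
    rcases lt_or_ge ‖x‖ r with h | h
    · have h1 := hlow x hx h
      have h2 : 0 ≤ c * ‖x‖ ^ (-((d : ℝ) - 2 * s)) := by positivity
      have h3 : 0 ≤ C * r ^ (-((d : ℝ) - 2 * s)) := by positivity
      linarith
    · have h1 : ‖x‖ ^ (-((d : ℝ) - 2 * s)) ≤ r ^ (-((d : ℝ) - 2 * s)) :=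
        Real.rpow_le_rpow_of_nonpos hr h (by linarith)
      refine neg_le_of_abs_le ((hKB.abs_le x).trans ?_)
      gcongr

/-! ### Energies of finite measures -/

/-- The Fourier transform of a measure. -/
def measureFourier {d : ℕ} (p : Measure (Space d)) (ξ : Space d) : ℂ := ∫ x, expInner x ξ ∂p

/-- The interaction energy of two measures. -/
def interaction {d : ℕ} (g : Space d → ℝ) (p q : Measure (Space d)) : ℝ :=
  ∫ z, g (z.1 - z.2) ∂(p.prod q)

/-- The measure has finite self-interaction energy; in particular it does not charge points. -/
def FiniteEnergy {d : ℕ} (g : Space d → ℝ) (p : Measure (Space d)) : Prop :=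
  Integrable (fun z : Space d × Space d => g (z.1 - z.2)) (p.prod p) ∧
    ∀ᵐ z ∂(p.prod p), z.1 ≠ z.2

lemma continuous_measureFourier {d : ℕ} (p : Measure (Space d)) [IsFiniteMeasure p] :
    Continuous (measureFourier p) := by
  refine continuous_of_dominated (bound := fun _ => 1) (fun ξ => ?_) (fun ξ => ?_)
    (integrable_const _) (ae_of_all _ fun x => ?_)
  · exact (by fun_prop : Continuous fun x => expInner x ξ).aestronglyMeasurable
  · exact ae_of_all _ fun x => by simp
  · fun_prop

lemma norm_measureFourier_le {d : ℕ} (p : Measure (Space d)) [IsFiniteMeasure p] (ξ : Space d) :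
    ‖measureFourier p ξ‖ ≤ p.real Set.univ := by
  refine (norm_integral_le_integral_norm _).trans ?_
  simp

/-- A null diagonal for `p × p` forces `p {x} ^ 2 = 0` for each `x`; a measure without atoms gives a
null diagonal against any finite `q`, by Fubini. -/
lemma FiniteEnergy.ae_ne {d : ℕ} {g : Space d → ℝ} {p : Measure (Space d)} [IsFiniteMeasure p]
    (hp : FiniteEnergy g p) (q : Measure (Space d)) [IsFiniteMeasure q] :
    ∀ᵐ z ∂(q.prod p), z.1 ≠ z.2 := by
  have hatom : ∀ x, p {x} = 0 := by
    intro x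
    have h1 : (p.prod p) ({x} ×ˢ {x}) = 0 := by
      refine measure_mono_null ?_ (ae_iff.1 hp.2)
      rintro ⟨a, b⟩ ⟨ha, hb⟩
      simp only [Set.mem_singleton_iff] at ha hb
      simp [ha, hb]
    rw [Measure.prod_prod] at h1
    simpa using h1
  rw [ae_iff]
  have hm : MeasurableSet {z : Space d × Space d | ¬ z.1 ≠ z.2} := by
    simp only [ne_eq, not_not]
    exact measurableSet_eq_fun measurable_fst measurable_snd
  rw [Measure.prod_apply hm]
  have : ∀ x, Prod.mk x ⁻¹' {z : Space d × Space d | ¬ z.1 ≠ z.2} = {x} := by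
    intro x; ext y; simp [eq_comm]
  simp only [this, hatom, lintegral_zero]

namespace KernelBounds

variable {d : ℕ} {s : ℝ} {g ghat : Space d → ℝ} {C₁ C₂ C : ℝ} (η : Mollifier d)

lemma measurable_sub (hg : KernelBounds s g ghat C₁ C₂ C) :
    Measurable fun z : Space d × Space d => g (z.1 - z.2) :=
  hg.measurable.comp (measurable_fst.sub measurable_snd)

lemma integrable_hat_mul_expInner (hg : KernelBounds s g ghat C₁ C₂ C) {ε : ℝ} (hε : 0 < ε)
    (z : Space d) :
    Integrable fun ξ => (ghat ξ : ℂ) * (expInner z ξ * η.φ (ε • ξ)) := by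
  have hc := η.continuous_φ
  refine (hg.integrable_hat_mul_φ η hε).mono' ?_ (ae_of_all _ fun ξ => ?_)
  · exact ((Complex.measurable_ofReal.comp hg.measurable_hat).mul
      (by fun_prop : Continuous fun ξ => expInner z ξ * (η.φ (ε • ξ) : ℂ)).measurable).aestronglyMeasurable
  · simp [abs_of_nonneg (hg.hat_nonneg ξ), abs_of_nonneg (η.φ_nonneg _)]

lemma continuous_mollify (hg : KernelBounds s g ghat C₁ C₂ C) {ε : ℝ} (hε : 0 < ε) : Continuous
    (mollify η g ε) := by
  have h : Continuous fun z => (mollify η g ε z : ℂ) := by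
    simp_rw [← hg.integral_hat_eq_mollify η hε]
    refine continuous_of_dominated (fun z => (hg.integrable_hat_mul_expInner η hε z).1)
      (fun z => ae_of_all _ fun ξ => ?_) (hg.integrable_hat_mul_φ η hε) (ae_of_all _ fun ξ => ?_)
    · simp [abs_of_nonneg (hg.hat_nonneg ξ), abs_of_nonneg (η.φ_nonneg _)]
    · fun_prop
  exact Complex.continuous_re.comp h

lemma abs_mollify_le_integral (hg : KernelBounds s g ghat C₁ C₂ C) {ε : ℝ} (hε : 0 < ε)
    (z : Space d) :
    |mollify η g ε z| ≤ ∫ ξ, ghat ξ * η.φ (ε • ξ) := by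
  have h : ‖(mollify η g ε z : ℂ)‖ ≤ ∫ ξ, ghat ξ * η.φ (ε • ξ) := by
    rw [← hg.integral_hat_eq_mollify η hε]
    refine norm_integral_le_of_norm_le (hg.integrable_hat_mul_φ η hε) (ae_of_all _ fun ξ => ?_)
    simp [abs_of_nonneg (hg.hat_nonneg ξ), abs_of_nonneg (η.φ_nonneg _)]
  simpa using h

lemma integrable_mollify_sub (hg : KernelBounds s g ghat C₁ C₂ C) {ε : ℝ} (hε : 0 < ε)
    (p q : Measure (Space d)) [IsFiniteMeasure p]
    [IsFiniteMeasure q] :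
    Integrable (fun z : Space d × Space d => mollify η g ε (z.1 - z.2)) (p.prod q) := by
  have hc := hg.continuous_mollify η hε
  exact (integrable_const (∫ ξ, ghat ξ * η.φ (ε • ξ))).mono'
    (by fun_prop : Continuous fun z : Space d × Space d => mollify η g ε (z.1 - z.2)).aestronglyMeasurable
    (ae_of_all _ fun z => hg.abs_mollify_le_integral η hε _)

/-- Fubini applies because `ĝ φ(ε·)` is integrable and characters have modulus one; the character of
`x - y` factors into the two transforms. -/
lemma interaction_mollify_eq (hg : KernelBounds s g ghat C₁ C₂ C) {ε : ℝ} (hε : 0 < ε)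
    (p q : Measure (Space d)) [IsFiniteMeasure p]
    [IsFiniteMeasure q] :
    (interaction (mollify η g ε) p q : ℂ) =
      ∫ ξ, (ghat ξ * η.φ (ε • ξ) : ℝ) * (measureFourier p ξ *
        starRingEnd ℂ (measureFourier q ξ)) := by
  have hc := η.continuous_φ
  rw [interaction, ← integral_complex_ofReal]
  simp_rw [← hg.integral_hat_eq_mollify η hε]
  rw [integral_integral_swap]
  · congr 1 with ξ
    rw [integral_const_mul, integral_mul_const, measureFourier, measureFourier, ← integral_conj,
      ← integral_prod_mul]
    simp_rw [sub_eq_add_neg, expInner_add, expInner_neg]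
    push_cast
    ring
  · have h1 : Integrable (fun x : (Space d × Space d) × Space d => ghat x.2 * η.φ (ε • x.2))
        ((p.prod q).prod volume) := (hg.integrable_hat_mul_φ η hε).comp_snd (p.prod q)
    refine h1.mono' ?_ (ae_of_all _ fun x => ?_)
    · refine (Measurable.mul ?_ ?_).aestronglyMeasurable
      · exact Complex.measurable_ofReal.comp (hg.measurable_hat.comp measurable_snd)
      · exact (by fun_prop : Continuous fun x : (Space d × Space d) × Space d =>
          expInner (x.1.1 - x.1.2) x.2 * (η.φ (ε • x.2) : ℂ)).measurable
    · change ‖(ghat x.2 : ℂ) * (expInner (x.1.1 - x.1.2) x.2 * (η.φ (ε • x.2) : ℂ))‖ ≤ _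
      simp [abs_of_nonneg (hg.hat_nonneg _), abs_of_nonneg (η.φ_nonneg _)]

lemma integrable_hat_mul_measureFourier (hg : KernelBounds s g ghat C₁ C₂ C) {ε : ℝ} (hε : 0 < ε)
    (p q : Measure (Space d))
    [IsFiniteMeasure p] [IsFiniteMeasure q] :
    Integrable fun ξ => ((ghat ξ * η.φ (ε • ξ) : ℝ) : ℂ) * (measureFourier p ξ *
        starRingEnd ℂ (measureFourier q ξ)) := by
  have hp := continuous_measureFourier p
  have hq := continuous_measureFourier q
  refine (hg.integrable_hat_mul_φ η hε).ofReal.mul_bdd (c := p.real Set.univ * q.real Set.univ) ?_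
    (ae_of_all _ fun ξ => ?_)
  · exact (hp.mul (Complex.continuous_conj.comp hq)).aestronglyMeasurable
  · rw [norm_mul, RCLike.norm_conj]
    exact mul_le_mul (norm_measureFourier_le p ξ) (norm_measureFourier_le q ξ) (norm_nonneg _)
      measureReal_nonneg

/-- The mollified energy of `p - q` on the Fourier side. -/
lemma interaction_mollify_sub (hg : KernelBounds s g ghat C₁ C₂ C) {ε : ℝ} (hε : 0 < ε)
    (p q : Measure (Space d)) [IsFiniteMeasure p]
    [IsFiniteMeasure q] :
    interaction (mollify η g ε) p p - interaction (mollify η g ε) p q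
      - interaction (mollify η g ε) q p + interaction (mollify η g ε) q q =
      ∫ ξ, ghat ξ * η.φ (ε • ξ) * ‖measureFourier p ξ - measureFourier q ξ‖ ^ 2 := by
  rw [← Complex.ofReal_inj]
  push_cast
  rw [hg.interaction_mollify_eq η hε, hg.interaction_mollify_eq η hε,
    hg.interaction_mollify_eq η hε, hg.interaction_mollify_eq η hε, ← integral_complex_ofReal]
  have i := fun (p q : Measure (Space d)) [IsFiniteMeasure p] [IsFiniteMeasure q] =>
    hg.integrable_hat_mul_measureFourier η hε p q
  rw [← integral_sub' (i p p) (i p q), ← integral_sub' ((i p p).sub (i p q)) (i q p),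
    ← integral_add' (((i p p).sub (i p q)).sub (i q p)) (i q q)]
  congr 1 with ξ
  push_cast
  rw [← Complex.mul_conj']
  simp only [Pi.add_apply, Pi.sub_apply, map_sub]
  ring

end KernelBounds

/-! ### Coercivity of the energy -/

/-- The squared homogeneous Sobolev norm of order `-s` of the difference of two measures. -/
def negSobolevSq {d : ℕ} (s : ℝ) (p q : Measure (Space d)) : ℝ≥0∞ :=
  ∫⁻ ξ, ENNReal.ofReal (‖ξ‖ ^ (-(2 * s)) * ‖measureFourier p ξ - measureFourier q ξ‖ ^ 2)

lemma tendsto_one_div_add_one : Tendsto (fun k : ℕ => 1 / ((k : ℝ) + 1)) atTop (𝓝 0) :=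
  tendsto_one_div_add_atTop_nhds_zero_nat

namespace SharpKernelBounds

variable {d : ℕ} {s : ℝ} {g ghat : Space d → ℝ} {C₁ C₂ C A K : ℝ} (η : Mollifier d)

/-- Here the lower bound on the kernel pays off: the majorant is expressed by `g` itself, so finite
interaction energy is enough for dominated convergence. -/
lemma exists_mollify_dominated (hg : SharpKernelBounds s g ghat C₁ C₂ C A K) :
    ∃ B, 0 ≤ B ∧ ∀ ε : ℝ, 0 < ε → ∀ z, z ≠ 0 → |mollify η g ε z| ≤ B * (|g z| + 1) := by
  obtain ⟨B, hB, h⟩ := hg.exists_abs_mollify_le η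
  refine ⟨B * A, mul_nonneg hB hg.A_nonneg, fun ε hε z hz => (h ε hε z hz).trans ?_⟩
  rw [mul_assoc]
  exact mul_le_mul_of_nonneg_left (hg.rpow_le z hz) hB

lemma tendsto_interaction_mollify (hg : SharpKernelBounds s g ghat C₁ C₂ C A K)
    {p q : Measure (Space d)} [IsFiniteMeasure p]
    [IsFiniteMeasure q]
    (hi : Integrable (fun z : Space d × Space d => g (z.1 - z.2)) (p.prod q))
    (hne : ∀ᵐ z ∂(p.prod q), z.1 ≠ z.2) {ε : ℕ → ℝ} (hε0 : ∀ k, 0 < ε k)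
    (hε : Tendsto ε atTop (𝓝 0)) :
    Tendsto (fun k => interaction (mollify η g (ε k)) p q) atTop (𝓝 (interaction g p q)) := by
  obtain ⟨B, hB, h⟩ := hg.exists_mollify_dominated η
  refine tendsto_integral_of_dominated_convergence
    (fun z : Space d × Space d => B * (|g (z.1 - z.2)| + 1)) (fun k => ?_) ?_ (fun k => ?_) ?_
  · exact (hg.integrable_mollify_sub η (hε0 k) p q).1
  · exact (hi.abs.add (integrable_const 1)).const_mul B
  · filter_upwards [hne] with z hz
    exact h _ (hε0 k) _ (sub_ne_zero.2 hz)
  · filter_upwards [hne] with z hz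
    exact hg.tendsto_mollify η (sub_ne_zero.2 hz) hε0 hε

lemma mul_le_interaction_mollify (hg : SharpKernelBounds s g ghat C₁ C₂ C A K) {ε : ℝ} (hε : 0 < ε)
    (p q : Measure (Space d))
    [IsFiniteMeasure p] [IsFiniteMeasure q] :
    -K * (p.prod q).real Set.univ ≤ interaction (mollify η g ε) p q := by
  have h : ∫ _, -K ∂(p.prod q) ≤ interaction (mollify η g ε) p q :=
    integral_mono (integrable_const _) (hg.integrable_mollify_sub η hε p q)
      fun z => hg.neg_le_mollify η hg.neg_le hε _
  rwa [integral_const, smul_eq_mul, mul_comm] at h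

/-- Two measures of finite energy have finite interaction energy. -/
lemma integrable_cross (hg : SharpKernelBounds s g ghat C₁ C₂ C A K) {p q : Measure (Space d)}
    [IsFiniteMeasure p] [IsFiniteMeasure q]
    (hp : FiniteEnergy g p) (hq : FiniteEnergy g q) :
    Integrable (fun z : Space d × Space d => g (z.1 - z.2)) (p.prod q) := by
  obtain ⟨η⟩ := nonempty_mollifier d
  obtain ⟨B, hB, h⟩ := hg.exists_mollify_dominated η
  have hne := hq.ae_ne p
  set ε : ℕ → ℝ := fun k => 1 / ((k : ℝ) + 1)
  have hε0 : ∀ k, 0 < ε k := fun k => by positivity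
  have hε : Tendsto ε atTop (𝓝 0) := tendsto_one_div_add_one
  have hself : ∀ (r : Measure (Space d)) [IsFiniteMeasure r], FiniteEnergy g r →
      ∃ M, ∀ k, interaction (mollify η g (ε k)) r r ≤ M := by
    intro r _ hr
    obtain ⟨M, hM⟩ := (hg.tendsto_interaction_mollify η hr.1 hr.2 hε0 hε).bddAbove_range
    exact ⟨M, fun k => hM ⟨k, rfl⟩⟩
  obtain ⟨Mp, hMp⟩ := hself p hp
  obtain ⟨Mq, hMq⟩ := hself q hq
  -- The mollified energy of `p - q` is nonnegative on the Fourier side, so the two cross terms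
  -- together are at most the self-energies. One cross term is bounded below through `g ≥ -K`, which
  -- bounds the other above.
  have hbound : ∀ k, interaction (mollify η g (ε k)) p q ≤
      Mp + Mq + K * (q.prod p).real Set.univ := by
    intro k
    have h1 := hg.interaction_mollify_sub η (hε0 k) p q
    have h2 : 0 ≤ ∫ ξ, ghat ξ * η.φ (ε k • ξ) * ‖measureFourier p ξ - measureFourier q ξ‖ ^ 2 :=
      integral_nonneg fun ξ => mul_nonneg (mul_nonneg (hg.hat_nonneg ξ) (η.φ_nonneg _))
        (by positivity)
    have h3 := hg.mul_le_interaction_mollify η (hε0 k) q p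
    linarith [hMp k, hMq k]
  set M := Mp + Mq + K * (q.prod p).real Set.univ + K * (p.prod q).real Set.univ
  -- Adding `K` makes the mollified kernels nonnegative, so Fatou carries the uniform bound over to
  -- `g`.
  have hfatou : ∫⁻ z, ENNReal.ofReal (g (z.1 - z.2) + K) ∂(p.prod q) ≤ ENNReal.ofReal M := by
    have h1 : ∫⁻ z, ENNReal.ofReal (g (z.1 - z.2) + K) ∂(p.prod q) ≤
        ∫⁻ z, liminf (fun k => ENNReal.ofReal (mollify η g (ε k) (z.1 - z.2) + K)) atTop
          ∂(p.prod q) := by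
      refine lintegral_mono_ae ?_
      filter_upwards [hne] with z hz
      refine le_of_eq (Tendsto.liminf_eq ?_).symm
      exact (ENNReal.continuous_ofReal.tendsto _).comp
        ((hg.tendsto_mollify η (sub_ne_zero.2 hz) hε0 hε).add_const K)
    refine h1.trans ((lintegral_liminf_le' fun k => ?_).trans ?_)
    · exact ((hg.integrable_mollify_sub η (hε0 k) p q).1.aemeasurable.add_const K).ennreal_ofReal
    · refine liminf_le_of_le (by isBoundedDefault) fun b hb => ?_
      obtain ⟨k, hk⟩ := hb.exists
      refine hk.trans ?_
      have hadd : Integrable (fun z : Space d × Space d => mollify η g (ε k) (z.1 - z.2) + K)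
          (p.prod q) := (hg.integrable_mollify_sub η (hε0 k) p q).add (integrable_const K)
      rw [← ofReal_integral_eq_lintegral_ofReal hadd (ae_of_all _ fun z => by
          have := hg.neg_le_mollify η hg.neg_le (hε0 k) (z.1 - z.2)
          simp only [Pi.zero_apply]
          linarith)]
      refine ENNReal.ofReal_le_ofReal ?_
      have h2 := integral_add (hg.integrable_mollify_sub η (hε0 k) p q)
        (integrable_const (μ := p.prod q) K)
      rw [h2, integral_const, smul_eq_mul, mul_comm]
      exact add_le_add (hbound k) le_rfl
  have hm := hg.measurable_sub
  have hfin : Integrable (fun z : Space d × Space d => g (z.1 - z.2) + K) (p.prod q) := by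
    refine ⟨(hm.add_const K).aestronglyMeasurable, ?_⟩
    rw [hasFiniteIntegral_iff_ofReal (ae_of_all _ fun z => by
      have := hg.neg_le (z.1 - z.2)
      simp only [Pi.zero_apply]; linarith)]
    exact hfatou.trans_lt ENNReal.ofReal_lt_top
  refine (hfin.sub (integrable_const K)).congr (ae_of_all _ fun z => ?_)
  simp

/-- The energy of `p - q` dominates its Sobolev norm of order `-s`. -/
lemma negSobolevSq_le (hg : SharpKernelBounds s g ghat C₁ C₂ C A K) {p q : Measure (Space d)}
    [IsFiniteMeasure p] [IsFiniteMeasure q]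
    (hp : FiniteEnergy g p) (hq : FiniteEnergy g q) :
    0 ≤ interaction g p p - interaction g p q - interaction g q p + interaction g q q ∧
    ENNReal.ofReal C₁ * negSobolevSq s p q ≤ ENNReal.ofReal
      (interaction g p p - interaction g p q - interaction g q p + interaction g q q) := by
  obtain ⟨η⟩ := nonempty_mollifier d
  set ε : ℕ → ℝ := fun k => 1 / ((k : ℝ) + 1)
  have hε0 : ∀ k, 0 < ε k := fun k => by positivity
  have hε : Tendsto ε atTop (𝓝 0) := tendsto_one_div_add_one
  have hlim := (((hg.tendsto_interaction_mollify η hp.1 hp.2 hε0 hε).sub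
    (hg.tendsto_interaction_mollify η (hg.integrable_cross hp hq) (hq.ae_ne p) hε0 hε)).sub
    (hg.tendsto_interaction_mollify η (hg.integrable_cross hq hp) (hp.ae_ne q) hε0 hε)).add
    (hg.tendsto_interaction_mollify η hq.1 hq.2 hε0 hε)
  simp_rw [fun k => hg.interaction_mollify_sub η (hε0 k) p q] at hlim
  have hnn : ∀ k ξ, 0 ≤ ghat ξ * η.φ (ε k • ξ) * ‖measureFourier p ξ - measureFourier q ξ‖ ^ 2 :=
    fun k ξ => mul_nonneg (mul_nonneg (hg.hat_nonneg ξ) (η.φ_nonneg _)) (by positivity)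
  refine ⟨ge_of_tendsto' hlim fun k => integral_nonneg (hnn k), ?_⟩
  have hcp := continuous_measureFourier p
  have hcq := continuous_measureFourier q
  have hcφ := η.continuous_φ
  set D : Space d → ℝ := fun ξ => ‖measureFourier p ξ - measureFourier q ξ‖ ^ 2
  have hcD : Continuous D := by fun_prop
  have hInt : ∀ k, Integrable fun ξ => ghat ξ * η.φ (ε k • ξ) * D ξ := by
    intro k
    refine (hg.integrable_hat_mul_φ η (hε0 k)).mul_bdd
      (c := (p.real Set.univ + q.real Set.univ) ^ 2) hcD.aestronglyMeasurable
      (ae_of_all _ fun ξ => ?_)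
    rw [Real.norm_of_nonneg (by positivity)]
    refine pow_le_pow_left₀ (norm_nonneg _) ((norm_sub_le _ _).trans ?_) 2
    exact add_le_add (norm_measureFourier_le p ξ) (norm_measureFourier_le q ξ)
  have hlim' := (ENNReal.continuous_ofReal.tendsto _).comp hlim
  rw [← hlim'.liminf_eq, negSobolevSq, ← lintegral_const_mul' _ _ ENNReal.ofReal_ne_top]
  -- Since `φ(ε_k ξ) → 1` pointwise and only an inequality is wanted, Fatou suffices on the Fourier
  -- side, while the energies converge.
  have h1 : ∀ ξ, ENNReal.ofReal C₁ * ENNReal.ofReal (‖ξ‖ ^ (-(2 * s)) * D ξ) ≤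
      liminf (fun k => ENNReal.ofReal (ghat ξ * η.φ (ε k • ξ) * D ξ)) atTop := by
    intro ξ
    have ht : Tendsto (fun k => ENNReal.ofReal (ghat ξ * η.φ (ε k • ξ) * D ξ)) atTop
        (𝓝 (ENNReal.ofReal (ghat ξ * 1 * D ξ))) :=
      (ENNReal.continuous_ofReal.tendsto _).comp
        (((η.tendsto_φ ξ hε).const_mul (ghat ξ)).mul_const (D ξ))
    rw [ht.liminf_eq, ← ENNReal.ofReal_mul hg.C₁_pos.le, ← mul_assoc, mul_one]
    exact ENNReal.ofReal_le_ofReal (mul_le_mul_of_nonneg_right (hg.le_hat ξ) (by positivity))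
  refine (lintegral_mono h1).trans ((lintegral_liminf_le' fun k =>
    (hInt k).1.aemeasurable.ennreal_ofReal).trans (le_of_eq ?_))
  congr 1
  ext k
  exact (ofReal_integral_eq_lintegral_ofReal (hInt k) (ae_of_all _ (hnn k))).symm

end SharpKernelBounds

/-! ### Plancherel's identity and fractional Sobolev norms of Hölder functions -/

lemma integral_mul_fourier {d : ℕ} {H : Space d → ℂ} (hH : Integrable H) (φ : 𝓢(Space d, ℂ)) :
    ∫ x, H x * (𝓕 φ) x = ∫ ξ, 𝓕 H ξ * φ ξ := by
  have h := VectorFourier.integral_bilin_fourierIntegral_eq_flip (ContinuousLinearMap.mul ℂ ℂ)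
    (L := innerₗ (Space d)) (μ := volume) (ν := volume)
    Real.continuous_fourierChar continuous_inner hH (φ.integrable (μ := volume))
  simpa using! h.symm

lemma continuous_fourier {d : ℕ} {H : Space d → ℂ} (hH : Integrable H) : Continuous (𝓕 H) :=
  VectorFourier.fourierIntegral_continuous Real.continuous_fourierChar continuous_inner hH

/-- The `L²` transform, defined by extension, agrees almost everywhere with the integral transform:
both give the same pairing with every smooth compactly supported function. Its isometry property is
then Plancherel for the integral transform. -/
lemma lintegral_enorm_fourier_sq {d : ℕ} {H : Space d → ℂ} (hH : Integrable H)
    (hH2 : MemLp H 2 volume) : ∫⁻ ξ, ‖𝓕 H ξ‖ₑ ^ 2 = ∫⁻ x, ‖H x‖ₑ ^ 2 := by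
  set f : Lp ℂ 2 (volume : Measure (Space d)) := hH2.toLp H
  have hae : (𝓕 f : Lp ℂ 2 (volume : Measure (Space d))) =ᵐ[volume] 𝓕 H := by
    refine ae_eq_of_integral_contDiff_smul_eq ?_ (continuous_fourier hH).locallyIntegrable ?_
    · exact (Lp.memLp (𝓕 f)).locallyIntegrable (by norm_num)
    · intro b hb hbs
      have hcd : ContDiff ℝ ∞ fun x => (b x : ℂ) := Complex.ofRealCLM.contDiff.comp hb
      have hcs : HasCompactSupport fun x => (b x : ℂ) :=
        hbs.comp_left (g := fun r : ℝ => (r : ℂ)) (by simp)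
      let Φ : 𝓢(Space d, ℂ) := hcs.toSchwartzMap hcd
      have hΦ : ∀ x, Φ x = (b x : ℂ) := fun x => rfl
      have h1 := congrArg (fun T => T Φ) (Lp.fourier_toTemperedDistribution_eq f)
      simp only [TemperedDistribution.fourier_apply, Lp.toTemperedDistribution_apply] at h1
      have h2 : ∫ x, (𝓕 Φ) x • f x = ∫ x, H x * (𝓕 Φ) x := by
        refine integral_congr_ae ?_
        filter_upwards [hH2.coeFn_toLp] with x hx
        rw [hx, smul_eq_mul, mul_comm]
      rw [h2, integral_mul_fourier hH] at h1
      simp only [hΦ, smul_eq_mul] at h1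
      simp only [Complex.real_smul]
      rw [← h1]
      congr 1 with x
      ring
  have hnorm : ‖(𝓕 f : Lp ℂ 2 (volume : Measure (Space d)))‖ = ‖f‖ := Lp.norm_fourier_eq f
  have h3 : eLpNorm (𝓕 H) 2 volume = eLpNorm H 2 volume := by
    rw [← eLpNorm_congr_ae hae, ← eLpNorm_congr_ae hH2.coeFn_toLp]
    rw [Lp.norm_def, Lp.norm_def] at hnorm
    exact (ENNReal.toReal_eq_toReal_iff' (Lp.eLpNorm_ne_top _) (Lp.eLpNorm_ne_top _)).1 hnorm
  have h4 := congrArg (fun t : ℝ≥0∞ => t ^ (2 : ℝ)) h3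
  simp only [eLpNorm_eq_lintegral_rpow_enorm_toReal two_ne_zero ENNReal.ofNat_ne_top,
    ← ENNReal.rpow_mul] at h4
  simpa using h4

lemma fourier_translate_sub {d : ℕ} {H : Space d → ℂ} (hH : Integrable H) (y ξ : Space d) :
    𝓕 (fun x => H (x + y) - H x) ξ = (expInner y ξ - 1) * 𝓕 H ξ := by
  have hi : Integrable fun x => expInner (-x) ξ * H x := by
    refine hH.bdd_mul (c := 1) (by fun_prop : Continuous fun x : Space d =>
      expInner (-x) ξ).aestronglyMeasurable (ae_of_all _ fun x => by simp)
  have hi' : Integrable fun x => expInner (-x) ξ * H (x + y) := by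
    refine (hH.comp_add_right y).bdd_mul (c := 1) (by fun_prop : Continuous fun x : Space d =>
      expInner (-x) ξ).aestronglyMeasurable (ae_of_all _ fun x => by simp)
  rw [fourier_eq_integral_expInner, fourier_eq_integral_expInner]
  simp_rw [mul_sub]
  rw [integral_sub hi' hi, sub_mul, one_mul, ← integral_const_mul,
    ← integral_add_right_eq_self (fun x => expInner y ξ * (expInner (-x) ξ * H x)) y]
  congr 2 with x
  rw [← mul_assoc, ← expInner_add]
  congr 2
  abel

/-- `|e^(iθ) - 1|² = 2 - 2 cos θ`, and the cosine is nonpositive on `[π/2, 3π/2]`. -/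
lemma two_le_norm_expInner_sub_one_sq {d : ℕ} {y ξ : Space d}
    (h1 : 1 / 4 ≤ inner ℝ y ξ) (h2 : inner ℝ y ξ ≤ 3 / 4) : 2 ≤ ‖expInner y ξ - 1‖ ^ 2 := by
  have hre : (expInner y ξ).re = Real.cos (2 * Real.pi * inner ℝ y ξ) := by
    rw [expInner, Real.fourierChar_apply]
    simp [Complex.exp_re]
  have hn : ‖expInner y ξ‖ ^ 2 = 1 := by simp
  have hcos : Real.cos (2 * Real.pi * inner ℝ y ξ) ≤ 0 := by
    refine Real.cos_nonpos_of_pi_div_two_le_of_le ?_ ?_ <;> nlinarith [Real.pi_pos]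
  rw [← Complex.normSq_eq_norm_sq, Complex.normSq_apply] at hn ⊢
  simp only [Complex.sub_re, Complex.sub_im, Complex.one_re, Complex.one_im, sub_zero]
  rw [hre] at hn ⊢
  nlinarith

/-- The Gagliardo weight dominates `‖ξ‖^{2s}`. -/
lemma exists_norm_rpow_le_lintegral {d : ℕ} {s : ℝ} (hs : 0 < s) :
    ∃ c > 0, ∀ ξ : Space d, ENNReal.ofReal (c * ‖ξ‖ ^ (2 * s)) ≤
      ∫⁻ y, ENNReal.ofReal (‖y‖ ^ (-((d : ℝ) + 2 * s))) * ‖expInner y ξ - 1‖ₑ ^ 2 := by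
  have hpos : 0 < (volume (Metric.ball (0 : Space d) 1)).toReal :=
    ENNReal.toReal_pos (Metric.measure_ball_pos _ _ one_pos).ne' measure_ball_lt_top.ne
  set vol := (volume (Metric.ball (0 : Space d) 1)).toReal with hvol
  refine ⟨(1 / 4) ^ d * vol, by positivity, fun ξ => ?_⟩
  rcases eq_or_ne ξ 0 with rfl | hξ
  · rw [norm_zero, Real.zero_rpow (by linarith)]; simp
  have hn : 0 < ‖ξ‖ := norm_pos_iff.2 hξ
  -- At `y₀` the phase `⟨y, ξ⟩` equals `1/2`, and radius `1/(4‖ξ‖)` keeps it within `[1/4, 3/4]`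
  -- with `‖y‖ ≤ 1/‖ξ‖`. The weight there is at least `‖ξ‖^(d+2s)`, against a volume of order
  -- `‖ξ‖^(-d)`.
  set y₀ : Space d := (1 / (2 * ‖ξ‖ ^ 2)) • ξ
  set ρ : ℝ := 1 / (4 * ‖ξ‖)
  have hρ : 0 < ρ := by positivity
  have hy₀ : inner ℝ y₀ ξ = (1 / 2 : ℝ) := by
    simp only [y₀, real_inner_smul_left, real_inner_self_eq_norm_sq]; field_simp
  have hy₀n : ‖y₀‖ = 1 / (2 * ‖ξ‖) := by
    simp only [y₀, norm_smul, Real.norm_eq_abs]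
    rw [abs_of_pos (by positivity)]; field_simp
  have hpt : ∀ y ∈ Metric.ball y₀ ρ, ENNReal.ofReal (‖ξ‖ ^ ((d : ℝ) + 2 * s)) ≤
      ENNReal.ofReal (‖y‖ ^ (-((d : ℝ) + 2 * s))) * ‖expInner y ξ - 1‖ₑ ^ 2 := by
    intro y hy
    rw [mem_ball_iff_norm] at hy
    have h1 : |inner ℝ (y - y₀) ξ| ≤ 1 / 4 := by
      refine (abs_real_inner_le_norm _ _).trans ?_
      calc ‖y - y₀‖ * ‖ξ‖ ≤ ρ * ‖ξ‖ := by gcongr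
        _ = 1 / 4 := by simp only [ρ]; field_simp
    rw [inner_sub_left, hy₀, abs_le] at h1
    have h2 := two_le_norm_expInner_sub_one_sq (y := y) (ξ := ξ) (by linarith) (by linarith)
    have hy0 : y ≠ 0 := by
      rintro rfl
      rw [inner_zero_left] at h1
      linarith
    have hyn : ‖y‖ ≤ 1 / ‖ξ‖ := by
      have h3 : ‖y‖ ≤ ‖y₀‖ + ‖y - y₀‖ := by simpa using norm_add_le y₀ (y - y₀)
      have h4 : ‖y₀‖ + ρ ≤ 1 / ‖ξ‖ := by
        rw [hy₀n]; simp only [ρ]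
        rw [div_add_div _ _ (by positivity) (by positivity),
          div_le_div_iff₀ (by positivity) (by positivity)]
        nlinarith [sq_nonneg ‖ξ‖]
      linarith
    have h5 : ‖ξ‖ ^ ((d : ℝ) + 2 * s) ≤ ‖y‖ ^ (-((d : ℝ) + 2 * s)) := by
      have := Real.rpow_le_rpow_of_nonpos (norm_pos_iff.2 hy0) hyn
        (z := -((d : ℝ) + 2 * s)) (by have := Nat.cast_nonneg (α := ℝ) d; linarith)
      rwa [one_div, Real.inv_rpow hn.le, ← Real.rpow_neg hn.le, neg_neg] at this
    have h6 : (1 : ℝ≥0∞) ≤ ‖expInner y ξ - 1‖ₑ ^ 2 := by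
      rw [← ofReal_norm, ← ENNReal.ofReal_pow (norm_nonneg _)]
      rw [← ENNReal.ofReal_one]
      exact ENNReal.ofReal_le_ofReal (by linarith)
    calc ENNReal.ofReal (‖ξ‖ ^ ((d : ℝ) + 2 * s))
        ≤ ENNReal.ofReal (‖y‖ ^ (-((d : ℝ) + 2 * s))) * 1 := by
          rw [mul_one]; exact ENNReal.ofReal_le_ofReal h5
      _ ≤ _ := by gcongr
  calc ENNReal.ofReal ((1 / 4) ^ d * vol * ‖ξ‖ ^ (2 * s))
      = ENNReal.ofReal (‖ξ‖ ^ ((d : ℝ) + 2 * s)) * volume (Metric.ball y₀ ρ) := by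
        rw [Measure.addHaar_ball_of_pos _ _ hρ, ← ENNReal.ofReal_toReal
          (measure_ball_lt_top (x := (0 : Space d)) (r := 1) (μ := volume)).ne, ← hvol,
          ← ENNReal.ofReal_mul (by positivity), ← ENNReal.ofReal_mul (by positivity)]
        congr 1
        simp only [finrank_euclideanSpace, Fintype.card_fin, ρ]
        rw [Real.rpow_add hn, Real.rpow_natCast, div_pow, div_pow, mul_pow]
        field_simp
    _ = ∫⁻ _ in Metric.ball y₀ ρ, ENNReal.ofReal (‖ξ‖ ^ ((d : ℝ) + 2 * s)) := by
        rw [setLIntegral_const]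
    _ ≤ ∫⁻ y in Metric.ball y₀ ρ, ENNReal.ofReal (‖y‖ ^ (-((d : ℝ) + 2 * s))) *
          ‖expInner y ξ - 1‖ₑ ^ 2 := setLIntegral_mono' measurableSet_ball hpt
    _ ≤ _ := setLIntegral_le_lintegral _ _

/-! ### Hölder bumps and their Sobolev norms -/

/-- A Hölder continuous function supported in a ball, with a bound `M` for the function and for its
Hölder quotients. -/
structure IsHolderBump {d : ℕ} (F : Space d → ℝ) (R β M : ℝ) : Prop where
  continuous : Continuous F
  abs_le : ∀ x, |F x| ≤ M
  abs_sub_le : ∀ x y, |F x - F y| ≤ M * ‖x - y‖ ^ β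
  eq_zero : ∀ x, R < ‖x‖ → F x = 0

/-- The squared homogeneous Sobolev norm of order `s`. -/
def sobolevSq {d : ℕ} (s : ℝ) (F : Space d → ℝ) : ℝ≥0∞ :=
  ∫⁻ ξ, ENNReal.ofReal (‖ξ‖ ^ (2 * s)) * ‖𝓕 (fun x => (F x : ℂ)) ξ‖ₑ ^ 2

namespace IsHolderBump

variable {d : ℕ} {F : Space d → ℝ} {R β M : ℝ}

lemma hasCompactSupport (hF : IsHolderBump F R β M) : HasCompactSupport F :=
  HasCompactSupport.intro (isCompact_closedBall (0 : Space d) R) fun x hx =>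
    hF.eq_zero x (by simpa using hx)

lemma nonneg (hF : IsHolderBump F R β M) : 0 ≤ M := (abs_nonneg _).trans (hF.abs_le 0)

lemma hasCompactSupport_ofReal (hF : IsHolderBump F R β M) : HasCompactSupport fun x => (F x : ℂ) :=
  hF.hasCompactSupport.comp_left (g := fun r : ℝ => (r : ℂ)) (by simp)

lemma continuous_ofReal (hF : IsHolderBump F R β M) : Continuous fun x => (F x : ℂ) :=
  Complex.continuous_ofReal.comp hF.continuous

lemma integrable (hF : IsHolderBump F R β M) : Integrable fun x => (F x : ℂ) :=
  hF.continuous_ofReal.integrable_of_hasCompactSupport hF.hasCompactSupport_ofReal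

/-- The increment is at most `2M` and at most `M ‖y‖^β`, and it vanishes unless `x` or `x + y` lies
in the ball of radius `R`. -/
lemma lintegral_translate_sub_le (hF : IsHolderBump F R β M) (y : Space d) :
    ∫⁻ x, ‖(F (x + y) : ℂ) - F x‖ₑ ^ 2 ≤
      ENNReal.ofReal (4 * M ^ 2 * min 1 (‖y‖ ^ (2 * β))) *
        (2 * volume (Metric.closedBall (0 : Space d) R)) := by
  set m := min 1 (‖y‖ ^ (2 * β))
  set S := Metric.closedBall (0 : Space d) R
  have hM := hF.nonneg
  have hm : 0 ≤ m := by positivity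
  have hsq : ∀ x, |F (x + y) - F x| ^ 2 ≤ 4 * M ^ 2 * m := by
    intro x
    have h1 : |F (x + y) - F x| ^ 2 ≤ 4 * M ^ 2 := by
      have : |F (x + y) - F x| ≤ 2 * M :=
        (abs_sub _ _).trans (by linarith [hF.abs_le (x + y), hF.abs_le x])
      calc _ ≤ (2 * M) ^ 2 := pow_le_pow_left₀ (abs_nonneg _) this 2
        _ = _ := by ring
    have h2 : |F (x + y) - F x| ^ 2 ≤ 4 * M ^ 2 * ‖y‖ ^ (2 * β) := by
      have : |F (x + y) - F x| ≤ M * ‖y‖ ^ β := by simpa using hF.abs_sub_le (x + y) x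
      calc _ ≤ (M * ‖y‖ ^ β) ^ 2 := pow_le_pow_left₀ (abs_nonneg _) this 2
        _ = M ^ 2 * ‖y‖ ^ (2 * β) := by
          rw [mul_pow, mul_comm 2 β, Real.rpow_mul (norm_nonneg _)]
          norm_num
        _ ≤ _ := by nlinarith [mul_nonneg (sq_nonneg M) (Real.rpow_nonneg (norm_nonneg y) (2 * β))]
    rcases min_choice 1 (‖y‖ ^ (2 * β)) with h | h <;> simp only [m, h]
    · simpa using h1
    · exact h2
  have hpt : ∀ x, ‖(F (x + y) : ℂ) - F x‖ₑ ^ 2 ≤ ENNReal.ofReal (4 * M ^ 2 * m) *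
      (S.indicator 1 (x + y) + S.indicator 1 x) := by
    intro x
    have hle : ‖(F (x + y) : ℂ) - F x‖ₑ ^ 2 ≤ ENNReal.ofReal (4 * M ^ 2 * m) := by
      rw [← Complex.ofReal_sub, ← ofReal_norm, ← ENNReal.ofReal_pow (norm_nonneg _),
        Complex.norm_real, Real.norm_eq_abs]
      exact ENNReal.ofReal_le_ofReal (hsq x)
    by_cases h1 : x ∈ S
    · refine hle.trans (le_mul_of_one_le_right' ?_)
      rw [Set.indicator_of_mem h1]
      exact le_add_self
    by_cases h2 : x + y ∈ S
    · refine hle.trans (le_mul_of_one_le_right' ?_)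
      rw [Set.indicator_of_mem h2]
      exact le_self_add
    · rw [hF.eq_zero x (by simpa [S] using h1), hF.eq_zero (x + y) (by simpa [S] using h2)]
      simp
  have hmeas : Measurable (S.indicator (1 : Space d → ℝ≥0∞)) :=
    measurable_one.indicator Metric.isClosed_closedBall.measurableSet
  refine (lintegral_mono hpt).trans (le_of_eq ?_)
  rw [lintegral_const_mul' _ _ ENNReal.ofReal_ne_top, lintegral_add_right _ hmeas, lintegral_add_right_eq_self (S.indicator 1) y,
    lintegral_indicator_one Metric.isClosed_closedBall.measurableSet, two_mul]

lemma lintegral_fourier_mul_le (hF : IsHolderBump F R β M) (y : Space d) :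
    ∫⁻ ξ, ‖expInner y ξ - 1‖ₑ ^ 2 * ‖𝓕 (fun x => (F x : ℂ)) ξ‖ₑ ^ 2 ≤
      ENNReal.ofReal (4 * M ^ 2 * min 1 (‖y‖ ^ (2 * β))) *
        (2 * volume (Metric.closedBall (0 : Space d) R)) := by
  refine le_trans (le_of_eq ?_) (hF.lintegral_translate_sub_le y)
  have hc := hF.continuous_ofReal
  have hsup : HasCompactSupport fun x => (F (x + y) : ℂ) - F x :=
    (hF.hasCompactSupport_ofReal.comp_homeomorph (Homeomorph.addRight y)).sub
      hF.hasCompactSupport_ofReal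
  have hcont : Continuous fun x => (F (x + y) : ℂ) - F x := by
    exact (hc.comp (continuous_add_const y)).sub hc
  have h := lintegral_enorm_fourier_sq (hcont.integrable_of_hasCompactSupport hsup)
    (hcont.memLp_of_hasCompactSupport hsup)
  rw [← h]
  congr 1 with ξ
  rw [fourier_translate_sub hF.integrable, enorm_mul, mul_pow]

end IsHolderBump

/-- Near the origin the integrand is `‖y‖^(-(d - 2(β-s)))`, integrable because `β > s`; at infinity
it is `‖y‖^(-(d+2s))`, integrable because `s > 0`. -/
lemma lintegral_weight_lt_top {d : ℕ} (hd : 0 < d) {s β : ℝ} (hs : 0 < s) (hsβ : s < β) :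
    ∫⁻ y : Space d, ENNReal.ofReal (‖y‖ ^ (-((d : ℝ) + 2 * s))) *
      ENNReal.ofReal (min 1 (‖y‖ ^ (2 * β))) < ⊤ := by
  have h1 := (integrable_indicator_iff measurableSet_ball).2
    (integrableOn_norm_rpow_ball hd (a := (d : ℝ) - 2 * (β - s)) (by linarith) 1)
  have hms : MeasurableSet {x : Space d | 1 ≤ ‖x‖} :=
    measurableSet_le measurable_const measurable_norm
  have h2 := (integrable_indicator_iff hms).2
    (integrable_norm_rpow_tail (d := d) (a := (d : ℝ) + 2 * s) (by linarith))
  refine lt_of_le_of_lt (lintegral_mono fun y => ?_) (h1.add h2).lintegral_lt_top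
  rw [← ENNReal.ofReal_mul (by positivity)]
  refine ENNReal.ofReal_le_ofReal ?_
  simp only [Pi.add_apply]
  have hnn1 : 0 ≤ (Metric.ball (0 : Space d) 1).indicator
      (fun x => ‖x‖ ^ (-((d : ℝ) - 2 * (β - s)))) y :=
    Set.indicator_nonneg (fun x _ => by positivity) y
  have hnn2 : 0 ≤ {x : Space d | 1 ≤ ‖x‖}.indicator
      (fun x => ‖x‖ ^ (-((d : ℝ) + 2 * s))) y :=
    Set.indicator_nonneg (fun x _ => by positivity) y
  rcases lt_or_ge ‖y‖ 1 with h | h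
  · refine le_trans ?_ (le_add_of_nonneg_right hnn2)
    rw [Set.indicator_of_mem (by simpa using h)]
    rcases eq_or_ne y 0 with rfl | hy
    · have hd' := Nat.cast_nonneg (α := ℝ) d
      rw [norm_zero, Real.zero_rpow (by linarith), zero_mul]; positivity
    · have hyp := norm_pos_iff.2 hy
      calc _ ≤ ‖y‖ ^ (-((d : ℝ) + 2 * s)) * ‖y‖ ^ (2 * β) := by gcongr; exact min_le_right _ _
        _ = _ := by rw [← Real.rpow_add hyp]; congr 1; ring
  · refine le_trans ?_ (le_add_of_nonneg_left hnn1)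
    rw [Set.indicator_of_mem (by exact h)]
    exact mul_le_of_le_one_right (by positivity) (min_le_left _ _)

/-- A Hölder bump of exponent `β > s` has finite Sobolev norm of order `s`. -/
lemma exists_sobolevSq_le {d : ℕ} (hd : 0 < d) {s β : ℝ} (hs : 0 < s) (hsβ : s < β) (R : ℝ) :
    ∃ S : ℝ, 0 ≤ S ∧ ∀ (F : Space d → ℝ) (M : ℝ), IsHolderBump F R β M →
      sobolevSq s F ≤ ENNReal.ofReal (S * M ^ 2) := by
  obtain ⟨c, hc, hW⟩ := exists_norm_rpow_le_lintegral (d := d) hs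
  have hJ := lintegral_weight_lt_top hd hs hsβ
  set J := ∫⁻ y : Space d, ENNReal.ofReal (‖y‖ ^ (-((d : ℝ) + 2 * s))) *
      ENNReal.ofReal (min 1 (‖y‖ ^ (2 * β)))
  set vol := 2 * volume (Metric.closedBall (0 : Space d) R)
  have hvol : vol < ⊤ := ENNReal.mul_lt_top (by simp) measure_closedBall_lt_top
  refine ⟨c⁻¹ * (4 * J.toReal * vol.toReal), by positivity, fun F M hF => ?_⟩
  set Fh := fun ξ => ‖𝓕 (fun x => (F x : ℂ)) ξ‖ₑ ^ 2
  have hFh : Measurable Fh := (continuous_fourier hF.integrable).measurable.enorm.pow_const 2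
  have hwm : Measurable fun y : Space d => ENNReal.ofReal (‖y‖ ^ (-((d : ℝ) + 2 * s))) :=
    (measurable_norm.pow_const _).ennreal_ofReal
  have hem : Measurable fun z : Space d × Space d => ‖expInner z.1 z.2 - 1‖ₑ ^ 2 :=
    ((continuous_expInner.sub continuous_const).measurable.enorm).pow_const 2
  -- The multiplier `‖ξ‖^(2s)` is replaced by Gagliardo's integral over increments `y`. Tonelli then
  -- puts the `ξ`-integral inside, where Plancherel turns it into the `L²` norm of a translation
  -- difference.
  have h1 : ENNReal.ofReal c * sobolevSq s F ≤
      ∫⁻ ξ, ∫⁻ y, ENNReal.ofReal (‖y‖ ^ (-((d : ℝ) + 2 * s))) *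
        (‖expInner y ξ - 1‖ₑ ^ 2 * Fh ξ) := by
    rw [sobolevSq, ← lintegral_const_mul' _ _ ENNReal.ofReal_ne_top]
    refine lintegral_mono fun ξ => ?_
    have : ∫⁻ y, ENNReal.ofReal (‖y‖ ^ (-((d : ℝ) + 2 * s))) * (‖expInner y ξ - 1‖ₑ ^ 2 * Fh ξ) =
        (∫⁻ y, ENNReal.ofReal (‖y‖ ^ (-((d : ℝ) + 2 * s))) * ‖expInner y ξ - 1‖ₑ ^ 2) * Fh ξ := by
      rw [← lintegral_mul_const' _ _ (by simp [Fh])]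
      congr 1 with y
      rw [mul_assoc]
    rw [this, ← mul_assoc, ← ENNReal.ofReal_mul hc.le]
    gcongr
    exact hW ξ
  have h2 : ∫⁻ ξ, ∫⁻ y, ENNReal.ofReal (‖y‖ ^ (-((d : ℝ) + 2 * s))) *
        (‖expInner y ξ - 1‖ₑ ^ 2 * Fh ξ) =
      ∫⁻ y, ENNReal.ofReal (‖y‖ ^ (-((d : ℝ) + 2 * s))) *
        ∫⁻ ξ, ‖expInner y ξ - 1‖ₑ ^ 2 * Fh ξ := by
    rw [lintegral_lintegral_swap]
    · congr 1 with y
      rw [lintegral_const_mul' _ _ ENNReal.ofReal_ne_top]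
    · refine Measurable.aemeasurable ?_
      exact (hwm.comp measurable_snd).mul ((hem.comp measurable_swap).mul (hFh.comp measurable_fst))
  have h3 : ENNReal.ofReal c * sobolevSq s F ≤ ENNReal.ofReal (4 * M ^ 2) * J * vol := by
    refine (h1.trans_eq h2).trans ?_
    have : ENNReal.ofReal (4 * M ^ 2) * J * vol = ∫⁻ y : Space d,
        ENNReal.ofReal (‖y‖ ^ (-((d : ℝ) + 2 * s))) *
          (ENNReal.ofReal (4 * M ^ 2 * min 1 (‖y‖ ^ (2 * β))) * vol) := by
      rw [← lintegral_const_mul' _ _ ENNReal.ofReal_ne_top, ← lintegral_mul_const' _ _ hvol.ne]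
      congr 1 with y
      rw [ENNReal.ofReal_mul (by positivity : (0 : ℝ) ≤ 4 * M ^ 2)]
      ring
    rw [this]
    gcongr with y
    exact hF.lintegral_fourier_mul_le y
  have hc' : ENNReal.ofReal c ≠ 0 := by simpa using hc
  have h4 : sobolevSq s F ≤ (ENNReal.ofReal c)⁻¹ * (ENNReal.ofReal (4 * M ^ 2) * J * vol) := by
    rw [← ENNReal.div_eq_inv_mul, ENNReal.le_div_iff_mul_le (Or.inl hc')
      (Or.inl ENNReal.ofReal_ne_top), mul_comm]
    exact h3
  refine h4.trans (le_of_eq ?_)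
  rw [← ENNReal.ofReal_inv_of_pos hc, ← ENNReal.ofReal_toReal hJ.ne, ← ENNReal.ofReal_toReal hvol.ne,
    ← ENNReal.ofReal_mul (by positivity), ← ENNReal.ofReal_mul (by positivity),
    ← ENNReal.ofReal_mul (by positivity)]
  congr 1
  rw [ENNReal.toReal_ofReal (by positivity), ENNReal.toReal_ofReal (by positivity)]
  ring

/-! ### Duality between Hölder bumps and measures of finite energy -/

namespace IsHolderBump

variable {d : ℕ} {F : Space d → ℝ} {R β M : ℝ} (η : Mollifier d)

lemma integral_fourier_eq_mollify (hF : IsHolderBump F R β M) {ε : ℝ} (hε : 0 < ε) (z : Space d) :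
    ∫ ξ, 𝓕 (fun x => (F x : ℂ)) ξ * (expInner z ξ * η.φ (ε • ξ)) = (mollify η F ε z : ℂ) := by
  rw [η.integral_mollify (integral_mul_fourier hF.integrable) hε z, mollify,
    ← integral_complex_ofReal]
  simp

lemma integrable_mollify (hF : IsHolderBump F R β M) (ε : ℝ) (z : Space d) : Integrable fun v => F
    (z + ε • v) * η.ψ v := by
  have hc := hF.continuous
  exact η.integrable_ψ.bdd_mul (c := M)
    (by fun_prop : Continuous fun v => F (z + ε • v)).aestronglyMeasurable
    (ae_of_all _ fun v => hF.abs_le _)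

lemma abs_mollify_le (hF : IsHolderBump F R β M) (ε : ℝ) (z : Space d) : |mollify η F ε z| ≤ M := by
  have h : ‖mollify η F ε z‖ ≤ ∫ v, M * η.ψ v := by
    refine norm_integral_le_of_norm_le (η.integrable_ψ.const_mul M) (ae_of_all _ fun v => ?_)
    rw [norm_mul, Real.norm_of_nonneg (η.ψ_nonneg v)]
    exact mul_le_mul_of_nonneg_right (hF.abs_le _) (η.ψ_nonneg v)
  rwa [integral_const_mul, η.integral_ψ, mul_one] at h

lemma continuous_mollify (hF : IsHolderBump F R β M) (ε : ℝ) : Continuous (mollify η F ε) := by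
  have hc := hF.continuous
  refine continuous_of_dominated (fun z => (hF.integrable_mollify η ε z).1)
    (bound := fun v => M * η.ψ v) (fun z => ae_of_all _ fun v => ?_) (η.integrable_ψ.const_mul M)
    (ae_of_all _ fun v => by fun_prop)
  rw [norm_mul, Real.norm_of_nonneg (η.ψ_nonneg v)]
  exact mul_le_mul_of_nonneg_right (hF.abs_le _) (η.ψ_nonneg v)

lemma tendsto_mollify (hF : IsHolderBump F R β M) {ε : ℕ → ℝ} (hε : Tendsto ε atTop (𝓝 0))
    (z : Space d) :
    Tendsto (fun k => mollify η F (ε k) z) atTop (𝓝 (F z)) := by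
  have h : Tendsto (fun k => mollify η F (ε k) z) atTop (𝓝 (∫ v, F z * η.ψ v)) := by
    refine tendsto_integral_of_dominated_convergence (fun v => M * η.ψ v)
      (fun k => (hF.integrable_mollify η (ε k) z).1) (η.integrable_ψ.const_mul M)
      (fun k => ae_of_all _ fun v => ?_) (ae_of_all _ fun v => ?_)
    · rw [norm_mul, Real.norm_of_nonneg (η.ψ_nonneg v)]
      exact mul_le_mul_of_nonneg_right (hF.abs_le _) (η.ψ_nonneg v)
    · refine Tendsto.mul_const _ ((hF.continuous.tendsto z).comp ?_)
      simpa using (hε.smul_const v).const_add z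
  rwa [integral_const_mul, η.integral_ψ, mul_one] at h

lemma integrable_fourier_mul_φ (hF : IsHolderBump F R β M) {ε : ℝ} (hε : 0 < ε) :
    Integrable fun ξ => ‖𝓕 (fun x => (F x : ℂ)) ξ‖ * η.φ (ε • ξ) := by
  refine (η.integrable_φ.comp_smul hε.ne').bdd_mul (c := ∫ x, ‖(F x : ℂ)‖)
    (continuous_fourier hF.integrable).norm.aestronglyMeasurable (ae_of_all _ fun ξ => ?_)
  rw [norm_norm]
  exact VectorFourier.norm_fourierIntegral_le_integral_norm _ _ _ _ _

lemma integral_mollify_eq (hF : IsHolderBump F R β M) {ε : ℝ} (hε : 0 < ε) (p : Measure (Space d))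
    [IsFiniteMeasure p] :
    ((∫ z, mollify η F ε z ∂p : ℝ) : ℂ) =
      ∫ ξ, 𝓕 (fun x => (F x : ℂ)) ξ * η.φ (ε • ξ) * measureFourier p ξ := by
  have hc := η.continuous_φ
  have hcF := continuous_fourier hF.integrable
  rw [← integral_complex_ofReal]
  simp_rw [← hF.integral_fourier_eq_mollify η hε]
  rw [integral_integral_swap]
  · congr 1 with ξ
    rw [integral_const_mul, integral_mul_const, measureFourier]
    ring
  · refine ((hF.integrable_fourier_mul_φ η hε).comp_snd p).mono' ?_ (ae_of_all _ fun x => ?_)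
    · exact (by fun_prop : Continuous fun x : Space d × Space d =>
        𝓕 (fun x => (F x : ℂ)) x.2 * (expInner x.1 x.2 * (η.φ (ε • x.2) : ℂ))).aestronglyMeasurable
    · change ‖𝓕 (fun x => (F x : ℂ)) x.2 * (expInner x.1 x.2 * (η.φ (ε • x.2) : ℂ))‖ ≤ _
      simp [abs_of_nonneg (η.φ_nonneg _)]

lemma integrable_fourier_mul_measureFourier (hF : IsHolderBump F R β M) {ε : ℝ} (hε : 0 < ε)
    (p : Measure (Space d))
    [IsFiniteMeasure p] :
    Integrable fun ξ => 𝓕 (fun x => (F x : ℂ)) ξ * η.φ (ε • ξ) * measureFourier p ξ := by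
  have hc := η.continuous_φ
  have hcF := continuous_fourier hF.integrable
  have hcp := continuous_measureFourier p
  refine ((hF.integrable_fourier_mul_φ η hε).mul_const (p.real Set.univ)).mono'
    (by fun_prop : Continuous _).aestronglyMeasurable (ae_of_all _ fun ξ => ?_)
  rw [norm_mul, norm_mul, Complex.norm_real, Real.norm_of_nonneg (η.φ_nonneg _)]
  exact mul_le_mul_of_nonneg_left (norm_measureFourier_le p ξ)
    (mul_nonneg (norm_nonneg _) (η.φ_nonneg _))

/-- The right side is free of `ε` because `0 ≤ φ ≤ 1`. -/
lemma enorm_integral_mollify_sub_le (hF : IsHolderBump F R β M) {ε : ℝ} (hε : 0 < ε)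
    (p q : Measure (Space d))
    [IsFiniteMeasure p] [IsFiniteMeasure q] :
    ‖∫ z, mollify η F ε z ∂p - ∫ z, mollify η F ε z ∂q‖ₑ ≤
      ∫⁻ ξ, ‖𝓕 (fun x => (F x : ℂ)) ξ‖ₑ * ‖measureFourier p ξ - measureFourier q ξ‖ₑ := by
  have h : ‖((∫ z, mollify η F ε z ∂p - ∫ z, mollify η F ε z ∂q : ℝ) : ℂ)‖ₑ ≤
      ∫⁻ ξ, ‖𝓕 (fun x => (F x : ℂ)) ξ‖ₑ * ‖measureFourier p ξ - measureFourier q ξ‖ₑ := by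
    rw [Complex.ofReal_sub, hF.integral_mollify_eq η hε p, hF.integral_mollify_eq η hε q,
      ← integral_sub (hF.integrable_fourier_mul_measureFourier η hε p)
        (hF.integrable_fourier_mul_measureFourier η hε q)]
    refine (enorm_integral_le_lintegral_enorm _).trans (lintegral_mono fun ξ => ?_)
    rw [← mul_sub, enorm_mul, enorm_mul]
    gcongr
    refine mul_le_of_le_one_right' ?_
    rw [← ofReal_norm, Complex.norm_real, Real.norm_of_nonneg (η.φ_nonneg _)]
    exact ENNReal.ofReal_le_one.2 (η.φ_le_one _)
  have e : ∀ r : ℝ, ‖(r : ℂ)‖ₑ = ‖r‖ₑ := fun r => by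
    rw [← ofReal_norm, Complex.norm_real, ofReal_norm]
  rwa [e] at h

/-- Cauchy–Schwarz after inserting `‖ξ‖^s ‖ξ‖^(-s) = 1`, which fails only at the origin, a null set
since `d > 0`. -/
lemma sq_lintegral_le (hF : IsHolderBump F R β M) (hd : 0 < d) (s : ℝ) (p q : Measure (Space d))
    [IsFiniteMeasure p]
    [IsFiniteMeasure q] :
    (∫⁻ ξ, ‖𝓕 (fun x => (F x : ℂ)) ξ‖ₑ * ‖measureFourier p ξ - measureFourier q ξ‖ₑ) ^ 2 ≤
      sobolevSq s F * negSobolevSq s p q := by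
  have hcF := continuous_fourier hF.integrable
  have hcp := continuous_measureFourier p
  have hcq := continuous_measureFourier q
  have hnull : ∀ᵐ ξ ∂(volume : Measure (Space d)), ξ ≠ 0 := by
    have := nontrivial_space hd
    simp [ae_iff]
  set u : Space d → ℝ≥0∞ := fun ξ => ENNReal.ofReal (‖ξ‖ ^ s) * ‖𝓕 (fun x => (F x : ℂ)) ξ‖ₑ
  set w : Space d → ℝ≥0∞ := fun ξ => ENNReal.ofReal (‖ξ‖ ^ (-s)) *
    ‖measureFourier p ξ - measureFourier q ξ‖ₑ
  have hu : Measurable u := (measurable_norm.pow_const _).ennreal_ofReal.mul hcF.measurable.enorm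
  have hw : Measurable w :=
    (measurable_norm.pow_const _).ennreal_ofReal.mul (hcp.sub hcq).measurable.enorm
  have h1 : ∫⁻ ξ, ‖𝓕 (fun x => (F x : ℂ)) ξ‖ₑ * ‖measureFourier p ξ - measureFourier q ξ‖ₑ =
      ∫⁻ ξ, (u * w) ξ := by
    refine lintegral_congr_ae ?_
    filter_upwards [hnull] with ξ hξ
    have hn := norm_pos_iff.2 hξ
    have : ENNReal.ofReal (‖ξ‖ ^ s) * ENNReal.ofReal (‖ξ‖ ^ (-s)) = 1 := by
      rw [← ENNReal.ofReal_mul (by positivity), ← Real.rpow_add hn]; simp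
    simp only [u, w, Pi.mul_apply]
    rw [mul_mul_mul_comm, this, one_mul]
  have h2 := ENNReal.lintegral_mul_le_Lp_mul_Lq volume Real.HolderConjugate.two_two
    hu.aemeasurable hw.aemeasurable
  have hrp : ∀ (ξ : Space d) (t : ℝ), ENNReal.ofReal (‖ξ‖ ^ t) ^ 2 = ENNReal.ofReal (‖ξ‖ ^ (2 * t)) := by
    intro ξ t
    rw [← ENNReal.ofReal_pow (by positivity), mul_comm 2 t, Real.rpow_mul (norm_nonneg _)]
    norm_num
  have h3 : ∫⁻ ξ, u ξ ^ (2 : ℝ) = sobolevSq s F := by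
    simp only [u, sobolevSq, ENNReal.rpow_ofNat, mul_pow, hrp]
  have h4 : ∫⁻ ξ, w ξ ^ (2 : ℝ) = negSobolevSq s p q := by
    simp only [w, negSobolevSq, ENNReal.rpow_ofNat, mul_pow, hrp]
    congr 1 with ξ
    rw [ENNReal.ofReal_mul (by positivity), ENNReal.ofReal_pow (norm_nonneg _), ofReal_norm,
      mul_neg]
  rw [h3, h4, ← h1] at h2
  calc _ ≤ (sobolevSq s F ^ (1 / 2 : ℝ) * negSobolevSq s p q ^ (1 / 2 : ℝ)) ^ 2 := by gcongr
    _ = _ := by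
      rw [mul_pow, ← ENNReal.rpow_natCast, ← ENNReal.rpow_natCast, ← ENNReal.rpow_mul,
        ← ENNReal.rpow_mul]
      norm_num

/-- The duality between the Sobolev norms of order `s` and `-s`. -/
lemma sq_integral_sub_le (hF : IsHolderBump F R β M) (hd : 0 < d) (s : ℝ) (p q : Measure (Space d))
    [IsFiniteMeasure p]
    [IsFiniteMeasure q] :
    ENNReal.ofReal ((∫ x, F x ∂p - ∫ x, F x ∂q) ^ 2) ≤ sobolevSq s F * negSobolevSq s p q := by
  obtain ⟨η⟩ := nonempty_mollifier d
  set ε : ℕ → ℝ := fun k => 1 / ((k : ℝ) + 1)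
  have hε0 : ∀ k, 0 < ε k := fun k => by positivity
  have hε : Tendsto ε atTop (𝓝 0) := tendsto_one_div_add_one
  have hlim : ∀ (r : Measure (Space d)) [IsFiniteMeasure r],
      Tendsto (fun k => ∫ z, mollify η F (ε k) z ∂r) atTop (𝓝 (∫ z, F z ∂r)) := by
    intro r _
    exact tendsto_integral_of_dominated_convergence (fun _ => M)
      (fun k => (hF.continuous_mollify η (ε k)).aestronglyMeasurable) (integrable_const _)
      (fun k => ae_of_all _ fun z => hF.abs_mollify_le η (ε k) z)
      (ae_of_all _ fun z => hF.tendsto_mollify η hε z)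
  have h := (ENNReal.continuous_ofReal.tendsto _).comp (((hlim p).sub (hlim q)).pow 2)
  -- The transform of `F` need not be integrable, so the pairing is bounded at each scale `ε_k`,
  -- uniformly, and the bound passes to the limit.
  refine le_of_tendsto' h fun k => ?_
  refine le_trans ?_ (hF.sq_lintegral_le hd s p q)
  simp only [Function.comp_apply]
  rw [← sq_abs, ENNReal.ofReal_pow (abs_nonneg _), ← Real.norm_eq_abs, ofReal_norm]
  gcongr
  exact hF.enorm_integral_mollify_sub_le η (hε0 k) p q

end IsHolderBump

/-- The squared difference of the integrals of a Hölder bump is controlled by the energy. -/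
lemma SharpKernelBounds.exists_sq_integral_sub_le {d : ℕ} {s : ℝ} {g ghat : Space d → ℝ}
    {C₁ C₂ C A K : ℝ} (hg : SharpKernelBounds s g ghat C₁ C₂ C A K) {β : ℝ} (hβ : s < β) (R : ℝ) :
    ∃ S : ℝ, 0 ≤ S ∧ ∀ (F : Space d → ℝ) (M : ℝ), IsHolderBump F R β M →
      ∀ (p q : Measure (Space d)) [IsFiniteMeasure p] [IsFiniteMeasure q],
      FiniteEnergy g p → FiniteEnergy g q →
      (∫ x, F x ∂p - ∫ x, F x ∂q) ^ 2 ≤ S * M ^ 2 *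
        (interaction g p p - interaction g p q - interaction g q p + interaction g q q) := by
  obtain ⟨S, hS, h⟩ := exists_sobolevSq_le hg.dim_pos hg.s_pos hβ R
  have hC := hg.C₁_pos
  refine ⟨S * C₁⁻¹, by positivity, fun F M hF p q _ _ hp hq => ?_⟩
  obtain ⟨hE0, hE⟩ := hg.negSobolevSq_le hp hq
  set E := interaction g p p - interaction g p q - interaction g q p + interaction g q q
  have h1 := hF.sq_integral_sub_le hg.dim_pos s p q
  have h2 : negSobolevSq s p q ≤ ENNReal.ofReal (C₁⁻¹ * E) := by
    rw [ENNReal.ofReal_mul (by positivity), ENNReal.ofReal_inv_of_pos hC, ← ENNReal.div_eq_inv_mul,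
      ENNReal.le_div_iff_mul_le (Or.inl (by simpa using hC)) (Or.inl ENNReal.ofReal_ne_top),
      mul_comm]
    exact hE
  have h3 : ENNReal.ofReal ((∫ x, F x ∂p - ∫ x, F x ∂q) ^ 2) ≤
      ENNReal.ofReal (S * M ^ 2 * (C₁⁻¹ * E)) := by
    rw [ENNReal.ofReal_mul (by positivity)]
    exact h1.trans (mul_le_mul' (h F M hF) h2)
  rw [ENNReal.ofReal_le_ofReal_iff (by positivity)] at h3
  linarith

/-! ### Signed measures and extended integrals -/

/-- Subtraction of measures is truncated, so `μ - ν` on the right is already the positive Jordan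
part. -/
lemma posPart_toSigned_sub {X : Type*} [MeasurableSpace X] (μ ν : ProbabilityMeasure X) :
    posPart (toSigned μ - toSigned ν) = (μ : Measure X) - ν := by
  simp only [posPart, toSigned, Measure.toJordanDecomposition_toSignedMeasure_sub]
  rfl

lemma negPart_toSigned_sub {X : Type*} [MeasurableSpace X] (μ ν : ProbabilityMeasure X) :
    negPart (toSigned μ - toSigned ν) = (ν : Measure X) - μ := by
  simp only [negPart, toSigned, Measure.toJordanDecomposition_toSignedMeasure_sub]
  rfl

lemma toJordanDecomposition_toSigned {X : Type*} [MeasurableSpace X] (μ : ProbabilityMeasure X) :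
    (toSigned μ).toJordanDecomposition =
      Measure.jordanDecompositionOfToSignedMeasureSub (μ : Measure X) 0 := by
  rw [← Measure.toJordanDecomposition_toSignedMeasure_sub, Measure.toSignedMeasure_zero, sub_zero]
  rfl

lemma posPart_toSigned {X : Type*} [MeasurableSpace X] (μ : ProbabilityMeasure X) :
    posPart (toSigned μ) = (μ : Measure X) := by
  rw [posPart, toJordanDecomposition_toSigned,
    Measure.jordanDecompositionOfToSignedMeasureSub_posPart, Measure.sub_zero]

lemma negPart_toSigned {X : Type*} [MeasurableSpace X] (μ : ProbabilityMeasure X) :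
    negPart (toSigned μ) = 0 := by
  rw [negPart, toJordanDecomposition_toSigned,
    Measure.jordanDecompositionOfToSignedMeasureSub_negPart, Measure.zero_sub]

/-- Truncated differences in the two orders are the Jordan parts of `μ - ν`; both sides are the join
of `μ` and `ν`. -/
lemma add_sub_swap {X : Type*} [MeasurableSpace X] (μ ν : Measure X) [IsFiniteMeasure μ]
    [IsFiniteMeasure ν] : μ + (ν - μ) = ν + (μ - ν) := by
  rw [← Measure.toSignedMeasure_eq_toSignedMeasure_iff, Measure.toSignedMeasure_add,
    Measure.toSignedMeasure_add]
  have h' : μ.toSignedMeasure - ν.toSignedMeasure =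
    (μ - ν).toSignedMeasure - (ν - μ).toSignedMeasure :=
    Measure.sub_toSignedMeasure_eq_toSignedMeasure_sub (μ := μ) (ν := ν)
  rw [sub_eq_sub_iff_add_eq_add] at h'
  rw [h', add_comm]

lemma integral_sub_measure {X : Type*} [MeasurableSpace X] {μ ν : Measure X} [IsFiniteMeasure μ]
    [IsFiniteMeasure ν] {f : X → ℝ} (hμ : Integrable f μ) (hν : Integrable f ν) :
    ∫ x, f x ∂(μ - ν) - ∫ x, f x ∂(ν - μ) = ∫ x, f x ∂μ - ∫ x, f x ∂ν := by
  have h : ∫ x, f x ∂(μ + (ν - μ)) = ∫ x, f x ∂(ν + (μ - ν)) := by rw [add_sub_swap μ ν]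
  rw [integral_add_measure hμ (hν.mono_measure Measure.sub_le),
    integral_add_measure hν (hμ.mono_measure Measure.sub_le)] at h
  linarith

lemma extIntegral_congr_ae {X : Type*} [MeasurableSpace X] {f f' : X → EReal} {p n : Measure X}
    (hp : f =ᵐ[p] f') (hn : f =ᵐ[n] f') : extIntegral f p n = extIntegral f' p n := by
  have h1 : ∀ F : EReal → ℝ≥0∞, ∫⁻ x, F (f x) ∂p = ∫⁻ x, F (f' x) ∂p := fun F =>
    lintegral_congr_ae (hp.fun_comp F)
  have h2 : ∀ F : EReal → ℝ≥0∞, ∫⁻ x, F (f x) ∂n = ∫⁻ x, F (f' x) ∂n := fun F =>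
    lintegral_congr_ae (hn.fun_comp F)
  simp only [extIntegral, h1 (fun y => y.toENNReal), h1 (fun y => (-y).toENNReal),
    h2 (fun y => y.toENNReal), h2 (fun y => (-y).toENNReal)]

lemma extIntegral_of_integrable {X : Type*} [MeasurableSpace X] {f : X → ℝ} {p n : Measure X}
    (hp : Integrable f p) (hn : Integrable f n) :
    extIntegral (fun x => (f x : EReal)) p n = ((∫ x, f x ∂p - ∫ x, f x ∂n : ℝ) : EReal) := by
  have e : ∀ x, (-(f x : EReal)).toENNReal = ENNReal.ofReal (-f x) := fun x => by
    rw [← EReal.coe_neg, EReal.real_coe_toENNReal]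
  have h1 := hp.lintegral_lt_top
  have h2 := hp.neg.lintegral_lt_top
  have h3 := hn.lintegral_lt_top
  have h4 := hn.neg.lintegral_lt_top
  simp only [Pi.neg_apply] at h2 h4
  simp only [extIntegral, EReal.real_coe_toENNReal, e]
  rw [if_neg (ENNReal.add_ne_top.2 ⟨h1.ne, h4.ne⟩), integral_eq_lintegral_pos_part_sub_lintegral_neg_part hp,
    integral_eq_lintegral_pos_part_sub_lintegral_neg_part hn]
  rw [← EReal.coe_ennreal_toReal (ENNReal.add_ne_top.2 ⟨h1.ne, h4.ne⟩),
    ← EReal.coe_ennreal_toReal (ENNReal.add_ne_top.2 ⟨h2.ne, h3.ne⟩),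
    ENNReal.toReal_add h1.ne h4.ne, ENNReal.toReal_add h2.ne h3.ne, ← EReal.coe_sub]
  congr 1
  ring

lemma sintegral_toSigned_sub {X : Type*} [MeasurableSpace X] (μ ν : ProbabilityMeasure X)
    {f : X → ℝ} (hμ : Integrable f μ) (hν : Integrable f ν) :
    sintegral f (toSigned μ - toSigned ν) = ((∫ x, f x ∂μ - ∫ x, f x ∂ν : ℝ) : EReal) := by
  rw [sintegral, posPart_toSigned_sub, negPart_toSigned_sub,
    extIntegral_of_integrable (hμ.mono_measure Measure.sub_le) (hν.mono_measure Measure.sub_le),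
    integral_sub_measure hμ hν]

lemma toSigned_sub_map {X Y : Type*} [MeasurableSpace X] [MeasurableSpace Y] {f : X → Y}
    (hf : Measurable f) (μ ν : ProbabilityMeasure X) :
    (toSigned μ - toSigned ν).map f =
      toSigned (μ.map hf.aemeasurable) - toSigned (ν.map hf.aemeasurable) := by
  ext s hs
  rw [VectorMeasure.map_apply _ hf hs]
  simp only [toSigned, sub_apply]
  rw [Measure.toSignedMeasure_apply_measurable (hf hs),
    Measure.toSignedMeasure_apply_measurable (hf hs), Measure.toSignedMeasure_apply_measurable hs,
    Measure.toSignedMeasure_apply_measurable hs]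
  simp only [ProbabilityMeasure.toMeasure_map, measureReal_def, Measure.map_apply hf hs]

/-! ### The energy in terms of the normalized kernel -/

lemma integrable_of_lintegral_ne_top {X : Type*} [MeasurableSpace X] {f : X → ℝ}
    (hf : Measurable f) {K : ℝ} (hK : ∀ x, -K ≤ f x) {p : Measure X} [IsFiniteMeasure p]
    (h1 : ∫⁻ x, ENNReal.ofReal (f x) ∂p ≠ ⊤) : Integrable f p := by
  have h2 : ∫⁻ x, ENNReal.ofReal (f x + K) ∂p < ⊤ := by
    refine lt_of_le_of_lt (lintegral_mono fun x => ENNReal.ofReal_add_le) ?_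
    rw [lintegral_add_left hf.ennreal_ofReal, lintegral_const]
    exact ENNReal.add_lt_top.2 ⟨h1.lt_top, ENNReal.mul_lt_top ENNReal.ofReal_lt_top
      (measure_lt_top _ _)⟩
  have h3 : Integrable (fun x => f x + K) p := by
    refine ⟨(hf.add_const K).aestronglyMeasurable, ?_⟩
    rwa [hasFiniteIntegral_iff_ofReal (ae_of_all _ fun x => by
      have := hK x
      simp only [Pi.zero_apply]; linarith)]
  refine (h3.sub (integrable_const K)).congr (ae_of_all _ fun x => ?_)
  simp

/-- The extended energy of the difference of two measures. -/
def extEnergy {d : ℕ} (g : Space d → ℝ) (p n : Measure (Space d)) : EReal :=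
  extIntegral (fun z : Space d × Space d => kernel g (z.1 - z.2))
    (p.prod p + n.prod n) (p.prod n + n.prod p)

lemma measurable_kernel {d : ℕ} {g : Space d → ℝ} (hg : Measurable g) : Measurable (kernel g) := by
  unfold kernel
  exact Measurable.ite (measurableSet_singleton 0) measurable_const hg.coe_real_ereal

lemma kernel_congr {d : ℕ} {g g₀ : Space d → ℝ} (h : ∀ x, x ≠ 0 → g₀ x = g x) :
    kernel g = kernel g₀ := by
  ext x
  unfold kernel
  split_ifs with hx
  · rfl
  · rw [h x hx]

lemma finiteEnergy_zero {d : ℕ} (g : Space d → ℝ) : FiniteEnergy g 0 := by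
  simp [FiniteEnergy]

namespace SharpKernelBounds

variable {d : ℕ} {s : ℝ} {g ghat : Space d → ℝ} {C₁ C₂ C A K : ℝ}

/-- By the convention for `∞ - ∞`, an energy different from `⊤` has a finite positive part. As the
kernel is `⊤` on the diagonal, the diagonal is null, and the lower bound on `g` gives integrability.
-/
lemma finiteEnergy_of_extEnergy_ne_top (hg : SharpKernelBounds s g ghat C₁ C₂ C A K)
    {p n : Measure (Space d)} [IsFiniteMeasure p]
    [IsFiniteMeasure n] (h : extEnergy g p n ≠ ⊤) : FiniteEnergy g p ∧ FiniteEnergy g n := by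
  have hm : Measurable fun z : Space d × Space d => kernel g (z.1 - z.2) :=
    (measurable_kernel hg.measurable).comp (measurable_fst.sub measurable_snd)
  have h1 : ∫⁻ z, (kernel g (z.1 - z.2)).toENNReal ∂(p.prod p + n.prod n) ≠ ⊤ := by
    intro htop
    apply h
    rw [extEnergy, extIntegral]
    simp [htop]
  rw [lintegral_add_measure, ENNReal.add_ne_top] at h1
  have key : ∀ (q : Measure (Space d)) [IsFiniteMeasure q],
      ∫⁻ z, (kernel g (z.1 - z.2)).toENNReal ∂(q.prod q) ≠ ⊤ → FiniteEnergy g q := by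
    intro q _ hq
    have hne : ∀ᵐ z ∂(q.prod q), z.1 ≠ z.2 := by
      filter_upwards [ae_lt_top hm.ereal_toENNReal hq] with z hz heq
      simp [kernel, heq] at hz
    refine ⟨?_, hne⟩
    refine integrable_of_lintegral_ne_top hg.measurable_sub (fun z => hg.neg_le _) ?_
    refine ne_of_eq_of_ne (lintegral_congr_ae ?_) hq
    filter_upwards [hne] with z hz
    simp [kernel, sub_ne_zero.2 hz]
  exact ⟨key p h1.1, key n h1.2⟩

lemma extEnergy_eq (hg : SharpKernelBounds s g ghat C₁ C₂ C A K) {p n : Measure (Space d)}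
    [IsFiniteMeasure p] [IsFiniteMeasure n]
    (hp : FiniteEnergy g p) (hn : FiniteEnergy g n) :
    extEnergy g p n = ((interaction g p p - interaction g p n - interaction g n p +
      interaction g n n : ℝ) : EReal) := by
  have hk : ∀ m : Measure (Space d × Space d), (∀ᵐ z ∂m, z.1 ≠ z.2) →
      (fun z : Space d × Space d => kernel g (z.1 - z.2)) =ᵐ[m]
        fun z => ((g (z.1 - z.2) : ℝ) : EReal) := by
    intro m hm
    filter_upwards [hm] with z hz
    simp [kernel, sub_ne_zero.2 hz]
  have hpn := hg.integrable_cross hp hn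
  have hnp := hg.integrable_cross hn hp
  rw [extEnergy, extIntegral_congr_ae (hk _ (ae_add_measure_iff.2 ⟨hp.2, hn.2⟩))
    (hk _ (ae_add_measure_iff.2 ⟨hn.ae_ne p, hp.ae_ne n⟩)),
    extIntegral_of_integrable (hp.1.add_measure hn.1) (hpn.add_measure hnp),
    integral_add_measure hp.1 hn.1, integral_add_measure hpn hnp]
  congr 1
  simp only [interaction]
  ring

end SharpKernelBounds

lemma energy_toSigned_sub {d : ℕ} (g : Space d → ℝ) (μ ν : ProbabilityMeasure (Space d)) :
    energy g (toSigned μ - toSigned ν) =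
      extEnergy g ((μ : Measure (Space d)) - ν) ((ν : Measure (Space d)) - μ) := by
  rw [energy, posPart_toSigned_sub, negPart_toSigned_sub]
  rfl

lemma energy_toSigned {d : ℕ} (g : Space d → ℝ) (μ : ProbabilityMeasure (Space d)) :
    energy g (toSigned μ) = extEnergy g (μ : Measure (Space d)) 0 := by
  rw [energy, posPart_toSigned, negPart_toSigned]
  rfl

lemma energy_congr {d : ℕ} {g g₀ : Space d → ℝ} (h : ∀ x, x ≠ 0 → g₀ x = g x)
    (κ : SignedMeasure (Space d)) : energy g κ = energy g₀ κ := by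
  simp only [energy, kernel_congr h]

/-! ### Dual Hölder norms and Hölder functions -/

/-- `N` stands for the Hölder seminorm or the full Hölder norm, so that both dual norms are treated
at once. -/
lemma iSup_sintegral_div_sq_le {X : Type*} [MetricSpace X] [MeasurableSpace X]
    (N : C(X, ℝ) → ℝ≥0∞) (κ : SignedMeasure X) {B : ℝ} (hB : 0 ≤ B)
    (h : ∀ f, N f < ⊤ → ∃ I : ℝ, sintegral f κ = I ∧ I ^ 2 ≤ B * (N f).toReal ^ 2) :
    (((⨆ (f : C(X, ℝ)) (_ : N f < ⊤), (sintegral f κ).toENNReal / N f) ^ 2 : ℝ≥0∞) : EReal) ≤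
      (B : EReal) := by
  have h1 : (⨆ (f : C(X, ℝ)) (_ : N f < ⊤), (sintegral f κ).toENNReal / N f) ≤
      ENNReal.ofReal (√B) := by
    refine iSup₂_le fun f hf => ?_
    obtain ⟨I, hI, hIB⟩ := h f hf
    refine ENNReal.div_le_of_le_mul ?_
    rw [hI, EReal.real_coe_toENNReal, ← ENNReal.ofReal_toReal hf.ne,
      ← ENNReal.ofReal_mul (Real.sqrt_nonneg _)]
    refine ENNReal.ofReal_le_ofReal (le_of_abs_le (abs_le_of_sq_le_sq ?_ (by positivity)))
    rwa [mul_pow, Real.sq_sqrt hB]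
  have h2 : (⨆ (f : C(X, ℝ)) (_ : N f < ⊤), (sintegral f κ).toENNReal / N f) ^ 2 ≤
      ENNReal.ofReal B := by
    calc _ ≤ ENNReal.ofReal (√B) ^ 2 := by gcongr
      _ = _ := by rw [← ENNReal.ofReal_pow (Real.sqrt_nonneg _), Real.sq_sqrt hB]
  calc _ ≤ ((ENNReal.ofReal B : ℝ≥0∞) : EReal) := EReal.coe_ennreal_le_coe_ennreal_iff.2 h2
    _ = _ := by rw [EReal.coe_ennreal_ofReal, max_eq_left hB]

/-- McShane's extension of Hölder functions. -/
lemma exists_holder_extension {d : ℕ} {Ω : Set (Space d)} {f : Ω → ℝ} {L β : ℝ} (hL : 0 ≤ L)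
    (hβ0 : 0 < β) (hβ1 : β ≤ 1)
    (hf : ∀ x y : Ω, |f x - f y| ≤ L * ‖(x : Space d) - y‖ ^ β) :
    ∃ F : Space d → ℝ, (∀ x : Ω, F x = f x) ∧ ∀ x y, |F x - F y| ≤ L * ‖x - y‖ ^ β := by
  rcases isEmpty_or_nonempty Ω with hΩ | ⟨⟨y₀⟩⟩
  · exact ⟨0, fun x => (hΩ.false x).elim, fun x y => by simp; positivity⟩
  -- For `β ≤ 1` the function `‖x - y‖^β` is again a metric; McShane's formula needs exactly this.
  have htri : ∀ x y z : Space d, ‖x - z‖ ^ β ≤ ‖x - y‖ ^ β + ‖y - z‖ ^ β := fun x y z =>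
    (Real.rpow_le_rpow (norm_nonneg _) (norm_sub_le_norm_sub_add_norm_sub x y z) hβ0.le).trans
      (Real.rpow_add_le_add_rpow (norm_nonneg _) (norm_nonneg _) hβ0.le hβ1)
  have hbdd : ∀ x : Space d, BddBelow (Set.range fun y : Ω => f y + L * ‖x - y‖ ^ β) := by
    intro x
    refine ⟨f y₀ - L * ‖(y₀ : Space d) - x‖ ^ β, ?_⟩
    rintro _ ⟨y, rfl⟩
    have h1 := (abs_le.1 (hf y₀ y)).2
    have h2 := mul_le_mul_of_nonneg_left (htri y₀ x y) hL
    simp only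
    linarith
  have : Nonempty Ω := ⟨y₀⟩
  refine ⟨fun x => ⨅ y : Ω, f y + L * ‖x - y‖ ^ β, fun x => le_antisymm ?_ ?_, fun x y => ?_⟩
  · refine (ciInf_le (hbdd x) x).trans ?_
    simp [Real.zero_rpow hβ0.ne']
  · refine le_ciInf fun y => ?_
    linarith [(abs_le.1 (hf x y)).2]
  · have key : ∀ x y : Space d, (⨅ z : Ω, f z + L * ‖x - z‖ ^ β) - L * ‖x - y‖ ^ β ≤
        ⨅ z : Ω, f z + L * ‖y - z‖ ^ β := by
      intro x y
      refine le_ciInf fun z => ?_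
      have h1 := ciInf_le (hbdd x) z
      have h2 := mul_le_mul_of_nonneg_left (htri x y z) hL
      linarith
    have h1 := key x y
    have h2 := key y x
    rw [norm_sub_rev y x] at h2
    exact abs_le.2 ⟨by linarith, by linarith⟩

lemma continuous_of_abs_sub_le {d : ℕ} {F : Space d → ℝ} {L β : ℝ} (hβ : 0 < β)
    (hF : ∀ x y, |F x - F y| ≤ L * ‖x - y‖ ^ β) : Continuous F := by
  refine continuous_iff_continuousAt.2 fun x => ?_
  refine tendsto_iff_norm_sub_tendsto_zero.2 ?_
  have h : Tendsto (fun y => L * ‖y - x‖ ^ β) (𝓝 x) (𝓝 0) := by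
    have : ContinuousAt (fun y => L * ‖y - x‖ ^ β) x :=
      ((continuous_id.sub continuous_const).norm.rpow_const fun _ => Or.inr hβ.le).continuousAt.const_mul L
    simpa [ContinuousAt, Real.zero_rpow hβ.ne'] using this
  exact squeeze_zero (fun _ => norm_nonneg _) (fun y => hF y x) h

/-- Truncation of a Hölder function to a compactly supported one. -/
lemma exists_isHolderBump {d : ℕ} {f : Space d → ℝ} {R L β : ℝ} (hR : 0 ≤ R) (hL : 0 ≤ L)
    (hβ0 : 0 < β) (hβ1 : β ≤ 1) (hf : Continuous f)
    (hfL : ∀ x y, ‖x‖ ≤ R + 2 → ‖y‖ ≤ R + 2 → |f x - f y| ≤ L * ‖x - y‖ ^ β)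
    {x₀ : Space d} (hx₀ : ‖x₀‖ ≤ R) (hfx₀ : f x₀ = 0) :
    ∃ F : Space d → ℝ, IsHolderBump F (R + 1) β (L * (1 + 2 * (2 * R + 4) ^ β)) ∧
      (∀ x, ‖x‖ ≤ R → F x = f x) ∧ ∀ x, |f x - F x| ≤ |f x| := by
  -- The cutoff is `1`-Lipschitz, equal to `1` for `‖x‖ ≤ R` and to `0` for `‖x‖ ≥ R + 1`.
  set χ : Space d → ℝ := fun x => max 0 (min 1 (R + 1 - ‖x‖)) with hχ
  have hχ0 : ∀ x, 0 ≤ χ x := fun x => le_max_left _ _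
  have hχ1 : ∀ x, χ x ≤ 1 := fun x => max_le zero_le_one (min_le_left _ _)
  have hχz : ∀ x, R + 1 ≤ ‖x‖ → χ x = 0 := fun x hx =>
    max_eq_left ((min_le_right _ _).trans (by linarith))
  have hχR : ∀ x, ‖x‖ ≤ R → χ x = 1 := fun x hx => by
    simp only [hχ]
    rw [min_eq_left (by linarith), max_eq_right zero_le_one]
  have hχL : ∀ x y, |χ x - χ y| ≤ ‖x - y‖ := fun x y => by
    have h1 := abs_norm_sub_norm_le x y
    have h2 : |(R + 1 - ‖x‖) - (R + 1 - ‖y‖)| = |‖x‖ - ‖y‖| := by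
      rw [abs_sub_comm]; congr 1; ring
    have h3 := abs_max_sub_max_le_max 0 (min 1 (R + 1 - ‖x‖)) 0 (min 1 (R + 1 - ‖y‖))
    have h4 := abs_min_sub_min_le_max 1 (R + 1 - ‖x‖) 1 (R + 1 - ‖y‖)
    simp only [sub_self, abs_zero] at h3 h4
    rw [max_eq_right (abs_nonneg (min 1 (R + 1 - ‖x‖) - min 1 (R + 1 - ‖y‖)))] at h3
    rw [max_eq_right (abs_nonneg ((R + 1 - ‖x‖) - (R + 1 - ‖y‖)))] at h4
    simp only [hχ]
    linarith
  have hχc : Continuous χ := by simp only [hχ]; fun_prop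
  -- Since `f x₀ = 0`, the Hölder bound gives `|f| ≤ L T` on the ball of radius `R + 2`.
  set T := (2 * R + 4) ^ β with hT
  have hT0 : 0 ≤ T := by positivity
  have hfT : ∀ x, ‖x‖ ≤ R + 2 → |f x| ≤ L * T := fun x hx => by
    have h1 := hfL x x₀ hx (by linarith)
    rw [hfx₀, sub_zero] at h1
    refine h1.trans (mul_le_mul_of_nonneg_left ?_ hL)
    refine Real.rpow_le_rpow (norm_nonneg _) ?_ hβ0.le
    linarith [norm_sub_le x x₀]
  have hFT : ∀ x, |χ x * f x| ≤ L * T := fun x => by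
    rcases le_total ‖x‖ (R + 1) with hx | hx
    · rw [abs_mul, abs_of_nonneg (hχ0 x)]
      exact (mul_le_of_le_one_left (abs_nonneg _) (hχ1 x)).trans (hfT x (by linarith))
    · rw [hχz x hx, zero_mul, abs_zero]; positivity
  have hLT : 0 ≤ L * T := by positivity
  refine ⟨fun x => χ x * f x, ⟨hχc.mul hf, fun x => (hFT x).trans ?_, fun x y => ?_, fun x hx => ?_⟩,
    fun x hx => ?_, fun x => ?_⟩
  · nlinarith
  -- Points at distance at least `1` are handled by the sup bound. Closer points either both lie in
  -- the ball of radius `R + 2`, where a product rule applies, or both lie outside radius `R + 1`,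
  -- where the truncation vanishes.
  · rcases le_or_gt 1 ‖x - y‖ with h1 | h1
    · have h2 : 1 ≤ ‖x - y‖ ^ β := Real.one_le_rpow h1 hβ0.le
      calc |χ x * f x - χ y * f y| ≤ |χ x * f x| + |χ y * f y| := abs_sub _ _
        _ ≤ L * (1 + 2 * T) * 1 := by linarith [hFT x, hFT y]
        _ ≤ _ := by gcongr
    · rcases le_or_gt ‖x‖ (R + 2) with hx | hx
      · rcases le_or_gt ‖y‖ (R + 2) with hy | hy
        · have h2 : ‖x - y‖ ≤ ‖x - y‖ ^ β := by
            conv_lhs => rw [← Real.rpow_one ‖x - y‖]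
            exact Real.rpow_le_rpow_of_exponent_ge_of_imp (norm_nonneg _) h1.le hβ1
              (fun _ h => absurd h one_ne_zero)
          have h3 : |χ x * (f x - f y)| ≤ L * ‖x - y‖ ^ β := by
            rw [abs_mul, abs_of_nonneg (hχ0 x)]
            exact (mul_le_of_le_one_left (abs_nonneg _) (hχ1 x)).trans (hfL x y hx hy)
          have h4 : |(χ x - χ y) * f y| ≤ ‖x - y‖ ^ β * (L * T) := by
            rw [abs_mul]
            exact mul_le_mul ((hχL x y).trans h2) (hfT y hy) (abs_nonneg _) (by positivity)
          have h5 : χ x * f x - χ y * f y = χ x * (f x - f y) + (χ x - χ y) * f y := by ring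
          rw [h5]
          refine (abs_add_le _ _).trans ((add_le_add h3 h4).trans ?_)
          have : 0 ≤ ‖x - y‖ ^ β * (L * T) := by positivity
          linarith
        · have h2 := norm_sub_norm_le y x
          rw [norm_sub_rev] at h2
          simp only [hχz x (by linarith), hχz y (by linarith), zero_mul, sub_self, abs_zero]
          positivity
      · have h2 := norm_sub_norm_le x y
        simp only [hχz x (by linarith), hχz y (by linarith), zero_mul, sub_self, abs_zero]
        positivity
  · simp only [hχz x hx.le, zero_mul]
  · simp only [hχR x hx, one_mul]
  · have h5 : f x - χ x * f x = (1 - χ x) * f x := by ring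
    rw [h5, abs_mul, abs_of_nonneg (sub_nonneg.2 (hχ1 x))]
    exact mul_le_of_le_one_left (abs_nonneg _) (by linarith [hχ0 x])

/-- The exponent may exceed `1`; on bounded sets an `α`-Hölder bound implies one with exponent `min
α 1`, to which extension and truncation apply. -/
lemma rpow_le_mul_rpow_min {r T a : ℝ} (hr : 0 ≤ r) (hrT : r ≤ T) (ha : 0 < a) :
    r ^ a ≤ T ^ (a - min a 1) * r ^ min a 1 := by
  rcases hr.eq_or_lt with rfl | hr
  · rw [Real.zero_rpow ha.ne']; positivity
  · have : a = (a - min a 1) + min a 1 := by ring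
    conv_lhs => rw [this]
    rw [Real.rpow_add hr]
    gcongr
    exact sub_nonneg.2 (min_le_left _ _)

lemma abs_sub_le_of_eHolderNorm {X : Type*} [MetricSpace X] {α : ℝ≥0} {f : X → ℝ}
    (hf : eHolderNorm α f < ⊤) (x y : X) :
    |f x - f y| ≤ (eHolderNorm α f).toReal * dist x y ^ (α : ℝ) :=
  ((eHolderNorm_lt_top.1 hf).holderWith).dist_le x y

/-! ### Measures on a compact set -/

lemma SharpKernelBounds.exists_dualHolderSeminorm_sq_le {d : ℕ} {s : ℝ} {g ghat : Space d → ℝ}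
    {C₁ C₂ C A K : ℝ} (hg : SharpKernelBounds s g ghat C₁ C₂ C A K) (hs1 : s < 1) {α : ℝ≥0}
    (hα : s < (α : ℝ)) {Ω : Set (Space d)} (hΩ : IsCompact Ω) :
    ∃ C : ℝ, 0 < C ∧ ∀ μ ν : ProbabilityMeasure Ω,
      ((dualHolderSeminorm α (toSigned μ - toSigned ν) ^ 2 : ℝ≥0∞) : EReal) ≤
        (C : EReal) * energy g ((toSigned μ - toSigned ν).map Subtype.val) := by
  have hα0 : (0 : ℝ) < α := hg.s_pos.trans hα
  set β : ℝ := min (α : ℝ) 1 with hβ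
  have hβ0 : 0 < β := lt_min hα0 one_pos
  have hβ1 : β ≤ 1 := min_le_right _ _
  obtain ⟨R₀, hR₀⟩ := hΩ.isBounded.subset_closedBall (0 : Space d)
  set R := max R₀ 0
  have hR : 0 ≤ R := le_max_right _ _
  have hΩR : ∀ x : Ω, ‖(x : Space d)‖ ≤ R := fun x =>
    (mem_closedBall_zero_iff.1 (hR₀ x.2)).trans (le_max_left _ _)
  obtain ⟨S, hS, hSb⟩ := hg.exists_sq_integral_sub_le (lt_min hα hs1) (R + 1)
  set D : ℝ := (2 * R) ^ ((α : ℝ) - β) * (1 + 2 * (2 * R + 4) ^ β) with hD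
  -- The summand `1` keeps the constant positive, so that its product with an infinite energy is
  -- `⊤`.
  refine ⟨S * D ^ 2 + 1, by positivity, fun μ ν => ?_⟩
  have hval : Measurable (Subtype.val : Ω → Space d) := measurable_subtype_coe
  rw [toSigned_sub_map hval, energy_toSigned_sub]
  set μ' := μ.map hval.aemeasurable with hμ'
  set ν' := ν.map hval.aemeasurable with hν'
  set p : Measure (Space d) := (μ' : Measure (Space d)) - ν'
  set n : Measure (Space d) := (ν' : Measure (Space d)) - μ'
  have : IsFiniteMeasure p := isFiniteMeasure_of_le _ Measure.sub_le
  have : IsFiniteMeasure n := isFiniteMeasure_of_le _ Measure.sub_le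
  have hCpos : 0 < S * D ^ 2 + 1 := by positivity
  by_cases htop : extEnergy g p n = ⊤
  · rw [htop, EReal.coe_mul_top_of_pos hCpos]; exact le_top
  obtain ⟨hp, hn⟩ := hg.finiteEnergy_of_extEnergy_ne_top htop
  rw [hg.extEnergy_eq hp hn, ← EReal.coe_mul]
  have hE0 := (hg.negSobolevSq_le hp hn).1
  set E := interaction g p p - interaction g p n - interaction g n p + interaction g n n
  refine iSup_sintegral_div_sq_le _ _ (by positivity) fun f hf => ?_
  set L := (eHolderNorm α f).toReal
  obtain ⟨x₀⟩ : Nonempty Ω := (μ : Measure Ω).nonempty_of_neZero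
  have hfL : ∀ x y : Ω, |(f x - f x₀) - (f y - f x₀)| ≤
      L * (2 * R) ^ ((α : ℝ) - β) * ‖(x : Space d) - y‖ ^ β := by
    intro x y
    rw [sub_sub_sub_cancel_right, mul_assoc]
    refine (abs_sub_le_of_eHolderNorm hf x y).trans ?_
    gcongr
    rw [Subtype.dist_eq, dist_eq_norm]
    refine rpow_le_mul_rpow_min (norm_nonneg _) ?_ hα0
    linarith [norm_sub_le (x : Space d) y, hΩR x, hΩR y]
  obtain ⟨f₁, hf₁, hf₁L⟩ := exists_holder_extension (by positivity) hβ0 hβ1 hfL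
  obtain ⟨F, hF, hFeq, -⟩ := exists_isHolderBump hR (by positivity) hβ0 hβ1
    (continuous_of_abs_sub_le hβ0 hf₁L) (fun x y _ _ => hf₁L x y) (hΩR x₀) (by simp [hf₁])
  have hFi : ∀ (q : Measure (Space d)) [IsFiniteMeasure q], Integrable F q := fun q _ =>
    Integrable.of_bound hF.continuous.aestronglyMeasurable _ (ae_of_all _ hF.abs_le)
  have hfF : ∀ x : Ω, f x = F x + f x₀ := fun x => by rw [hFeq x (hΩR x), hf₁]; ring
  have hInt : ∀ q : ProbabilityMeasure Ω, Integrable (fun x : Ω => F x) (q : Measure Ω) := fun q =>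
    Integrable.of_bound (hF.continuous.comp continuous_subtype_val).aestronglyMeasurable _
      (ae_of_all _ fun x => hF.abs_le x)
  have hfi : ∀ q : ProbabilityMeasure Ω, Integrable f (q : Measure Ω) := fun q =>
    ((hInt q).add (integrable_const (f x₀))).congr (ae_of_all _ fun x => (hfF x).symm)
  have hI : ∀ q : ProbabilityMeasure Ω, ∫ x, f x ∂(q : Measure Ω) =
      ∫ x, F x ∂(q.map hval.aemeasurable : Measure (Space d)) + f x₀ := fun q => by
    rw [ProbabilityMeasure.toMeasure_map, integral_map hval.aemeasurable
      hF.continuous.aestronglyMeasurable]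
    rw [integral_congr_ae (ae_of_all _ hfF), integral_add (hInt q) (integrable_const _)]
    simp
  refine ⟨_, sintegral_toSigned_sub μ ν (hfi μ) (hfi ν), ?_⟩
  -- The additive constant `f x₀` cancels. The duality bound is applied to the Jordan parts `p` and
  -- `n`, which have finite energy even if `μ'` and `ν'` themselves do not.
  rw [hI, hI, add_sub_add_right_eq_sub, ← integral_sub_measure (hFi _) (hFi _)]
  refine (hSb F _ hF p n hp hn).trans ?_
  have e : S * (L * (2 * R) ^ ((α : ℝ) - β) * (1 + 2 * (2 * R + 4) ^ β)) ^ 2 * E =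
      S * D ^ 2 * E * L ^ 2 := by rw [hD]; ring
  rw [e]
  gcongr
  linarith

/-! ### Bilinearity of the interaction -/

lemma FiniteEnergy.mono {d : ℕ} {g : Space d → ℝ} {p q : Measure (Space d)} [IsFiniteMeasure q]
    (hq : FiniteEnergy g q) (hpq : p ≤ q) : FiniteEnergy g p := by
  have h : p.prod p ≤ q.prod q := Measure.prod_mono hpq hpq
  exact ⟨hq.1.mono_measure h, ae_mono h hq.2⟩

lemma FiniteEnergy.smul {d : ℕ} {g : Space d → ℝ} {p : Measure (Space d)} [IsFiniteMeasure p]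
    (hp : FiniteEnergy g p) (c : ℝ≥0) : FiniteEnergy g (c • p) := by
  have h : (c • p).prod (c • p) = (c * c) • p.prod p := by
    rw [Measure.prod_smul_left, Measure.prod_smul_right, smul_smul]
  rw [FiniteEnergy, h]
  exact ⟨hp.1.smul_measure_nnreal, Measure.ae_smul_measure hp.2 _⟩

lemma interaction_smul_left {d : ℕ} (g : Space d → ℝ) (p q : Measure (Space d)) [IsFiniteMeasure p]
    [IsFiniteMeasure q] (c : ℝ≥0) : interaction g (c • p) q = c * interaction g p q := by
  rw [interaction, Measure.prod_smul_left, integral_smul_nnreal_measure]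
  rfl

lemma interaction_smul_right {d : ℕ} (g : Space d → ℝ) (p q : Measure (Space d))
    [IsFiniteMeasure p] [IsFiniteMeasure q] (c : ℝ≥0) :
    interaction g p (c • q) = c * interaction g p q := by
  rw [interaction, Measure.prod_smul_right, integral_smul_nnreal_measure]
  rfl

namespace SharpKernelBounds

variable {d : ℕ} {s : ℝ} {g ghat : Space d → ℝ} {C₁ C₂ C A K : ℝ}

lemma interaction_comm (hg : SharpKernelBounds s g ghat C₁ C₂ C A K) (p q : Measure (Space d))
    [IsFiniteMeasure p] [IsFiniteMeasure q] :
    interaction g p q = interaction g q p := by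
  rw [interaction, interaction, ← integral_prod_swap]
  refine integral_congr_ae (ae_of_all _ fun z => ?_)
  simp only [Prod.fst_swap, Prod.snd_swap]
  rw [← hg.even, neg_sub]

lemma interaction_add_left (hg : SharpKernelBounds s g ghat C₁ C₂ C A K)
    {p q r : Measure (Space d)} [IsFiniteMeasure p] [IsFiniteMeasure q]
    [IsFiniteMeasure r] (hp : FiniteEnergy g p) (hq : FiniteEnergy g q) (hr : FiniteEnergy g r) :
    interaction g (p + q) r = interaction g p r + interaction g q r := by
  rw [interaction, Measure.add_prod,
    integral_add_measure (hg.integrable_cross hp hr) (hg.integrable_cross hq hr)]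
  rfl

lemma interaction_add_right (hg : SharpKernelBounds s g ghat C₁ C₂ C A K)
    {p q r : Measure (Space d)} [IsFiniteMeasure p] [IsFiniteMeasure q]
    [IsFiniteMeasure r] (hp : FiniteEnergy g p) (hq : FiniteEnergy g q) (hr : FiniteEnergy g r) :
    interaction g r (p + q) = interaction g r p + interaction g r q := by
  rw [hg.interaction_comm, hg.interaction_add_left hp hq hr, hg.interaction_comm p,
    hg.interaction_comm q]

lemma finiteEnergy_add (hg : SharpKernelBounds s g ghat C₁ C₂ C A K) {p q : Measure (Space d)}
    [IsFiniteMeasure p] [IsFiniteMeasure q]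
    (hp : FiniteEnergy g p) (hq : FiniteEnergy g q) : FiniteEnergy g (p + q) := by
  have h : (p + q).prod (p + q) = (p.prod p + p.prod q) + (q.prod p + q.prod q) := by
    rw [Measure.add_prod, Measure.prod_add, Measure.prod_add]
  rw [FiniteEnergy, h]
  refine ⟨(hp.1.add_measure (hg.integrable_cross hp hq)).add_measure
    ((hg.integrable_cross hq hp).add_measure hq.1), ?_⟩
  simp only [ae_add_measure_iff]
  exact ⟨⟨hp.2, hq.ae_ne p⟩, hp.ae_ne q, hq.2⟩

lemma neg_mul_le_interaction (hg : SharpKernelBounds s g ghat C₁ C₂ C A K)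
    {p q : Measure (Space d)} [IsFiniteMeasure p]
    [IsProbabilityMeasure q] (hp : FiniteEnergy g p) (hq : FiniteEnergy g q) :
    -K * p.real Set.univ ≤ interaction g p q := by
  have h := integral_mono (integrable_const (-K)) (hg.integrable_cross hp hq)
    fun z => hg.neg_le (z.1 - z.2)
  rw [integral_const, measureReal_def, ← Set.univ_prod_univ, Measure.prod_prod,
    measure_univ (μ := q), mul_one, smul_eq_mul] at h
  rw [measureReal_def, mul_comm]
  exact h

/-! ### The mean field energy -/

/-- Differences of points of the unit ball lie in the ball of radius `2`, on which `g` is integrable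
since `d - 2s < d`. This supplies a competitor of finite energy. -/
lemma finiteEnergy_volume_restrict_ball (hg : SharpKernelBounds s g ghat C₁ C₂ C A K) :
    FiniteEnergy g ((volume : Measure (Space d)).restrict (Metric.ball 0 1)) := by
  have := nontrivial_space hg.dim_pos
  set q : Measure (Space d) := volume.restrict (Metric.ball 0 1) with hq
  have : IsFiniteMeasure q := ⟨by
    rw [hq, Measure.restrict_apply_univ]; exact measure_ball_lt_top⟩
  refine ⟨⟨hg.measurable_sub.aestronglyMeasurable, ?_⟩, ?_⟩
  · have hm := hg.measurable_sub.enorm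
    rw [HasFiniteIntegral, lintegral_prod _ hm.aemeasurable]
    set J := ∫⁻ y in Metric.ball (0 : Space d) 2, ‖g y‖ₑ
    have hJ : J < ⊤ := by
      have h1 : IntegrableOn g (Metric.ball 0 2) := by
        refine ((integrableOn_norm_rpow_ball hg.dim_pos hg.exponent_lt 2).const_mul C).mono'
          hg.measurable.aestronglyMeasurable (ae_of_all _ fun x => ?_)
        exact hg.abs_le x
      exact h1.2
    have hin : ∀ᵐ x ∂q, ∫⁻ y, ‖g (x - y)‖ₑ ∂q ≤ J := by
      filter_upwards [ae_restrict_mem measurableSet_ball] with x hx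
      calc ∫⁻ y, ‖g (x - y)‖ₑ ∂q
          ≤ ∫⁻ y in Metric.ball (0 : Space d) 1,
              (Metric.ball (0 : Space d) 2).indicator (fun y => ‖g y‖ₑ) (x - y) := by
            refine setLIntegral_mono' measurableSet_ball fun y hy => ?_
            rw [Set.indicator_of_mem]
            rw [mem_ball_zero_iff] at *
            linarith [norm_sub_le x y]
        _ ≤ ∫⁻ y, (Metric.ball (0 : Space d) 2).indicator (fun y => ‖g y‖ₑ) (x - y) :=
            setLIntegral_le_lintegral _ _
        _ = J := by
            rw [lintegral_sub_left_eq_self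
              ((Metric.ball (0 : Space d) 2).indicator (fun y => ‖g y‖ₑ)) x,
              lintegral_indicator measurableSet_ball]
    calc _ ≤ ∫⁻ _, J ∂q := lintegral_mono_ae hin
      _ < ⊤ := by rw [lintegral_const]; exact ENNReal.mul_lt_top hJ (measure_lt_top _ _)
  · have hm : MeasurableSet {z : Space d × Space d | z.1 ≠ z.2} :=
      (measurableSet_eq_fun measurable_fst measurable_snd).compl
    rw [Measure.ae_prod_iff_ae_ae hm]
    refine ae_of_all _ fun x => ?_
    rw [ae_iff]
    simp [hq]

variable {V : Space d → ℝ}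

lemma energyV_eq (hg : SharpKernelBounds s g ghat C₁ C₂ C A K) {μ : ProbabilityMeasure (Space d)}
    (hμ : FiniteEnergy g (μ : Measure (Space d)))
    (hV : Integrable V (μ : Measure (Space d))) :
    energyV g V μ = ((interaction g μ μ + ∫ x, V x ∂(μ : Measure (Space d)) : ℝ) : EReal) := by
  rw [energyV, energy_toSigned, hg.extEnergy_eq hμ (finiteEnergy_zero g), sintegral,
    posPart_toSigned, negPart_toSigned, extIntegral_of_integrable hV integrable_zero_measure,
    ← EReal.coe_add]
  simp [interaction]

/-- In `EReal` one has `⊤ + ⊥ = ⊥`, so infinite terms could cancel. The lower bounds on `g` and `V`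
exclude this: each of the two terms is real or `⊤`. -/
lemma of_energyV_ne_top (hg : SharpKernelBounds s g ghat C₁ C₂ C A K) (hVm : Measurable V) {v : ℝ}
    (hv : ∀ x, -v ≤ V x)
    {μ : ProbabilityMeasure (Space d)} (h : energyV g V μ ≠ ⊤) :
    FiniteEnergy g (μ : Measure (Space d)) ∧ Integrable V (μ : Measure (Space d)) := by
  have h1 : extEnergy g (μ : Measure (Space d)) 0 = ⊤ ∨
      FiniteEnergy g (μ : Measure (Space d)) := by
    by_contra! hc
    exact hc.2 (hg.finiteEnergy_of_extEnergy_ne_top hc.1).1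
  have h2 : sintegral V (toSigned μ) = ⊤ ∨ Integrable V (μ : Measure (Space d)) := by
    rw [sintegral, posPart_toSigned, negPart_toSigned, extIntegral]
    by_cases hc : ∫⁻ x, ENNReal.ofReal (V x) ∂(μ : Measure (Space d)) = ⊤
    · left; simp [hc]
    · exact Or.inr (integrable_of_lintegral_ne_top hVm hv hc)
  rw [energyV, energy_toSigned] at h
  rcases h1 with h1 | h1
  · exfalso
    rcases h2 with h2 | h2
    · exact h (by rw [h1, h2, EReal.top_add_top])
    · rw [h1, sintegral, posPart_toSigned, negPart_toSigned,
        extIntegral_of_integrable h2 integrable_zero_measure] at h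
      exact h (EReal.top_add_coe _)
  · refine ⟨h1, h2.resolve_left fun h2 => h ?_⟩
    rw [h2, hg.extEnergy_eq h1 (finiteEnergy_zero g)]
    exact EReal.coe_add_top _

/-- Minimality is compared with the normalized Lebesgue measure on the unit ball. -/
lemma energyV_ne_top_of_isEquilibriumMeasure (hg : SharpKernelBounds s g ghat C₁ C₂ C A K)
    (hVc : Continuous V)
    {μ : ProbabilityMeasure (Space d)} (hμ : IsEquilibriumMeasure g V μ) :
    energyV g V μ ≠ ⊤ := by
  set q : Measure (Space d) := volume.restrict (Metric.ball 0 1) with hq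
  have hqu : q Set.univ = volume (Metric.ball (0 : Space d) 1) := by
    rw [hq, Measure.restrict_apply_univ]
  have hq0 : q Set.univ ≠ 0 := by
    rw [hqu]; exact (Metric.measure_ball_pos _ _ one_pos).ne'
  have : IsFiniteMeasure q := ⟨by rw [hqu]; exact measure_ball_lt_top⟩
  set c : ℝ≥0 := (q Set.univ).toNNReal⁻¹
  have hprob : IsProbabilityMeasure (c • q) := ⟨by
    have h0 : (q Set.univ).toNNReal ≠ 0 := by
      simp [ENNReal.toNNReal_eq_zero_iff, hq0]
    rw [Measure.smul_apply, ENNReal.smul_def, smul_eq_mul, ENNReal.coe_inv h0,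
      ENNReal.coe_toNNReal (measure_ne_top _ _),
      ENNReal.inv_mul_cancel hq0 (measure_ne_top _ _)]⟩
  have hVi : Integrable V q :=
    (hVc.continuousOn.integrableOn_compact (isCompact_closedBall 0 1)).mono_set
      Metric.ball_subset_closedBall
  have h := hg.energyV_eq (μ := ⟨c • q, hprob⟩) (V := V)
    (hg.finiteEnergy_volume_restrict_ball.smul c) hVi.smul_measure_nnreal
  refine ((hμ ⟨c • q, hprob⟩).trans_lt ?_).ne
  rw [h]
  exact EReal.coe_lt_top _

/-- The first variation of the energy at an equilibrium measure. -/
lemma le_first_variation (hg : SharpKernelBounds s g ghat C₁ C₂ C A K)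
    {μ : ProbabilityMeasure (Space d)} (hμ : IsEquilibriumMeasure g V μ)
    (hμE : FiniteEnergy g (μ : Measure (Space d))) (hμV : Integrable V (μ : Measure (Space d)))
    {ρ : Measure (Space d)} [IsFiniteMeasure ρ] (hρ1 : ρ.real Set.univ ≤ 1)
    (hρE : FiniteEnergy g ρ) (hρV : Integrable V ρ) :
    ρ.real Set.univ * (2 * interaction g μ μ + ∫ x, V x ∂(μ : Measure (Space d))) ≤
      2 * interaction g ρ μ + ∫ x, V x ∂ρ := by
  set m := ρ.real Set.univ with hm
  have hm0 : 0 ≤ m := measureReal_nonneg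
  set Q := interaction g (μ : Measure (Space d)) μ
  set P := interaction g ρ μ
  set W := interaction g ρ ρ
  set v := ∫ x, V x ∂(μ : Measure (Space d))
  set w := ∫ x, V x ∂ρ
  -- The competitor `(1 - t m) μ + t ρ` is a probability measure because `m ≤ 1`. Its energy is a
  -- quadratic polynomial in `t`; minimality divided by `t` gives the claim, and `t → 0` leaves the
  -- linear coefficient.
  have key : ∀ t : ℝ, 0 < t → t ≤ 1 →
      0 ≤ (2 * P + w - m * (2 * Q + v)) + t * (m ^ 2 * Q - 2 * m * P + W) := by
    intro t ht0 ht1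
    have htm : 0 ≤ 1 - t * m := by nlinarith
    lift t to ℝ≥0 using ht0.le
    obtain ⟨a, ha⟩ : ∃ a : ℝ≥0, (a : ℝ) = 1 - t * m := ⟨⟨_, htm⟩, rfl⟩
    have hprob : IsProbabilityMeasure (a • (μ : Measure (Space d)) + t • ρ) := ⟨by
      have h1 : (a • (μ : Measure (Space d)) + t • ρ).real Set.univ = 1 := by
        rw [measureReal_add_apply, measureReal_nnreal_smul_apply, measureReal_nnreal_smul_apply,
          ← hm, ha]
        simp
      rw [measureReal_def] at h1
      rwa [ENNReal.toReal_eq_one_iff] at h1⟩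
    have hE1 := hμE.smul a
    have hE2 := hρE.smul t
    have hE := hg.finiteEnergy_add hE1 hE2
    have h := hμ ⟨_, hprob⟩
    rw [hg.energyV_eq hμE hμV, hg.energyV_eq (μ := ⟨_, hprob⟩) hE
      (hμV.smul_measure_nnreal.add_measure hρV.smul_measure_nnreal), EReal.coe_le_coe_iff] at h
    simp only [ProbabilityMeasure.coe_mk] at h
    rw [hg.interaction_add_left hE1 hE2 hE, hg.interaction_add_right hE1 hE2 hE1,
      hg.interaction_add_right hE1 hE2 hE2,
      integral_add_measure hμV.smul_measure_nnreal hρV.smul_measure_nnreal] at h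
    simp only [interaction_smul_left, interaction_smul_right, integral_smul_nnreal_measure,
      NNReal.smul_def, smul_eq_mul, hg.interaction_comm (μ : Measure (Space d)) ρ] at h
    rw [ha] at h
    change Q + v ≤ (1 - t * m) * ((1 - t * m) * Q) + t * ((1 - t * m) * P) +
      ((1 - t * m) * (t * P) + t * (t * W)) + ((1 - t * m) * v + t * w) at h
    have h3 : 0 ≤ (t : ℝ) * ((2 * P + w - m * (2 * Q + v)) + t * (m ^ 2 * Q - 2 * m * P + W)) := by
      linarith
    exact nonneg_of_mul_nonneg_right h3 ht0
  have hlim : Tendsto (fun t : ℝ => (2 * P + w - m * (2 * Q + v)) +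
      t * (m ^ 2 * Q - 2 * m * P + W)) (𝓝[>] 0) (𝓝 (2 * P + w - m * (2 * Q + v))) := by
    have h : Continuous (fun t : ℝ => (2 * P + w - m * (2 * Q + v)) +
      t * (m ^ 2 * Q - 2 * m * P + W)) := by fun_prop
    have := (h.tendsto 0).mono_left (nhdsWithin_le_nhds (s := Set.Ioi 0))
    simpa using this
  have := ge_of_tendsto hlim (by
    filter_upwards [Ioc_mem_nhdsGT one_pos] with t ht using key t ht.1 ht.2)
  linarith

/-- The energy excess controls the energy of the difference and the mass at infinity. -/
lemma energy_sub_add_setIntegral_le (hg : SharpKernelBounds s g ghat C₁ C₂ C A K) {v e : ℝ}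
    (hv : ∀ x, -v ≤ V x)
    {μ₀ : ProbabilityMeasure (Space d)} (hμ₀ : IsEquilibriumMeasure g V μ₀)
    (hμ₀E : FiniteEnergy g (μ₀ : Measure (Space d))) (hμ₀V : Integrable V (μ₀ : Measure (Space d)))
    (he : interaction g μ₀ μ₀ + ∫ x, V x ∂(μ₀ : Measure (Space d)) = e)
    {μ : ProbabilityMeasure (Space d)} (hμE : FiniteEnergy g (μ : Measure (Space d)))
    (hμV : Integrable V (μ : Measure (Space d))) {S : Set (Space d)} (hS : MeasurableSet S) :
    (interaction g μ μ - interaction g μ μ₀ - interaction g μ₀ μ + interaction g μ₀ μ₀) +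
      ∫ x in Sᶜ, (V x - (2 * K + 2 * e + v)) ∂(μ : Measure (Space d)) ≤
    interaction g μ μ + ∫ x, V x ∂(μ : Measure (Space d)) - e := by
  set ρ := (μ : Measure (Space d)).restrict S
  set σ := (μ : Measure (Space d)).restrict Sᶜ with hσ
  have hρσ : (μ : Measure (Space d)) = ρ + σ := (Measure.restrict_add_restrict_compl hS).symm
  have hρE : FiniteEnergy g ρ := hμE.mono Measure.restrict_le_self
  have hσE : FiniteEnergy g σ := hμE.mono Measure.restrict_le_self
  have hρV : Integrable V ρ := hμV.restrict
  have hσV : Integrable V σ := hμV.restrict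
  have hmass : ρ.real Set.univ + σ.real Set.univ = 1 := by
    rw [← measureReal_add_apply, ← hρσ]; simp
  have hσ0 : 0 ≤ σ.real Set.univ := measureReal_nonneg
  -- The first variation is used only on `ρ`, the part of `μ` in `S`; on the outer part `σ` the
  -- crude bound `g ≥ -K` suffices and costs `2K` per unit of mass.
  have h1 := hg.le_first_variation hμ₀ hμ₀E hμ₀V (by linarith) hρE hρV
  have h2 := hg.neg_mul_le_interaction hσE hμ₀E
  have h3 : interaction g μ μ₀ = interaction g ρ μ₀ + interaction g σ μ₀ := by
    conv_lhs => rw [hρσ]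
    exact hg.interaction_add_left hρE hσE hμ₀E
  have h4 : ∫ x, V x ∂(μ : Measure (Space d)) = ∫ x, V x ∂ρ + ∫ x, V x ∂σ := by
    conv_lhs => rw [hρσ]
    exact integral_add_measure hρV hσV
  have h5 : -v ≤ ∫ x, V x ∂(μ₀ : Measure (Space d)) := by
    have := integral_mono (integrable_const (-v)) hμ₀V hv
    simpa using this
  have h6 : ∫ x, (V x - (2 * K + 2 * e + v)) ∂σ =
      ∫ x, V x ∂σ - σ.real Set.univ * (2 * K + 2 * e + v) := by
    rw [integral_sub hσV (integrable_const _), integral_const, smul_eq_mul]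
  rw [h6, hg.interaction_comm μ₀ μ, h4, h3]
  have h7 : ρ.real Set.univ = 1 - σ.real Set.univ := by linarith
  rw [h7] at h1
  set Q := interaction g (μ₀ : Measure (Space d)) μ₀
  set u := ∫ x, V x ∂(μ₀ : Measure (Space d))
  -- Because `e = Q + u` and `u ≥ -v`, one has `2Q + u = 2e - u ≤ 2e + v`.
  have h8 : σ.real Set.univ * (2 * Q + u) ≤ σ.real Set.univ * (2 * e + v) :=
    mul_le_mul_of_nonneg_left (by linarith) hσ0
  nlinarith

end SharpKernelBounds

/-! ### Comparison with the equilibrium measure -/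

lemma sq_integral_le_integral_sq {X : Type*} [MeasurableSpace X] {μ : Measure X}
    [IsProbabilityMeasure μ] {h : X → ℝ} (hi : Integrable h μ)
    (hi2 : Integrable (fun x => h x ^ 2) μ) : (∫ x, h x ∂μ) ^ 2 ≤ ∫ x, h x ^ 2 ∂μ := by
  set m := ∫ x, h x ∂μ
  have h0 : 0 ≤ ∫ x, (h x ^ 2 - 2 * m * h x + m ^ 2) ∂μ :=
    integral_nonneg fun x => by
      have : h x ^ 2 - 2 * m * h x + m ^ 2 = (h x - m) ^ 2 := by ring
      simp only [this, Pi.zero_apply]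
      positivity
  have hi3 : Integrable (fun x => h x ^ 2 - 2 * m * h x) μ := hi2.sub (hi.const_mul _)
  rw [integral_add hi3 (integrable_const _), integral_sub hi2 (hi.const_mul _), integral_const_mul, integral_const] at h0
  simp only [probReal_univ, one_smul] at h0
  change 0 ≤ _ - 2 * m * m + m ^ 2 at h0
  linarith

/-- A function vanishing on `S` whose square is dominated off `S`. -/
lemma integrable_and_sq_integral_le {X : Type*} [MeasurableSpace X] {μ : Measure X}
    [IsProbabilityMeasure μ] {h W : X → ℝ} (hh : AEStronglyMeasurable h μ) {S : Set X}
    (hS : MeasurableSet S) (hW : Integrable W μ) (h0 : ∀ x ∈ S, h x = 0)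
    (hb : ∀ x ∉ S, h x ^ 2 ≤ W x) :
    Integrable h μ ∧ (∫ x, h x ∂μ) ^ 2 ≤ ∫ x in Sᶜ, W x ∂μ := by
  have hWi : Integrable (Sᶜ.indicator W) μ := hW.indicator hS.compl
  have hle : ∀ x, h x ^ 2 ≤ Sᶜ.indicator W x := fun x => by
    by_cases hx : x ∈ S
    · rw [h0 x hx, Set.indicator_of_notMem (by simpa using hx)]; simp
    · rw [Set.indicator_of_mem (by simpa using hx)]; exact hb x hx
  have hi2 : Integrable (fun x => h x ^ 2) μ :=
    hWi.mono' (hh.pow 2) (ae_of_all _ fun x => by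
      rw [Real.norm_eq_abs, abs_of_nonneg (sq_nonneg _)]; exact hle x)
  have hi : Integrable h μ := ((memLp_two_iff_integrable_sq hh).2 hi2).integrable one_le_two
  refine ⟨hi, (sq_integral_le_integral_sq hi hi2).trans ?_⟩
  rw [← integral_indicator hS.compl]
  exact integral_mono hi2 hWi hle

namespace SharpKernelBounds

variable {d : ℕ} {s : ℝ} {g ghat : Space d → ℝ} {C₁ C₂ C A K : ℝ} {V : Space d → ℝ}

/-- Write `f - f 0 = F + h` with `F` a Hölder bump and `h` zero on the ball of radius `R`. The bump
is controlled by the energy of `μ - μ₀`, the tail `h` by the integral of `V` minus the threshold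
outside the ball; the energy excess dominates both. -/
lemma exists_sq_integral_sub_equilibrium_le (hg : SharpKernelBounds s g ghat C₁ C₂ C A K)
    (hs1 : s < 1) {α : ℝ} (hα : s < α) {v e R c : ℝ}
    (hv : ∀ x, -v ≤ V x) (hR : 0 ≤ R) (hc : 0 ≤ c)
    (hVR : ∀ x, R < ‖x‖ → 2 * K + 2 * e + v ≤ V x) :
    ∃ D : ℝ, 0 < D ∧ ∀ μ₀ : ProbabilityMeasure (Space d), IsEquilibriumMeasure g V μ₀ →
      FiniteEnergy g (μ₀ : Measure (Space d)) → Integrable V (μ₀ : Measure (Space d)) →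
      interaction g μ₀ μ₀ + ∫ x, V x ∂(μ₀ : Measure (Space d)) = e →
      ∀ μ : ProbabilityMeasure (Space d), FiniteEnergy g (μ : Measure (Space d)) →
      Integrable V (μ : Measure (Space d)) → ∀ f : Space d → ℝ, Continuous f →
      ∀ L : ℝ, 0 ≤ L → (∀ x y, |f x - f y| ≤ L * ‖x - y‖ ^ α) →
      (∀ x, R < ‖x‖ → (f x - f 0) ^ 2 ≤ L ^ 2 * (c * (V x - (2 * K + 2 * e + v)))) →
      Integrable f (μ : Measure (Space d)) ∧ Integrable f (μ₀ : Measure (Space d)) ∧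
      (∫ x, f x ∂(μ : Measure (Space d)) - ∫ x, f x ∂(μ₀ : Measure (Space d))) ^ 2 ≤
        D * (interaction g μ μ + ∫ x, V x ∂(μ : Measure (Space d)) - e) * L ^ 2 := by
  have hα0 : 0 < α := hg.s_pos.trans hα
  set β : ℝ := min α 1 with hβ
  have hβ0 : 0 < β := lt_min hα0 one_pos
  have hβ1 : β ≤ 1 := min_le_right _ _
  obtain ⟨S, hS, hSb⟩ := hg.exists_sq_integral_sub_le (lt_min hα hs1) (R + 1)
  set T : ℝ := (2 * R + 4) ^ (α - β) * (1 + 2 * (2 * R + 4) ^ β) with hT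
  -- The factors `2` come from squaring the sum of the bump and tail contributions.
  refine ⟨2 * (S * T ^ 2) + 2 * c + 1, by positivity, ?_⟩
  intro μ₀ hμ₀ hμ₀E hμ₀V he μ hμE hμV f hfc L hL hfL hfV
  have hball : MeasurableSet (Metric.closedBall (0 : Space d) R) := measurableSet_closedBall
  have hfL' : ∀ x y : Space d, ‖x‖ ≤ R + 2 → ‖y‖ ≤ R + 2 → |(f x - f 0) - (f y - f 0)| ≤
      L * (2 * R + 4) ^ (α - β) * ‖x - y‖ ^ β := by
    intro x y hx hy
    rw [sub_sub_sub_cancel_right, mul_assoc]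
    refine (hfL x y).trans ?_
    gcongr
    refine rpow_le_mul_rpow_min (norm_nonneg _) ?_ hα0
    linarith [norm_sub_le x y]
  obtain ⟨F, hF, hFeq, hFle⟩ := exists_isHolderBump (f := fun x => f x - f 0) hR (by positivity) hβ0 hβ1
    (hfc.sub continuous_const) hfL' (by simpa using hR) (sub_self _)
  have hFi : ∀ (q : Measure (Space d)) [IsFiniteMeasure q], Integrable F q := fun q _ =>
    Integrable.of_bound hF.continuous.aestronglyMeasurable _ (ae_of_all _ hF.abs_le)
  set h : Space d → ℝ := fun x => f x - f 0 - F x with hh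
  have hhc : Continuous h := (hfc.sub continuous_const).sub hF.continuous
  have hfh : ∀ x, f x = F x + h x + f 0 := fun x => by simp only [hh]; ring
  have htail : ∀ q : ProbabilityMeasure (Space d), FiniteEnergy g (q : Measure (Space d)) →
      Integrable V (q : Measure (Space d)) →
      0 ≤ interaction g q q - interaction g q μ₀ - interaction g μ₀ q + interaction g μ₀ μ₀ ∧
      interaction g q q - interaction g q μ₀ - interaction g μ₀ q + interaction g μ₀ μ₀ ≤
        interaction g q q + ∫ x, V x ∂(q : Measure (Space d)) - e ∧
      Integrable h (q : Measure (Space d)) ∧ (∫ x, h x ∂(q : Measure (Space d))) ^ 2 ≤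
        L ^ 2 * c * (interaction g q q + ∫ x, V x ∂(q : Measure (Space d)) - e) := by
    intro q hqE hqV
    have h1 := hg.energy_sub_add_setIntegral_le hv hμ₀ hμ₀E hμ₀V he hqE hqV hball
    have h2 := (hg.negSobolevSq_le hqE hμ₀E).1
    have h3 : 0 ≤ ∫ x in (Metric.closedBall (0 : Space d) R)ᶜ, (V x - (2 * K + 2 * e + v))
        ∂(q : Measure (Space d)) :=
      setIntegral_nonneg hball.compl fun x hx =>
        sub_nonneg.2 (hVR x (by simpa using hx))
    obtain ⟨hi, h4⟩ := integrable_and_sq_integral_le (μ := (q : Measure (Space d)))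
      (W := fun x => L ^ 2 * c * (V x - (2 * K + 2 * e + v)))
      hhc.aestronglyMeasurable hball ((hqV.sub (integrable_const _)).const_mul _)
      (fun x hx => by simp only [hh]; rw [hFeq x (by simpa using hx), sub_self])
      (fun x hx => by
        refine (sq_le_sq.2 (hFle x)).trans ?_
        rw [mul_assoc]
        exact hfV x (by simpa using hx))
    rw [integral_const_mul] at h4
    refine ⟨h2, by linarith, hi, h4.trans ?_⟩
    gcongr
    linarith
  obtain ⟨-, -, hi₀, ht₀⟩ := htail μ₀ hμ₀E hμ₀V
  obtain ⟨hE0, hED, hi, ht⟩ := htail μ hμE hμV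
  -- The tail estimate for `μ₀` itself, whose excess is zero, shows that `h` has zero integral
  -- against `μ₀`.
  have hz : ∫ x, h x ∂(μ₀ : Measure (Space d)) = 0 := by
    rw [he, sub_self, mul_zero] at ht₀
    exact pow_eq_zero_iff two_ne_zero |>.1 (le_antisymm ht₀ (sq_nonneg _))
  have hInt : ∀ q : ProbabilityMeasure (Space d), Integrable h (q : Measure (Space d)) →
      Integrable f (q : Measure (Space d)) ∧ ∫ x, f x ∂(q : Measure (Space d)) =
        ∫ x, F x ∂(q : Measure (Space d)) + ∫ x, h x ∂(q : Measure (Space d)) + f 0 := by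
    intro q hq
    refine ⟨(((hFi q).add hq).add (integrable_const (f 0))).congr
      (ae_of_all _ fun x => (hfh x).symm), ?_⟩
    have hFh : Integrable (fun x => F x + h x) (q : Measure (Space d)) := (hFi q).add hq
    rw [integral_congr_ae (ae_of_all _ hfh), integral_add hFh (integrable_const _),
      integral_add (hFi q) hq]
    simp
  refine ⟨(hInt μ hi).1, (hInt μ₀ hi₀).1, ?_⟩
  rw [(hInt μ hi).2, (hInt μ₀ hi₀).2, hz]
  have hmain := hSb F _ hF μ μ₀ hμE hμ₀E
  set E := interaction g μ μ - interaction g μ μ₀ - interaction g μ₀ μ + interaction g μ₀ μ₀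
  set X := interaction g μ μ + ∫ x, V x ∂(μ : Measure (Space d)) - e
  set a := ∫ x, F x ∂(μ : Measure (Space d))
  set b := ∫ x, F x ∂(μ₀ : Measure (Space d))
  set r := ∫ x, h x ∂(μ : Measure (Space d))
  have e1 : S * (L * (2 * R + 4) ^ (α - β) * (1 + 2 * (2 * R + 4) ^ β)) ^ 2 * E =
      S * T ^ 2 * L ^ 2 * E := by rw [hT]; ring
  rw [e1] at hmain
  have e2 : S * T ^ 2 * L ^ 2 * E ≤ S * T ^ 2 * L ^ 2 * X := by gcongr
  have e3 : 0 ≤ X * L ^ 2 := mul_nonneg (hE0.trans hED) (sq_nonneg _)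
  have e4 : (a + r + f 0 - (b + 0 + f 0)) ^ 2 ≤ 2 * (a - b) ^ 2 + 2 * r ^ 2 := by
    nlinarith [sq_nonneg (a - b - r)]
  linarith

/-- A quadratic bound for dual norms in terms of the energy excess. -/
lemma exists_iSup_sq_le (hg : SharpKernelBounds s g ghat C₁ C₂ C A K) (hs1 : s < 1) {α : ℝ≥0}
    (hα : s < (α : ℝ)) (hVc : Continuous V)
    (hVt : Tendsto V (cocompact (Space d)) atTop) (N : C(Space d, ℝ) → ℝ≥0∞)
    (hαN : ∀ f : C(Space d, ℝ), eHolderNorm α f ≤ N f)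
    (hN : ∀ B : ℝ, ∃ R c : ℝ, 0 ≤ R ∧ 0 ≤ c ∧ (∀ x, R < ‖x‖ → B ≤ V x) ∧
      ∀ f, N f < ⊤ → ∀ x, R < ‖x‖ → (f x - f 0) ^ 2 ≤ (N f).toReal ^ 2 * (c * (V x - B))) :
    ∃ D : ℝ, 0 < D ∧ ∀ μ₀ : ProbabilityMeasure (Space d), IsEquilibriumMeasure g V μ₀ →
      ∀ μ : ProbabilityMeasure (Space d),
        (((⨆ (f : C(Space d, ℝ)) (_ : N f < ⊤),
          (sintegral f (toSigned μ - toSigned μ₀)).toENNReal / N f) ^ 2 : ℝ≥0∞) : EReal) ≤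
        (D : EReal) * (energyV g V μ - energyV g V μ₀) := by
  -- The threshold involves the minimal energy `e`, so one minimizer is fixed beforehand; if there
  -- is none the claim is vacuous.
  by_cases hex : ∃ μ₁ : ProbabilityMeasure (Space d), IsEquilibriumMeasure g V μ₁
  swap
  · exact ⟨1, one_pos, fun μ₀ hμ₀ => (hex ⟨μ₀, hμ₀⟩).elim⟩
  obtain ⟨μ₁, hμ₁⟩ := hex
  obtain ⟨x₁, hx₁⟩ := hVc.exists_forall_le hVt
  have hv : ∀ x, -(-V x₁) ≤ V x := fun x => by simpa using hx₁ x
  obtain ⟨hμ₁E, hμ₁V⟩ := hg.of_energyV_ne_top hVc.measurable hv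
    (hg.energyV_ne_top_of_isEquilibriumMeasure hVc hμ₁)
  obtain ⟨e, he⟩ : ∃ e, interaction g μ₁ μ₁ + ∫ x, V x ∂(μ₁ : Measure (Space d)) = e := ⟨_, rfl⟩
  obtain ⟨R, c, hR, hc, hVR, hfN⟩ := hN (2 * K + 2 * e + (-V x₁))
  obtain ⟨D, hD, hmain⟩ := hg.exists_sq_integral_sub_equilibrium_le hs1 hα hv hR hc hVR
  refine ⟨D, hD, fun μ₀ hμ₀ μ => ?_⟩
  obtain ⟨hμ₀E, hμ₀V⟩ := hg.of_energyV_ne_top hVc.measurable hv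
    (hg.energyV_ne_top_of_isEquilibriumMeasure hVc hμ₀)
  -- Every minimizer has the same energy, so the constants obtained from `μ₁` serve for `μ₀`.
  have he₀ : interaction g μ₀ μ₀ + ∫ x, V x ∂(μ₀ : Measure (Space d)) = e := by
    have h := le_antisymm (hμ₀ μ₁) (hμ₁ μ₀)
    rw [hg.energyV_eq hμ₀E hμ₀V, hg.energyV_eq hμ₁E hμ₁V, EReal.coe_eq_coe_iff] at h
    rw [h, he]
  have hμ₀e := hg.energyV_eq hμ₀E hμ₀V
  rw [he₀] at hμ₀e
  by_cases htop : energyV g V μ = ⊤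
  · rw [htop, hμ₀e, EReal.top_sub_coe, EReal.coe_mul_top_of_pos hD]
    exact le_top
  obtain ⟨hμE, hμV⟩ := hg.of_energyV_ne_top hVc.measurable hv htop
  have hle := hμ₀ μ
  rw [hμ₀e, hg.energyV_eq hμE hμV] at hle ⊢
  rw [EReal.coe_le_coe_iff] at hle
  rw [← EReal.coe_sub, ← EReal.coe_mul]
  refine iSup_sintegral_div_sq_le N _ (mul_nonneg hD.le (sub_nonneg.2 hle)) fun f hf => ?_
  have hfα : eHolderNorm α f < ⊤ := (hαN f).trans_lt hf
  obtain ⟨hi, hi₀, hb⟩ := hmain μ₀ hμ₀ hμ₀E hμ₀V he₀ μ hμE hμV f f.continuous (N f).toReal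
    ENNReal.toReal_nonneg (fun x y => by
      refine (abs_sub_le_of_eHolderNorm hfα x y).trans ?_
      rw [dist_eq_norm]
      gcongr
      exacts [hf.ne, hαN f]) (hfN f hf)
  exact ⟨_, sintegral_toSigned_sub μ μ₀ hi hi₀, hb⟩

end SharpKernelBounds

/-! ### Growth of test functions against the potential -/

lemma exists_lt_norm_of_eventually_cocompact {d : ℕ} {P : Space d → Prop}
    (h : ∀ᶠ x in cocompact (Space d), P x) : ∃ R : ℝ, 0 ≤ R ∧ ∀ x, R < ‖x‖ → P x := by
  rw [← Metric.cobounded_eq_cocompact, ← comap_norm_atTop] at h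
  obtain ⟨R, -, hR⟩ := (atTop_basis_Ioi.comap _).eventually_iff.1 h
  refine ⟨max R 0, le_max_right _ _, fun x hx => hR ((le_max_left R 0).trans_lt hx)⟩

lemma exists_sq_sub_le_fullHolderNorm {d : ℕ} {V : Space d → ℝ}
    (hVt : Tendsto V (cocompact (Space d)) atTop) (α : ℝ≥0) (B : ℝ) :
    ∃ R c : ℝ, 0 ≤ R ∧ 0 ≤ c ∧ (∀ x, R < ‖x‖ → B ≤ V x) ∧
      ∀ f : C(Space d, ℝ), fullHolderNorm α f < ⊤ → ∀ x, R < ‖x‖ →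
        (f x - f 0) ^ 2 ≤ (fullHolderNorm α f).toReal ^ 2 * (c * (V x - B)) := by
  obtain ⟨R, hR, hVR⟩ :=
    exists_lt_norm_of_eventually_cocompact (hVt.eventually_ge_atTop (B + 1))
  -- Outside the ball `V - B ≥ 1`, while `|f x - f 0|` is at most twice the norm; hence the constant
  -- `4`.
  refine ⟨R, 4, hR, by norm_num, fun x hx => by linarith [hVR x hx], fun f hf x hx => ?_⟩
  have hsup : ∀ y, |f y| ≤ (fullHolderNorm α f).toReal := fun y => by
    have h1 : ‖f y‖ₑ ≤ fullHolderNorm α f := (le_iSup (fun y => ‖f y‖ₑ) y).trans le_add_self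
    simpa using ENNReal.toReal_mono hf.ne h1
  set N := (fullHolderNorm α f).toReal
  have h1 : |f x - f 0| ≤ 2 * N := (abs_sub _ _).trans (by linarith [hsup x, hsup 0])
  have h2 : (f x - f 0) ^ 2 ≤ (2 * N) ^ 2 := sq_le_sq' (abs_le.1 h1).1 (abs_le.1 h1).2
  have h3 := hVR x hx
  nlinarith [sq_nonneg N]

lemma exists_sq_sub_le_eHolderNorm {d : ℕ} {V : Space d → ℝ}
    (hVt : Tendsto V (cocompact (Space d)) atTop) {α : ℝ≥0}
    (hlim : 0 < liminf (fun x => ((V x / ‖x‖ ^ (2 * (α : ℝ)) : ℝ) : EReal))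
      (cocompact (Space d))) (B : ℝ) :
    ∃ R c : ℝ, 0 ≤ R ∧ 0 ≤ c ∧ (∀ x, R < ‖x‖ → B ≤ V x) ∧
      ∀ f : C(Space d, ℝ), eHolderNorm α f < ⊤ → ∀ x, R < ‖x‖ →
        (f x - f 0) ^ 2 ≤ (eHolderNorm α f).toReal ^ 2 * (c * (V x - B)) := by
  obtain ⟨δ, hδ0, hδ⟩ := EReal.lt_iff_exists_real_btwn.1 hlim
  have hδ0' : 0 < δ := EReal.coe_pos.1 hδ0
  have h1 := eventually_lt_of_lt_liminf hδ
  obtain ⟨R, hR, hVR⟩ := exists_lt_norm_of_eventually_cocompact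
    (h1.and (hVt.eventually_ge_atTop (2 * |B|)))
  -- Outside the ball `V ≥ δ ‖x‖^(2α)`, and `V ≥ 2|B|` gives `V - B ≥ V/2`; hence the constant `2 /
  -- δ`.
  refine ⟨R, 2 / δ, hR, by positivity, fun x hx => ?_, fun f hf x hx => ?_⟩
  · linarith [(hVR x hx).2, le_abs_self B, abs_nonneg B]
  · obtain ⟨h2, h3⟩ := hVR x hx
    rw [EReal.coe_lt_coe_iff] at h2
    have hx0 : 0 < ‖x‖ := hR.trans_lt hx
    rw [lt_div_iff₀ (by positivity)] at h2
    have h4 := abs_sub_le_of_eHolderNorm hf x 0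
    rw [dist_zero_right] at h4
    set N := (eHolderNorm α f).toReal
    have h5 : (f x - f 0) ^ 2 ≤ (N * ‖x‖ ^ (α : ℝ)) ^ 2 := sq_le_sq' (abs_le.1 h4).1 (abs_le.1 h4).2
    refine h5.trans ?_
    rw [mul_pow]
    gcongr
    have h6 : (‖x‖ ^ (α : ℝ)) ^ 2 = ‖x‖ ^ (2 * (α : ℝ)) := by
      rw [mul_comm, Real.rpow_mul hx0.le, Real.rpow_two]
    rw [h6, div_mul_eq_mul_div, le_div_iff₀ hδ0']
    linarith [le_abs_self B]

end RieszGas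

end

/-! ### Assembly of the three estimates -/

theorem theoremT (d : ℕ) (s : ℝ) (hs : s ∈ Set.Ioo (0 : ℝ) (min 1 ((d : ℝ) / 2)))
    (g : RieszGas.Space d → ℝ) (hg : RieszGas.IsRieszType d s g)
    (α : ℝ≥0) (hα : s < (α : ℝ)) :
    (∀ Ω : Set (RieszGas.Space d), IsCompact Ω →
      ∃ C : ℝ, 0 < C ∧ ∀ μ ν : ProbabilityMeasure Ω,
        ((RieszGas.dualHolderSeminorm α (RieszGas.toSigned μ - RieszGas.toSigned ν) ^ 2 : ℝ≥0∞) :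
            EReal) ≤
          (C : EReal) * RieszGas.energy g
            ((RieszGas.toSigned μ - RieszGas.toSigned ν).map Subtype.val)) ∧
    (∀ V : RieszGas.Space d → ℝ, RieszGas.Admissible g V →
      (∃ C : ℝ, 0 < C ∧ ∀ μ_inf : ProbabilityMeasure (RieszGas.Space d),
        RieszGas.IsEquilibriumMeasure g V μ_inf →
        ∀ μ : ProbabilityMeasure (RieszGas.Space d),
          ((RieszGas.dualHolderNorm α (RieszGas.toSigned μ - RieszGas.toSigned μ_inf) ^ 2 : ℝ≥0∞) :
              EReal) ≤
            (C : EReal) * (RieszGas.energyV g V μ - RieszGas.energyV g V μ_inf)) ∧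
      (0 < liminf (fun x => ((V x / ‖x‖ ^ (2 * (α : ℝ)) : ℝ) : EReal))
          (cocompact (RieszGas.Space d)) →
        ∃ C : ℝ, 0 < C ∧ ∀ μ_inf : ProbabilityMeasure (RieszGas.Space d),
          RieszGas.IsEquilibriumMeasure g V μ_inf →
          ∀ μ : ProbabilityMeasure (RieszGas.Space d),
            ((RieszGas.dualHolderSeminorm α
                (RieszGas.toSigned μ - RieszGas.toSigned μ_inf) ^ 2 : ℝ≥0∞) : EReal) ≤
              (C : EReal) * (RieszGas.energyV g V μ - RieszGas.energyV g V μ_inf))) := by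
  obtain ⟨g₀, ghat, C₁, C₂, C, A, K, hg₀, hgg⟩ := hg.exists_bounds hs
  have hs1 : s < 1 := hs.2.trans_le (min_le_left _ _)
  -- Replacing `g` by its normalization changes no energy, hence no minimizer, since the two differ
  -- at most at the origin, where the kernel is set to `⊤`.
  have hE : ∀ κ, RieszGas.energy g κ = RieszGas.energy g₀ κ := RieszGas.energy_congr hgg
  have hEV : ∀ V μ, RieszGas.energyV g V μ = RieszGas.energyV g₀ V μ := fun V μ => by
    rw [RieszGas.energyV, hE, RieszGas.energyV]
  have hEq : ∀ V μ, RieszGas.IsEquilibriumMeasure g V μ → RieszGas.IsEquilibriumMeasure g₀ V μ :=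
    fun V μ h ν => by
      rw [← hEV, ← hEV]
      exact h ν
  refine ⟨fun Ω hΩ => ?_, fun V hV => ⟨?_, fun hlim => ?_⟩⟩
  · obtain ⟨D, hD, h⟩ := hg₀.exists_dualHolderSeminorm_sq_le hs1 hα hΩ
    refine ⟨D, hD, fun μ ν => ?_⟩
    rw [hE]
    exact h μ ν
  · obtain ⟨D, hD, h⟩ := hg₀.exists_iSup_sq_le hs1 hα hV.contDiff.continuous hV.tendsto
      (fun f => RieszGas.fullHolderNorm α f) (fun f => le_self_add)
      (RieszGas.exists_sq_sub_le_fullHolderNorm hV.tendsto α)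
    refine ⟨D, hD, fun μ₀ hμ₀ μ => ?_⟩
    rw [hEV, hEV]
    exact h μ₀ (hEq V μ₀ hμ₀) μ
  · obtain ⟨D, hD, h⟩ := hg₀.exists_iSup_sq_le hs1 hα hV.contDiff.continuous hV.tendsto
      (fun f => eHolderNorm α f) (fun f => le_rfl)
      (RieszGas.exists_sq_sub_le_eHolderNorm hV.tendsto hlim)
    refine ⟨D, hD, fun μ₀ hμ₀ μ => ?_⟩
    rw [hEV, hEV]
    exact h μ₀ (hEq V μ₀ hμ₀) μ
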